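/- **Setting.** An open book $\mathcal L$ consists of countably many *bindings* $B_j$, each isometric to $[0,L_j]$ with $L_j\in(0,\infty]$, and countably many *pages* $P_k$, each isometric to $[0,L_k^1]\times[0,L_k^2]$ with $L_k^1,L_k^2\in(0,\infty]$ (an interval $[0,\infty]$ is read as $[0,\infty)$). Every side of every page is identified isometrically with a binding, different sides of one page lying on different bindings; one binding may carry sides of several pages. A function $u$ on $\mathcal L$ is a family $(u_k)$ of functions $u_k:P_k\to\mathbb C$, and $L^2(\mathcal L)=\bigoplus_k L^2(P_k)$, $H^s(\mathcal L)=\bigoplus_k H^s(P_k)$ (Hilbert sums). $H^1_D(\mathcal L)$ is the set of $u\in H^1(\mathcal L)$ whose traces, on each binding, from all incident pages coincide. $H$ is the self-adjoint operator on $L^2(\mathcal L)$ associated with the form $Q(u)=\sum_k\int_{P_k}|\nabla u_k|^2$ with domain $H^1_D(\mathcal L)$: $u\in D(H)$ and $Hu=w\in L^2(\mathcal L)$ if and only if $u\in H^1_D(\mathcal L)$ and $\operatorname{Re}\sum_k\int_{P_k} w_k\bar v_k=\operatorname{Re}\sum_k\int_{P_k}\nabla u_k\cdot\nabla\bar v_k$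 for all $v\in H^1_D(\mathcal L)$. **Proposition (exponential decay).** Let $\mathcal L$ be an open book, $p>1$, $\omega>0$, and let $u\in H^1_D(\mathcal L)$ be a solution of $$Hu+\omega u-|u|^{p-1}u=0 .$$ Assume that $\inf_j L_j>0$ (for instance, that $\mathcal L$ has finitely many bindings), or that $u\in H^2(\mathcal L)$. Then for every page $P_k$ with $L_k^1=\infty$ (resp. $L_k^2=\infty$) there exists $M_k>0$ such that $$|u_k(x,y)|\le M_k e^{-\frac{\sqrt\omega}{2}|x|}\qquad\Bigl(\text{resp. } |u_k(x,y)|\le M_k e^{-\frac{\sqrt\omega}{2}|y|}\Bigr)$$ for almost every $(x,y)\in[0,L_k^1]\times[0,L_k^2]$, and at every point of $[0,L_k^1]\times[0,L_k^2]$ at which a representative of $u_k$ is continuous. -/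

import Mathlib

open MeasureTheory Filter Topology Set
open scoped ENNReal

/-- The four possible sides of a rectangle `[0,a] × [0,b]`:
`{0} × [0,b]`, `{a} × [0,b]`, `[0,a] × {0}`, `[0,a] × {b}`. -/
inductive Side
  | west
  | east
  | south
  | north

/-- The open rectangle `(0,a) × (0,b)`, where `a` and `b` may be infinite. -/
def openRect (a b : ℝ≥0∞) : Set (ℝ × ℝ) :=
  {z | 0 < z.1 ∧ ENNReal.ofReal z.1 < a ∧ 0 < z.2 ∧ ENNReal.ofReal z.2 < b}

/-- The rectangle `[0,a] × [0,b]`, where `[0,∞]` is read as `[0,∞)`. -/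
def closedRect (a b : ℝ≥0∞) : Set (ℝ × ℝ) :=
  {z | 0 ≤ z.1 ∧ ENNReal.ofReal z.1 ≤ a ∧ 0 ≤ z.2 ∧ ENNReal.ofReal z.2 ≤ b}

namespace Side

/-- The sides which the rectangle with side lengths `a`, `b` in `(0,∞]` really has. -/
def Present (a b : ℝ≥0∞) : Side → Prop
  | west => True
  | east => a ≠ ∞
  | south => True
  | north => b ≠ ∞

/-- The length of a side. -/
def length (a b : ℝ≥0∞) : Side → ℝ≥0∞
  | west => b
  | east => b
  | south => a
  | north => a

/-- The distance of a point of the rectangle to the line that carries the side. -/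
def depth (a b : ℝ≥0∞) : Side → ℝ × ℝ → ℝ
  | west, z => z.1
  | east, z => a.toReal - z.1
  | south, z => z.2
  | north, z => b.toReal - z.2

/-- The coordinate along the side. -/
def along : Side → ℝ × ℝ → ℝ
  | west, z => z.2
  | east, z => z.2
  | south, z => z.1
  | north, z => z.1

end Side

/-- An open book with bindings indexed by `J` and pages indexed by `K`. Every side of every page is
identified isometrically with a binding: `flip k s` says that the arclength parameter of the binding
runs against the coordinate along the side (possible only for a side of finite length). -/
structure OpenBook (J K : Type*) where
  /-- the length of a binding -/
  len : J → ℝ≥0∞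
  len_pos : ∀ j, 0 < len j
  /-- the two lengths of a page -/
  len₁ : K → ℝ≥0∞
  len₂ : K → ℝ≥0∞
  len₁_pos : ∀ k, 0 < len₁ k
  len₂_pos : ∀ k, 0 < len₂ k
  /-- the binding on which a side of a page lies; only the values at present sides matter -/
  binding : K → Side → J
  /-- the orientation of a side with respect to its binding -/
  flip : K → Side → Prop
  binding_injOn : ∀ k, InjOn (binding k) {s | s.Present (len₁ k) (len₂ k)}
  len_binding : ∀ k s, s.Present (len₁ k) (len₂ k) →
    len (binding k s) = s.length (len₁ k) (len₂ k)
  flip_finite : ∀ k s, s.Present (len₁ k) (len₂ k) → flip k s → len (binding k s) ≠ ∞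

namespace OpenBook

noncomputable section

variable {J K : Type*} (L : OpenBook J K)

/-- The open page `(0,L¹) × (0,L²)`. -/
def page (k : K) : Set (ℝ × ℝ) := openRect (L.len₁ k) (L.len₂ k)

/-- The page `[0,L¹] × [0,L²]` with its sides. -/
def closedPage (k : K) : Set (ℝ × ℝ) := closedRect (L.len₁ k) (L.len₂ k)

/-- The side `s` of the page `k` exists and lies on the binding `j`. -/
def Incident (k : K) (s : Side) (j : J) : Prop :=
  s.Present (L.len₁ k) (L.len₂ k) ∧ L.binding k s = j

/-- The lower bound `½ min (inf of the binding lengths, 1)` on the lengths of the bindings. -/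
def minLength : ℝ≥0∞ := 2⁻¹ * min (⨅ j, L.len j) 1

/-- The square integrable functions on the book, `⊕ L²(P)` over the pages `P`. A function on the
book is a family of functions on its pages, of which only the values inside the pages matter. -/
def MemL2 (u : K → ℝ × ℝ → ℂ) : Prop :=
  (∀ k, AEStronglyMeasurable (u k) (volume.restrict (L.page k))) ∧
    ∑' k, ∫⁻ z in L.page k, ‖u k z‖ₑ ^ 2 < ∞

/-- The real scalar product `Re ∑ ∫ u v̄` of `L²` functions on the book. -/
def scalar (u v : K → ℝ × ℝ → ℂ) : ℝ :=
  ∑' k, ∫ z in L.page k, inner ℝ (u k z) (v k z)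

/-- `g` is, on every page, the weak derivative of `u` in the direction `e`. -/
def HasWeakDeriv (e : ℝ × ℝ) (u g : K → ℝ × ℝ → ℂ) : Prop :=
  ∀ k, ∀ φ : ℝ × ℝ → ℝ, ContDiff ℝ ((⊤ : ℕ∞) : WithTop ℕ∞) φ → HasCompactSupport φ → tsupport φ ⊆ L.page k →
    ∫ z in L.page k, fderiv ℝ φ z e • u k z = -∫ z in L.page k, φ z • g k z

/-- `u ∈ H¹` of the book, with weak gradient `(p, q)`. -/
def IsH1 (u p q : K → ℝ × ℝ → ℂ) : Prop :=
  L.MemL2 u ∧ L.MemL2 p ∧ L.MemL2 q ∧ L.HasWeakDeriv (1, 0) u p ∧ L.HasWeakDeriv (0, 1) u q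

/-- `u ∈ H¹` of the book (no condition at the bindings). -/
def MemH1 (u : K → ℝ × ℝ → ℂ) : Prop := ∃ p q, L.IsH1 u p q

/-- `u ∈ H²` of the book (no condition at the bindings). -/
def MemH2 (u : K → ℝ × ℝ → ℂ) : Prop := ∃ p q, L.IsH1 u p q ∧ L.MemH1 p ∧ L.MemH1 q

/-- `τ`, a function of the coordinate along the side, is the trace of `u` on the side `s` of the
page `k`: it is in `L²` of the side, and the mean of `|u - τ|²` over the strip of width `δ` along
the side, integrated along the side, tends to `0` with `δ`. Every `H¹` function has exactly one such
`τ` up to null sets, which for a function that is smooth up to the side is its restriction. -/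
def HasTrace (u : K → ℝ × ℝ → ℂ) (k : K) (s : Side) (τ : ℝ → ℂ) : Prop :=
  MemLp τ 2 (volume.restrict {t | 0 < t ∧ ENNReal.ofReal t < s.length (L.len₁ k) (L.len₂ k)}) ∧
  Tendsto
    (fun δ : ℝ => (ENNReal.ofReal δ)⁻¹ *
      ∫⁻ z in {z ∈ L.page k | s.depth (L.len₁ k) (L.len₂ k) z < δ}, ‖u k z - τ (s.along z)‖ₑ ^ 2)
    (𝓝[>] 0) (𝓝 0)

open Classical in
/-- The arclength parameter on its binding of the point of the side `s` of the page `k` with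
coordinate `t`. -/
def param (k : K) (s : Side) (t : ℝ) : ℝ :=
  if L.flip k s then (L.len (L.binding k s)).toReal - t else t

/-- The traces of `u` from all the pages incident to a binding coincide, for every binding. -/
def TracesAgree (u : K → ℝ × ℝ → ℂ) : Prop :=
  ∀ j, ∃ τ : ℝ → ℂ, ∀ k s, L.Incident k s j → L.HasTrace u k s fun t => τ (L.param k s t)

/-- `u ∈ H¹_D` of the book, with weak gradient `(p, q)`. -/
def IsH1D (u p q : K → ℝ × ℝ → ℂ) : Prop := L.IsH1 u p q ∧ L.TracesAgree u

/-- `u ∈ D(H)` and `H u = w`, where `H` is the self-adjoint operator on `L²` of the book that is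
associated with the quadratic form `Q(u) = ∫ |∇u|²` with domain `H¹_D`. -/
def LaplacianEq (u w : K → ℝ × ℝ → ℂ) : Prop :=
  L.MemL2 w ∧ ∃ p q, L.IsH1D u p q ∧
    ∀ v p' q', L.IsH1D v p' q' → L.scalar w v = L.scalar p p' + L.scalar q q'

/-- `u` solves the stationary nonlinear Schrödinger equation `H u + ω u - |u|^(p-1) u = 0`. -/
def SolvesNLS (ω p : ℝ) (u : K → ℝ × ℝ → ℂ) : Prop :=
  ∃ w, L.LaplacianEq u w ∧
    ∀ k, ∀ᵐ z ∂volume.restrict (L.page k),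
      w k z + (ω : ℂ) * u k z - ((‖u k z‖ ^ (p - 1) : ℝ) : ℂ) * u k z = 0

/-- The page function `f` is bounded by `b` on the page `k`: almost everywhere, and at every point
of the page, sides included, at which a representative of `f` is continuous. -/
def BoundedOnPage (k : K) (f : ℝ × ℝ → ℂ) (b : ℝ × ℝ → ℝ) : Prop :=
  (∀ᵐ z ∂volume.restrict (L.page k), ‖f z‖ ≤ b z) ∧
  ∀ g : ℝ × ℝ → ℂ, g =ᵐ[volume.restrict (L.page k)] f →
    ∀ z ∈ L.closedPage k, ContinuousWithinAt g (L.page k) z → ‖g z‖ ≤ b z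

end

end OpenBook

/-! The height of a point of a page is the sum of its coordinates in the infinite directions. On a
side of infinite length it is the arclength parameter of the binding, on a side of finite length it
is zero. Hence multiplying `u` by a function `G` of the height and of `|u|` keeps the traces from
all pages equal (`isH1D_cut`). If `G` vanishes at height zero, finite bindings carry zero traces, so
one may keep only a family of pages that is closed under sharing an infinite binding: a component.
Everything about `u` is extracted by testing the equation with such products
(`IsSolution.integral_energyDensity`).

Decay at infinity comes from a De Giorgi iteration. A truncation of `|u|` at level `t` and height
`R` has its energy controlled by its `L²` norm and that of `w = Hu`; no growth condition on the
nonlinearity enters, only `w ∈ L²`. With the embedding of `W^{1,1}` into `L²` this bounds the excess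
at a higher level by a power larger than one of the excess at a lower level
(`IsSolution.excess_sq_le`), so a small excess forces `|u| ≤ t` further out
(`IsSolution.exists_forall_ae_le`). At large height the excess is small for every `t > 0`.

The embedding needs care, since the pages of a component may be arbitrarily narrow and no uniform
constant holds page by page. Values on neighbouring pages agree along infinite bindings, however, so
a bound on one page of positive width propagates through the component at the cost of the total
variation over all pages (`ofReal_le_of_mem_component`, `sobolevOn_component`).

Once `|u|` is so small that `|u|^(p-1) ≤ ω/4`, it is compared with the barrier `ψ = m exp(-b (height
- R - 1))`, `b = √ω/2`. A page may be infinite in both directions, so `Δψ ≤ 2b²ψ`, whereas the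
equation provides the coefficient `ω - ω/4 = 3b²`; the remaining `b²` forces `|u| ≤ ψ`
(`IsSolution.ae_le_exp`). The barrier decreases away from the bindings, so its boundary terms have
the favourable sign.

None of this uses the alternative on binding lengths or `H²`. That alternative only bounds `u` on
the given page at bounded height: by the same iteration on all pages with a large level, or by
integrating along lines in both directions (`MemH2.exists_bound`). The chain rule, the values at the
sides and the embedding all rest on representing an `H¹` function as a primitive along almost every
line (`exists_isVertPrimitive`). -/

/-! ### Primitives of locally integrable functions -/

/-- A function whose increments are dominated by those of an absolutely continuous one is absolutely
continuous. -/
theorem AbsolutelyContinuousOnInterval.of_dist_le {X Y : Type*} [PseudoMetricSpace X]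
    [PseudoMetricSpace Y] {f : ℝ → X} {θ : ℝ → Y} {a b : ℝ}
    (hθ : AbsolutelyContinuousOnInterval θ a b)
    (h : ∀ x ∈ uIcc a b, ∀ y ∈ uIcc a b, dist (f x) (f y) ≤ dist (θ x) (θ y)) :
    AbsolutelyContinuousOnInterval f a b := by
  rw [absolutelyContinuousOnInterval_iff] at hθ ⊢
  intro ε hε
  obtain ⟨δ, hδ, H⟩ := hθ ε hε
  refine ⟨δ, hδ, fun E hE hlt => lt_of_le_of_lt (Finset.sum_le_sum fun i hi => ?_) (H E hE hlt)⟩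
  exact h _ (hE.1 i hi).1 _ (hE.1 i hi).2

theorem MeasureTheory.LocallyIntegrable.intervalIntegrable_real {E : Type*} [NormedAddCommGroup E]
    {g : ℝ → E} (hg : LocallyIntegrable g) (a b : ℝ) : IntervalIntegrable g volume a b :=
  (hg.integrableOn_isCompact isCompact_uIcc).intervalIntegrable

theorem absolutelyContinuousOnInterval_of_norm_sub_le {E : Type*} [NormedAddCommGroup E]
    {f : ℝ → E} {θ : ℝ → ℝ} (hθ : LocallyIntegrable θ) (hθ0 : ∀ x, 0 ≤ θ x) {M : ℝ} (hM : -M ≤ M)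
    (h : ∀ x ∈ Icc (-M) M, ∀ y ∈ Icc (-M) M, x ≤ y → ‖f y - f x‖ ≤ ∫ s in x..y, θ s) :
    AbsolutelyContinuousOnInterval f (-M) M := by
  have hac := (hθ.intervalIntegrable_real (-M) M).absolutelyContinuousOnInterval_intervalIntegral
    (c := -M) left_mem_uIcc
  refine hac.of_dist_le fun x hx y hy => ?_
  rw [uIcc_of_le hM] at hx hy
  have key : ∀ x ∈ Icc (-M) M, ∀ y ∈ Icc (-M) M, x ≤ y → dist (f x) (f y) ≤
      dist (∫ s in (-M)..x, θ s) (∫ s in (-M)..y, θ s) := by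
    intro x hx y hy hxy
    have h1 := intervalIntegral.integral_add_adjacent_intervals
      (hθ.intervalIntegrable_real (-M) x) (hθ.intervalIntegrable_real x y)
    rw [dist_comm, dist_eq_norm, dist_comm, dist_eq_norm, ← h1, add_sub_cancel_left,
      Real.norm_of_nonneg (intervalIntegral.integral_nonneg hxy fun s _ => hθ0 s)]
    exact h x hx y hy hxy
  rcases le_total x y with hxy | hxy
  · exact key x hx y hy hxy
  · rw [dist_comm, dist_comm (∫ s in (-M)..x, θ s)]
    exact key y hy x hx hxy

/-- The chain rule for the composition of a `C¹` map with the primitive of a locally integrable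
function. -/
theorem ContDiff.comp_primitive {V E : Type*} [NormedAddCommGroup V] [NormedSpace ℝ V]
    [ProperSpace V] [CompleteSpace V] [NormedAddCommGroup E] [NormedSpace ℝ E] [CompleteSpace E]
    {F : V → E} (hF : ContDiff ℝ 1 F) {f g : ℝ → V} (hg : LocallyIntegrable g)
    (hf : ∀ y, f y = f 0 + ∫ s in (0 : ℝ)..y, g s) :
    LocallyIntegrable (fun s => fderiv ℝ F (f s) (g s)) ∧
      ∀ y, F (f y) = F (f 0) + ∫ s in (0 : ℝ)..y, fderiv ℝ F (f s) (g s) := by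
  have hfc : Continuous f := by
    have : f = fun y => f 0 + ∫ s in (0 : ℝ)..y, g s := funext hf
    rw [this]
    exact continuous_const.add
      (intervalIntegral.continuous_primitive (fun a b => hg.intervalIntegrable_real a b) 0)
  have hDc : Continuous fun s => fderiv ℝ F (f s) :=
    (hF.continuous_fderiv one_ne_zero).comp hfc
  have hloc : LocallyIntegrable (fun s => fderiv ℝ F (f s) (g s)) := by
    rw [locallyIntegrable_iff]
    intro k hk
    obtain ⟨B, hB⟩ := hk.exists_bound_of_continuousOn hDc.continuousOn
    have hi := hg.integrableOn_isCompact hk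
    refine Integrable.mono' (hi.norm.const_mul B) ?_ ?_
    · exact (isBoundedBilinearMap_apply (𝕜 := ℝ) (E := V) (F := E)).continuous
        |>.comp_aestronglyMeasurable
          (hDc.aestronglyMeasurable.prodMk hi.aestronglyMeasurable)
    · filter_upwards [ae_restrict_mem hk.measurableSet] with s hs
      exact (ContinuousLinearMap.le_opNorm _ _).trans
        (mul_le_mul_of_nonneg_right (hB s hs) (norm_nonneg _))
  refine ⟨hloc, fun y => ?_⟩
  set M := |y| with hMdef
  have hM0 : 0 ≤ M := abs_nonneg y
  have hM : -M ≤ M := by linarith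
  have hsub : ∀ x y, f y - f x = ∫ s in x..y, g s := by
    intro x y
    rw [hf x, hf y, add_sub_add_left_eq_sub, intervalIntegral.integral_interval_sub_left
      (hg.intervalIntegrable_real _ _) (hg.intervalIntegrable_real _ _)]
  -- The curve stays in a ball on a compact interval, and there `F` is Lipschitz with constant `B`.
  -- This dominates the increments of both sides by those of the primitive of `B * ‖g‖`.
  obtain ⟨r, hr⟩ := (isCompact_Icc (a := -M) (b := M)).exists_bound_of_continuousOn
    hfc.continuousOn
  obtain ⟨B, hB⟩ := (isCompact_closedBall (0 : V) r).exists_bound_of_continuousOn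
    (hF.continuous_fderiv one_ne_zero).continuousOn
  have hball : ∀ x ∈ Icc (-M) M, f x ∈ Metric.closedBall (0 : V) r := fun x hx => by
    simpa using hr x hx
  have hB0 : 0 ≤ B := (norm_nonneg _).trans (hB _ (hball 0 ⟨by linarith, hM0⟩))
  have hθ : LocallyIntegrable fun s => B * ‖g s‖ := by
    refine LocallyIntegrable.smul (f := fun s => ‖g s‖) (fun x => ?_) B
    obtain ⟨t, ht, hi⟩ := hg x
    exact ⟨t, ht, hi.norm⟩
  have hθ0 : ∀ s, 0 ≤ B * ‖g s‖ := fun s => by positivity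
  set P : ℝ → E := fun y => ∫ s in (0 : ℝ)..y, fderiv ℝ F (f s) (g s) with hP
  have hPsub : ∀ x y, P y - P x = ∫ s in x..y, fderiv ℝ F (f s) (g s) := fun x y =>
    intervalIntegral.integral_interval_sub_left
      (hloc.intervalIntegrable_real _ _) (hloc.intervalIntegrable_real _ _)
  have hac1 : AbsolutelyContinuousOnInterval (fun y => F (f y)) (-M) M := by
    refine absolutelyContinuousOnInterval_of_norm_sub_le hθ hθ0 hM fun x hx y hy hxy => ?_
    refine ((convex_closedBall (0 : V) r).norm_image_sub_le_of_norm_hasFDerivWithin_le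
      (fun v _ => (hF.differentiable one_ne_zero v).hasFDerivAt.hasFDerivWithinAt) hB
      (hball x hx) (hball y hy)).trans ?_
    rw [intervalIntegral.integral_const_mul, hsub]
    exact mul_le_mul_of_nonneg_left (intervalIntegral.norm_integral_le_integral_norm hxy) hB0
  have hac2 : AbsolutelyContinuousOnInterval P (-M) M := by
    refine absolutelyContinuousOnInterval_of_norm_sub_le hθ hθ0 hM fun x hx y hy hxy => ?_
    rw [hPsub]
    refine intervalIntegral.norm_integral_le_of_norm_le hxy ?_ (hθ.intervalIntegrable_real x y)
    refine Eventually.of_forall fun s hs => (ContinuousLinearMap.le_opNorm _ _).trans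
      (mul_le_mul_of_nonneg_right (hB _ (hball s ⟨?_, ?_⟩)) (norm_nonneg _))
    · exact hx.1.trans hs.1.le
    · exact hs.2.trans hy.2
  -- By Lebesgue differentiation both sides have the same derivative almost everywhere. Being
  -- absolutely continuous, they differ by a constant, which is read off at `0`.
  obtain ⟨c, hc⟩ := (hac1.sub hac2).const_of_ae_hasDerivAt_zero (by
    filter_upwards [LocallyIntegrable.ae_hasDerivAt_integral hg,
      LocallyIntegrable.ae_hasDerivAt_integral hloc] with s h1 h2 _
    have hd : HasDerivAt f (g s) s := by
      have : f = fun y => f 0 + ∫ s in (0 : ℝ)..y, g s := funext hf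
      rw [this]
      exact (h1 0).const_add _
    have := ((hF.differentiable one_ne_zero (f s)).hasFDerivAt.comp_hasDerivAt s hd).sub (h2 0)
    rw [sub_self] at this
    exact this)
  rw [uIcc_of_le hM] at hc
  have e0 := hc 0 ⟨by linarith, hM0⟩
  have ey := hc y ⟨neg_abs_le y, le_abs_self y⟩
  have hP0 : P 0 = 0 := by simp [hP]
  simp only [Pi.sub_apply] at e0 ey
  rw [hP0, sub_zero] at e0
  rw [e0, ← ey]
  simp [hP]

/-! ### Open rectangles -/

/-- The open interval `(0, a)`. -/
def ray (a : ℝ≥0∞) : Set ℝ := {t | 0 < t ∧ ENNReal.ofReal t < a}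

theorem isOpen_ray (a : ℝ≥0∞) : IsOpen (ray a) :=
  isOpen_Ioi.inter (isOpen_Iio.preimage ENNReal.continuous_ofReal)

theorem ordConnected_ray (a : ℝ≥0∞) : (ray a).OrdConnected :=
  ⟨fun _ hx _ hy _ hz => ⟨hx.1.trans_le hz.1,
    (ENNReal.ofReal_le_ofReal hz.2).trans_lt hy.2⟩⟩

theorem openRect_eq (a b : ℝ≥0∞) : openRect a b = ray a ×ˢ ray b := by
  ext z
  simp [openRect, ray, and_assoc]

theorem isOpen_openRect (a b : ℝ≥0∞) : IsOpen (openRect a b) := by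
  rw [openRect_eq]
  exact (isOpen_ray a).prod (isOpen_ray b)

theorem measurableSet_openRect (a b : ℝ≥0∞) : MeasurableSet (openRect a b) :=
  (isOpen_openRect a b).measurableSet

theorem measurableSet_ray (a : ℝ≥0∞) : MeasurableSet (ray a) := (isOpen_ray a).measurableSet

theorem restrict_openRect (a b : ℝ≥0∞) : (volume : Measure (ℝ × ℝ)).restrict (openRect a b) =
    ((volume : Measure ℝ).restrict (ray a)).prod ((volume : Measure ℝ).restrict (ray b)) := by
  rw [openRect_eq, Measure.prod_restrict]
  rfl

theorem Ioo_subset_ray {d : ℝ} {a : ℝ≥0∞} (h : ENNReal.ofReal d ≤ a) : Ioo 0 d ⊆ ray a :=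
  fun _ ht => ⟨ht.1, lt_of_lt_of_le
    ((ENNReal.ofReal_lt_ofReal_iff (ht.1.trans ht.2)).2 ht.2) h⟩

theorem exists_ofReal_le {a : ℝ≥0∞} (ha : 0 < a) :
    ∃ d : ℝ, 0 < d ∧ d ≤ 1 ∧ ENNReal.ofReal d ≤ a := by
  refine ⟨(min a 1).toReal, ENNReal.toReal_pos (by simp [ha.ne']) (by simp), ?_, ?_⟩
  · exact ENNReal.toReal_le_of_le_ofReal zero_le_one (by simp)
  · rw [ENNReal.ofReal_toReal (by simp)]
    exact min_le_left _ _

theorem exists_Icc_of_isCompact_subset_ray {a : ℝ≥0∞} {k : Set ℝ} (hk : IsCompact k)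
    (h : k ⊆ ray a) (hne : k.Nonempty) : ∃ x₁ x₂, k ⊆ Icc x₁ x₂ ∧ Icc x₁ x₂ ⊆ ray a :=
  ⟨sInf k, sSup k, fun _ hx => ⟨csInf_le hk.bddBelow hx, le_csSup hk.bddAbove hx⟩,
    (ordConnected_ray a).out (h (hk.sInf_mem hne)) (h (hk.sSup_mem hne))⟩

/-! ### Smooth primitives -/

/-- The integral over a half-line is the convolution in the second variable with the indicator of
`[0, ∞)`, with the first variable as a parameter. -/
theorem contDiff_integral_Iic {η : ℝ × ℝ → ℝ} (hη : ContDiff ℝ ((⊤ : ℕ∞) : WithTop ℕ∞) η)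
    (hc : HasCompactSupport η) :
    ContDiff ℝ ((⊤ : ℕ∞) : WithTop ℕ∞) fun z : ℝ × ℝ => ∫ s in Iic z.2, η (z.1, s) := by
  have hk : IsCompact (Prod.snd '' tsupport η) := hc.isCompact.image continuous_snd
  have := contDiffOn_convolution_right_with_param (μ := (volume : Measure ℝ)) (𝕜 := ℝ)
    (n := (⊤ : ℕ∞)) (ContinuousLinearMap.mul ℝ ℝ) (f := indicator (Ici (0 : ℝ)) fun _ => (1 : ℝ))
    (g := fun x s => η (x, s)) isOpen_univ hk (fun p x _ hx => by
      by_contra h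
      exact hx ⟨(p, x), subset_tsupport _ h, rfl⟩)
    ((locallyIntegrable_const 1).indicator measurableSet_Ici) (hη.contDiffOn)
  rw [univ_prod_univ, contDiffOn_univ] at this
  convert this using 2 with z
  rw [convolution_eq_swap, ← integral_indicator measurableSet_Iic]
  congr 1 with t
  by_cases h : t ≤ z.2 <;> simp [indicator, h]

theorem fderiv_integral_Iic {η : ℝ × ℝ → ℝ} (hη : ContDiff ℝ ((⊤ : ℕ∞) : WithTop ℕ∞) η)
    (hc : HasCompactSupport η) (z : ℝ × ℝ) :
    fderiv ℝ (fun z : ℝ × ℝ => ∫ s in Iic z.2, η (z.1, s)) z (0, 1) = η z := by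
  obtain ⟨x, y⟩ := z
  have h1 := ((contDiff_integral_Iic hη hc).differentiable (by simp) (x, y)).hasFDerivAt
  have h2 : HasDerivAt (fun t : ℝ => (x, t)) ((0 : ℝ), (1 : ℝ)) y :=
    (hasDerivAt_const y x).prodMk (hasDerivAt_id y)
  have h3 := h1.comp_hasDerivAt y h2
  have hcont : Continuous fun s => η (x, s) := hη.continuous.comp (by fun_prop)
  have hηi : Integrable fun s => η (x, s) := by
    refine hcont.integrable_of_hasCompactSupport ?_
    refine HasCompactSupport.intro (hc.isCompact.image continuous_snd) fun s hs => ?_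
    by_contra h
    exact hs ⟨(x, s), subset_tsupport _ h, rfl⟩
  have h4 : HasDerivAt (fun t : ℝ => ∫ s in Iic t, η (x, s)) (η (x, y)) y := by
    have h5 : (fun t : ℝ => ∫ s in Iic t, η (x, s)) =
        fun t => (∫ s in Iic 0, η (x, s)) + ∫ s in (0 : ℝ)..t, η (x, s) := by
      funext t
      rw [← intervalIntegral.integral_Iic_sub_Iic hηi.integrableOn hηi.integrableOn]
      ring
    rw [h5]
    exact (intervalIntegral.integral_hasDerivAt_right (hcont.intervalIntegrable _ _)
      (hcont.stronglyMeasurableAtFilter _ _) hcont.continuousAt).const_add _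
  exact h3.unique h4

/-- Up to a function of the first variable times a fixed bump, a test function is the derivative of a
test function in the second variable. -/
theorem exists_test_antideriv {a b : ℝ≥0∞} {η : ℝ × ℝ → ℝ}
    (hη : ContDiff ℝ ((⊤ : ℕ∞) : WithTop ℕ∞) η) (hc : HasCompactSupport η)
    (hs : tsupport η ⊆ openRect a b) {θ : ℝ → ℝ} (hθ : ContDiff ℝ ((⊤ : ℕ∞) : WithTop ℕ∞) θ)
    (hθc : HasCompactSupport θ) (hθs : tsupport θ ⊆ ray b) (hθ1 : ∫ s, θ s = 1) :
    ∃ φ : ℝ × ℝ → ℝ, ContDiff ℝ ((⊤ : ℕ∞) : WithTop ℕ∞) φ ∧ HasCompactSupport φ ∧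
      tsupport φ ⊆ openRect a b ∧
      ∀ z, fderiv ℝ φ z (0, 1) = η z - θ z.2 * ∫ s, η (z.1, s) := by
  have hθne : (tsupport θ).Nonempty := by
    by_contra h
    rw [not_nonempty_iff_eq_empty, tsupport_eq_empty_iff] at h
    simp [h] at hθ1
  have hk2 : IsCompact (Prod.snd '' tsupport η ∪ tsupport θ) :=
    (hc.isCompact.image continuous_snd).union hθc.isCompact
  -- One compact interval in the side contains the vertical extent of both supports. It also
  -- contains the gap between them, where the primitive need not vanish.
  obtain ⟨y₁, y₂, hy, hyb⟩ := exists_Icc_of_isCompact_subset_ray hk2 (union_subset (by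
    rintro _ ⟨z, hz, rfl⟩
    have := hs hz
    rw [openRect_eq] at this
    exact this.2) hθs) (hθne.inr)
  have hk1 : IsCompact (Prod.fst '' tsupport η) := hc.isCompact.image continuous_fst
  have hk1a : Prod.fst '' tsupport η ⊆ ray a := by
    rintro _ ⟨z, hz, rfl⟩
    have := hs hz
    rw [openRect_eq] at this
    exact this.1
  have hzero1 : ∀ x s, x ∉ Prod.fst '' tsupport η → η (x, s) = 0 := fun x s hx => by
    by_contra h
    exact hx ⟨(x, s), subset_tsupport _ h, rfl⟩
  have hzero2 : ∀ x s, s ∉ Icc y₁ y₂ → η (x, s) = 0 := fun x s hx => by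
    by_contra h
    exact hx (hy (Or.inl ⟨(x, s), subset_tsupport _ h, rfl⟩))
  have hzeroθ : ∀ s, s ∉ Icc y₁ y₂ → θ s = 0 := fun s hx => by
    by_contra h
    exact hx (hy (Or.inr (subset_tsupport _ h)))
  have hm : (fun x => ∫ s, η (x, s)) = fun x => ∫ s in Iic y₂, η (x, s) := by
    funext x
    rw [setIntegral_eq_integral_of_forall_compl_eq_zero]
    intro s hs
    exact hzero2 x s fun h => hs h.2
  have hmd : ContDiff ℝ ((⊤ : ℕ∞) : WithTop ℕ∞) fun x => ∫ s, η (x, s) := by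
    rw [hm]
    exact (contDiff_integral_Iic hη hc).comp (contDiff_id.prodMk contDiff_const)
  set ζ : ℝ × ℝ → ℝ := fun z => η z - θ z.2 * ∫ s, η (z.1, s) with hζ
  have hζd : ContDiff ℝ ((⊤ : ℕ∞) : WithTop ℕ∞) ζ :=
    hη.sub ((hθ.comp contDiff_snd).mul (hmd.comp contDiff_fst))
  have hζ1 : ∀ x s, x ∉ Prod.fst '' tsupport η → ζ (x, s) = 0 := fun x s hx => by
    simp [hζ, hzero1 x _ hx]
  have hζ2 : ∀ x s, s ∉ Icc y₁ y₂ → ζ (x, s) = 0 := fun x s hx => by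
    simp [hζ, hzero2 x _ hx, hzeroθ s hx]
  have hζc : HasCompactSupport ζ := by
    refine HasCompactSupport.intro (hk1.prod (isCompact_Icc (a := y₁) (b := y₂))) ?_
    rintro ⟨x, s⟩ hx
    rw [mem_prod, not_and_or] at hx
    exact hx.elim (hζ1 x s) (hζ2 x s)
  -- Subtracting the multiple of `θ` makes the mean over every vertical line zero; this is why the
  -- primitive taken from `-∞` vanishes again above `y₂`.
  have hζint : ∀ x, ∫ s, ζ (x, s) = 0 := fun x => by
    have i1 : Integrable fun s => η (x, s) := by
      refine (hη.continuous.comp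
        (by fun_prop : Continuous fun s : ℝ => (x, s))).integrable_of_hasCompactSupport ?_
      exact HasCompactSupport.intro isCompact_Icc fun s hs => hzero2 x s hs
    have i2 : Integrable θ := hθ.continuous.integrable_of_hasCompactSupport hθc
    simp only [hζ]
    rw [integral_sub i1 (i2.mul_const _), integral_mul_const, hθ1, one_mul, sub_self]
  have hφ0 : ∀ z : ℝ × ℝ, z ∉ (Prod.fst '' tsupport η) ×ˢ Icc y₁ y₂ →
      (∫ s in Iic z.2, ζ (z.1, s)) = 0 := by
    rintro ⟨x, y⟩ hz
    rw [mem_prod, not_and_or] at hz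
    rcases hz with hz | hz
    · simp [hζ1 x _ hz]
    · by_cases hlt : y < y₁
      · refine setIntegral_eq_zero_of_forall_eq_zero fun s hs => hζ2 x s fun h => ?_
        exact absurd (h.1.trans hs) (not_le.2 hlt)
      · have hgt : y₂ < y := by
          by_contra h
          exact hz ⟨not_lt.1 hlt, not_lt.1 h⟩
        rw [setIntegral_eq_integral_of_forall_compl_eq_zero, hζint]
        intro s hs
        exact hζ2 x s fun h => hs (h.2.trans hgt.le)
  refine ⟨fun z => ∫ s in Iic z.2, ζ (z.1, s), contDiff_integral_Iic hζd hζc, ?_, ?_,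
    fun z => fderiv_integral_Iic hζd hζc z⟩
  · exact HasCompactSupport.intro (hk1.prod isCompact_Icc) hφ0
  · refine (closure_minimal (fun z hz => ?_) (hk1.prod isCompact_Icc).isClosed).trans
      (by rw [openRect_eq]; exact prod_mono hk1a hyb)
    by_contra h
    exact hz (hφ0 z h)

/-! ### Vertical primitives -/

/-- `U` is measurable and is, on every vertical line, a primitive of the measurable, locally integrable
function `g`. -/
structure IsVertPrimitive {E : Type*} [NormedAddCommGroup E] [NormedSpace ℝ E]
    (U g : ℝ × ℝ → E) : Prop where
  measU : StronglyMeasurable U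
  measg : StronglyMeasurable g
  loc : ∀ x, LocallyIntegrable fun y => g (x, y)
  eq : ∀ x y, U (x, y) = U (x, 0) + ∫ s in (0 : ℝ)..y, g (x, s)

namespace IsVertPrimitive

section

variable {E : Type*} [NormedAddCommGroup E] [NormedSpace ℝ E] {U g : ℝ × ℝ → E}

theorem sub_eq (h : IsVertPrimitive U g) (x y₁ y₂ : ℝ) :
    U (x, y₂) - U (x, y₁) = ∫ s in y₁..y₂, g (x, s) := by
  rw [h.eq x y₁, h.eq x y₂, add_sub_add_left_eq_sub, intervalIntegral.integral_interval_sub_left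
      ((h.loc x).intervalIntegrable_real _ _) ((h.loc x).intervalIntegrable_real _ _)]

theorem continuous (h : IsVertPrimitive U g) (x : ℝ) : Continuous fun y => U (x, y) := by
  have : (fun y => U (x, y)) = fun y => U (x, 0) + ∫ s in (0 : ℝ)..y, g (x, s) :=
    funext (h.eq x)
  rw [this]
  exact continuous_const.add
    (intervalIntegral.continuous_primitive (fun a b => (h.loc x).intervalIntegrable_real a b) 0)

end

/-- The chain rule for `F (x, y, U (x, y))` in the vertical direction. -/
theorem comp {U g : ℝ × ℝ → ℂ} (h : IsVertPrimitive U g) {E : Type*} [NormedAddCommGroup E]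
    [NormedSpace ℝ E] [CompleteSpace E] [SecondCountableTopology E] [MeasurableSpace E]
    [BorelSpace E] {F : ℝ × ℂ → E} (hF : ContDiff ℝ 1 F) (e₁ e₂ : ℝ) :
    IsVertPrimitive (fun z => F (e₁ * z.1 + e₂ * z.2, U z))
      (fun z => fderiv ℝ F (e₁ * z.1 + e₂ * z.2, U z) (e₂, g z)) := by
  have hm : StronglyMeasurable fun z : ℝ × ℝ => (e₁ * z.1 + e₂ * z.2, U z) :=
    (by fun_prop : Continuous fun z : ℝ × ℝ => e₁ * z.1 + e₂ * z.2).stronglyMeasurable.prodMk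
      h.measU
  -- The curve `y ↦ (e₁ x + e₂ y, U (x, y))` is a primitive of `(e₂, g (x, y))`. The linear first
  -- component will be the height.
  have key : ∀ x, _ := fun x => hF.comp_primitive
    (f := fun y => (e₁ * x + e₂ * y, U (x, y))) (g := fun y => (e₂, g (x, y)))
    (fun y => by
      obtain ⟨t, ht, hi⟩ := (h.loc x) y
      obtain ⟨t', ht', hi'⟩ := (locallyIntegrable_const e₂ : LocallyIntegrable (fun _ : ℝ => e₂)) y
      exact ⟨t ∩ t', inter_mem ht ht', (hi'.mono_set inter_subset_right).prodMk
        (hi.mono_set inter_subset_left)⟩)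
    (fun y => by
      have i1 : IntervalIntegrable (fun _ : ℝ => e₂) volume 0 y := intervalIntegrable_const
      have i2 := (h.loc x).intervalIntegrable_real 0 y
      rcases le_total 0 y with hy | hy
      · rw [intervalIntegral.integral_of_le hy, integral_pair i1.1 i2.1,
          ← intervalIntegral.integral_of_le hy, ← intervalIntegral.integral_of_le hy,
          Prod.mk_add_mk, ← h.eq]
        simp [mul_comm]
      · rw [intervalIntegral.integral_of_ge hy, integral_pair i1.2 i2.2, Prod.neg_mk,
          ← intervalIntegral.integral_of_ge hy, ← intervalIntegral.integral_of_ge hy,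
          Prod.mk_add_mk, ← h.eq]
        simp [mul_comm])
  refine ⟨hF.continuous.comp_stronglyMeasurable hm, ?_, fun x => (key x).1, fun x y => ?_⟩
  · exact (isBoundedBilinearMap_apply (𝕜 := ℝ) (E := ℝ × ℂ) (F := E)).continuous
      |>.comp_stronglyMeasurable
        (((hF.continuous_fderiv one_ne_zero).comp_stronglyMeasurable hm).prodMk
          (stronglyMeasurable_const.prodMk h.measg))
  · exact (key x).2 y

/-- A vertical primitive of `g` has the weak vertical derivative `g`. -/
theorem integral_fderiv_smul {U g : ℝ × ℝ → ℂ} (h : IsVertPrimitive U g) {a b : ℝ≥0∞}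
    (hU : LocallyIntegrableOn U (openRect a b)) (hg : LocallyIntegrableOn g (openRect a b))
    {φ : ℝ × ℝ → ℝ} (hφ : ContDiff ℝ ((⊤ : ℕ∞) : WithTop ℕ∞) φ) (hc : HasCompactSupport φ)
    (hs : tsupport φ ⊆ openRect a b) :
    ∫ z in openRect a b, fderiv ℝ φ z (0, 1) • U z = -∫ z in openRect a b, φ z • g z := by
  have hφ1 : ContDiff ℝ 1 φ := hφ.of_le (by exact_mod_cast le_top)
  have hcont : Continuous fun z => fderiv ℝ φ z (0, 1) :=
    (hφ1.continuous_fderiv one_ne_zero).clm_apply continuous_const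
  have hD0 : ∀ z, z ∉ tsupport φ → fderiv ℝ φ z (0, 1) = 0 := fun z hz => by
    have : fderiv ℝ φ z = 0 := by
      by_contra h'
      exact hz (support_fderiv_subset ℝ h')
    simp [this]
  have h0 : ∀ z, z ∉ tsupport φ → φ z = 0 := fun z hz => image_eq_zero_of_notMem_tsupport hz
  have i1 : Integrable fun z => fderiv ℝ φ z (0, 1) • U z := by
    have := (hU.integrableOn_compact_subset hs hc.isCompact).continuousOn_smul
      hcont.continuousOn hc.isCompact
    exact (integrableOn_iff_integrable_of_support_subset fun z hz => by
      by_contra hz'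
      exact hz (by simp [hD0 z hz'])).1 this
  have i2 : Integrable fun z => φ z • g z := by
    have := (hg.integrableOn_compact_subset hs hc.isCompact).continuousOn_smul
      hφ.continuous.continuousOn hc.isCompact
    exact (integrableOn_iff_integrable_of_support_subset fun z hz => by
      by_contra hz'
      exact hz (by simp [h0 z hz'])).1 this
  rw [setIntegral_eq_integral_of_forall_compl_eq_zero fun z hz => by
      rw [hD0 z fun hz' => hz (hs hz'), zero_smul],
    setIntegral_eq_integral_of_forall_compl_eq_zero fun z hz => by
      rw [h0 z fun hz' => hz (hs hz'), zero_smul],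
    eq_neg_iff_add_eq_zero, ← integral_add i1 i2]
  refine (integral_prod _ (i1.add i2)).trans ?_
  simp only [Pi.add_apply]
  rw [← integral_zero ℝ ℂ (μ := volume)]
  congr 1 with x
  obtain ⟨M, hM⟩ := (hc.isCompact.image continuous_snd).isBounded.subset_closedBall 0
  -- For frozen `x` the product `φ U` is a composition covered by `comp`. Its derivative is the
  -- integrand and it vanishes at `±N`, so the integral over the line is zero.
  have hF : ContDiff ℝ 1 fun r : ℝ × ℂ => φ (x, r.1) • r.2 :=
    (hφ1.comp (contDiff_const.prodMk contDiff_fst)).smul contDiff_snd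
  have hV := h.comp hF 0 1
  have hMM : ∀ y, M < |y| → (x, y) ∉ tsupport φ := fun y hy hz => by
    have := hM ⟨_, hz, rfl⟩
    simp only [Metric.mem_closedBall, dist_zero_right, Real.norm_eq_abs] at this
    linarith
  have hfd : ∀ y, fderiv ℝ (fun r : ℝ × ℂ => φ (x, r.1) • r.2) (0 * x + 1 * y, U (x, y))
      (1, g (x, y)) = fderiv ℝ φ (x, y) (0, 1) • U (x, y) + φ (x, y) • g (x, y) := by
    intro y
    have h1 : HasFDerivAt φ (fderiv ℝ φ (x, y)) (x, y) :=
      (hφ1.differentiable one_ne_zero _).hasFDerivAt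
    have h2 : HasFDerivAt (fun r : ℝ × ℂ => (x, r.1))
        ((0 : ℝ × ℂ →L[ℝ] ℝ).prod (ContinuousLinearMap.fst ℝ ℝ ℂ)) (y, U (x, y)) :=
      (hasFDerivAt_const x _).prodMk hasFDerivAt_fst
    have h3 := (HasFDerivAt.comp (y, U (x, y)) (g := φ) h1 h2).smul
      (hasFDerivAt_snd (𝕜 := ℝ) (E := ℝ) (F := ℂ) (p := (y, U (x, y))))
    have h4 : (0 * x + 1 * y, U (x, y)) = (y, U (x, y)) := by simp
    rw [h4]
    refine (congrArg (fun l => l ((1 : ℝ), g (x, y))) h3.fderiv).trans ?_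
    simp [add_comm]
  set N := |M| + 1 with hN
  have hNM : M < |N| := by
    rw [hN, abs_of_nonneg (by positivity)]
    linarith [le_abs_self M]
  have h5 := hV.sub_eq x (-N) N
  simp only [hfd] at h5
  have e1 : φ (x, 0 * x + 1 * N) = 0 := h0 _ (hMM _ (by simpa using hNM))
  have e2 : φ (x, 0 * x + 1 * (-N)) = 0 := h0 _ (hMM _ (by simpa using hNM))
  simp only [e1, e2, zero_smul, sub_zero] at h5
  have hNN : -N ≤ N := neg_le_self (by positivity)
  rw [intervalIntegral.integral_of_le hNN, setIntegral_eq_integral_of_forall_compl_eq_zero] at h5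
  · exact h5.symm
  · intro y hy
    have : (x, y) ∉ tsupport φ := hMM y (by
      by_contra hle
      rw [not_lt] at hle
      have := abs_le.1 (hle.trans (le_abs_self M))
      exact hy ⟨by rw [hN]; linarith [this.1], by rw [hN]; linarith [this.2]⟩)
    rw [hD0 _ this, h0 _ this, zero_smul, zero_smul, add_zero]

end IsVertPrimitive

/-! ### Functions with a weak vertical derivative -/

theorem memLp_two_iff_lintegral {α E : Type*} [MeasurableSpace α] {μ : Measure α}
    [NormedAddCommGroup E] {f : α → E} :
    MemLp f 2 μ ↔ AEStronglyMeasurable f μ ∧ ∫⁻ x, ‖f x‖ₑ ^ 2 ∂μ < ∞ := by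
  rw [MemLp, eLpNorm_lt_top_iff_lintegral_rpow_enorm_lt_top two_ne_zero ENNReal.ofNat_ne_top]
  simp

theorem stronglyMeasurable_vertPrimitive {g : ℝ × ℝ → ℂ} (hg : StronglyMeasurable g) :
    StronglyMeasurable fun z : ℝ × ℝ => ∫ s in (0 : ℝ)..z.2, g (z.1, s) := by
  have h : ∀ S : Set ((ℝ × ℝ) × ℝ), MeasurableSet S →
      StronglyMeasurable fun z : ℝ × ℝ => ∫ s, S.indicator (fun w => g (w.1.1, w.2)) (z, s) :=
    fun S hS => StronglyMeasurable.integral_prod_right'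
      ((hg.comp_measurable (by fun_prop : Measurable fun w : (ℝ × ℝ) × ℝ => (w.1.1, w.2))).indicator
        hS)
  have h1 := h {w | w.2 ∈ Ioc 0 w.1.2} ((measurableSet_lt measurable_const measurable_snd).inter
    (measurableSet_le measurable_snd (measurable_snd.comp measurable_fst)))
  have h2 := h {w | w.2 ∈ Ioc w.1.2 0} ((measurableSet_lt (measurable_snd.comp measurable_fst)
    measurable_snd).inter (measurableSet_le measurable_snd measurable_const))
  convert h1.sub h2 using 2 with z
  simp only [intervalIntegral, Pi.sub_apply]
  rw [← integral_indicator measurableSet_Ioc, ← integral_indicator measurableSet_Ioc]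
  rfl

/-- On a square the primitive is dominated by the integral of `‖g‖` over the vertical section of the
square, which is integrable by Fubini. -/
theorem locallyIntegrable_vertPrimitive {g : ℝ × ℝ → ℂ} (hg : StronglyMeasurable g)
    (hl : LocallyIntegrable g) :
    LocallyIntegrable fun z : ℝ × ℝ => ∫ s in (0 : ℝ)..z.2, g (z.1, s) := by
  rw [locallyIntegrable_iff]
  intro k hk
  obtain ⟨M, hM⟩ := hk.isBounded.subset_closedBall 0
  set A := |M| with hA
  have hA0 : 0 ≤ A := abs_nonneg M
  have hkA : k ⊆ Icc (-A) A ×ˢ Icc (-A) A := fun z hz => by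
    have h1 := hM hz
    rw [mem_closedBall_zero_iff] at h1
    have h2 : |z.1| ≤ A := (norm_fst_le z).trans (h1.trans (le_abs_self M))
    have h3 : |z.2| ≤ A := (norm_snd_le z).trans (h1.trans (le_abs_self M))
    exact ⟨abs_le.1 h2, abs_le.1 h3⟩
  refine IntegrableOn.mono_set ?_ hkA
  have hi : Integrable g
      ((volume.restrict (Icc (-A) A)).prod ((volume : Measure ℝ).restrict (Icc (-A) A))) := by
    rw [Measure.prod_restrict]
    exact hl.integrableOn_isCompact (isCompact_Icc.prod isCompact_Icc)
  have hi2 := hi.integral_norm_prod_left.comp_fst ((volume : Measure ℝ).restrict (Icc (-A) A))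
  rw [Measure.prod_restrict] at hi2
  have hsl := hi.prod_right_ae
  refine Integrable.mono' hi2 (stronglyMeasurable_vertPrimitive hg).aestronglyMeasurable ?_
  have hsl2 : ∀ᵐ z : ℝ × ℝ ∂volume.restrict (Icc (-A) A ×ˢ Icc (-A) A),
      IntegrableOn (fun y => g (z.1, y)) (Icc (-A) A) := by
    rw [show (volume : Measure (ℝ × ℝ)) = (volume : Measure ℝ).prod volume from rfl,
      ← Measure.prod_restrict]
    exact Measure.quasiMeasurePreserving_fst.ae hsl
  filter_upwards [hsl2, ae_restrict_mem (measurableSet_Icc.prod measurableSet_Icc)] with z hz hzm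
  refine (intervalIntegral.norm_integral_le_integral_norm_uIoc).trans ?_
  refine setIntegral_mono_set hz.norm (Eventually.of_forall fun _ => norm_nonneg _) ?_
  refine LE.le.eventuallyLE (uIoc_subset_uIcc.trans ?_)
  exact uIcc_subset_Icc ⟨by linarith, hA0⟩ hzm.2

theorem exists_normalized_bump {b : ℝ≥0∞} (hb : 0 < b) : ∃ θ : ℝ → ℝ,
    ContDiff ℝ ((⊤ : ℕ∞) : WithTop ℕ∞) θ ∧ HasCompactSupport θ ∧ tsupport θ ⊆ ray b ∧
      ∫ s, θ s = 1 := by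
  obtain ⟨d, hd, -, hdb⟩ := exists_ofReal_le hb
  let f : ContDiffBump (d / 2) := ⟨d / 8, d / 4, by positivity, by linarith⟩
  refine ⟨f.normed volume, f.contDiff_normed, f.hasCompactSupport_normed, ?_, f.integral_normed⟩
  rw [f.tsupport_normed_eq]
  refine Subset.trans (fun s hs => ?_) (Ioo_subset_ray hdb)
  rw [Real.closedBall_eq_Icc] at hs
  have h1 : d / 2 - d / 4 ≤ s := hs.1
  have h2 : s ≤ d / 2 + d / 4 := hs.2
  exact ⟨by linarith, by linarith⟩

/-- A function in `L²` of a rectangle with a weak vertical derivative in `L²` agrees almost everywhere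
with a vertical primitive of that derivative. -/
theorem exists_isVertPrimitive {a b : ℝ≥0∞} (hb : 0 < b) {u q : ℝ × ℝ → ℂ}
    (hu : MemLp u 2 (volume.restrict (openRect a b)))
    (hq : MemLp q 2 (volume.restrict (openRect a b)))
    (h : ∀ φ : ℝ × ℝ → ℝ, ContDiff ℝ ((⊤ : ℕ∞) : WithTop ℕ∞) φ → HasCompactSupport φ →
      tsupport φ ⊆ openRect a b →
      ∫ z in openRect a b, fderiv ℝ φ z (0, 1) • u z = -∫ z in openRect a b, φ z • q z) :
    ∃ U g : ℝ × ℝ → ℂ, IsVertPrimitive U g ∧ U =ᵐ[volume.restrict (openRect a b)] u ∧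
      g =ᵐ[volume.restrict (openRect a b)] q := by
  have hR := measurableSet_openRect a b
  set g₂ : ℝ × ℝ → ℂ := (openRect a b).indicator (hq.1.mk q) with hg₂
  have hg₂m : StronglyMeasurable g₂ := hq.1.stronglyMeasurable_mk.indicator hR
  have hg₂L : MemLp g₂ 2 volume :=
    (memLp_indicator_iff_restrict hR).2 ((memLp_congr_ae hq.1.ae_eq_mk).1 hq)
  -- These are the lines on which the derivative is square integrable. Replacing it by zero on the
  -- remaining null set of lines gives a primitive on every line without exception.
  set S : Set ℝ := {x | ∫⁻ y, ‖g₂ (x, y)‖ₑ ^ 2 < ∞} with hS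
  have hmeas : Measurable fun z => ‖g₂ z‖ₑ ^ 2 := hg₂m.enorm.pow_const 2
  have hSm : MeasurableSet S := measurableSet_lt hmeas.lintegral_prod_right' measurable_const
  have hSae : ∀ᵐ x, x ∈ S := by
    refine ae_lt_top hmeas.lintegral_prod_right' ?_
    rw [← lintegral_prod _ hmeas.aemeasurable]
    exact (memLp_two_iff_lintegral.1 hg₂L).2.ne
  set g : ℝ × ℝ → ℂ := (Prod.fst ⁻¹' S).indicator g₂ with hg
  have hgm : StronglyMeasurable g := hg₂m.indicator (measurable_fst hSm)
  have hgg₂ : g =ᵐ[volume] g₂ := by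
    have : ∀ᵐ z : ℝ × ℝ, z.1 ∈ S :=
      (Measure.quasiMeasurePreserving_fst (μ := volume) (ν := volume)).ae hSae
    filter_upwards [this] with z hz
    exact indicator_of_mem (s := Prod.fst ⁻¹' S) hz _
  have hgL : MemLp g 2 volume := (memLp_congr_ae hgg₂).2 hg₂L
  have hgq : g =ᵐ[volume.restrict (openRect a b)] q := by
    filter_upwards [ae_restrict_of_ae hgg₂, ae_restrict_mem hR, hq.1.ae_eq_mk] with z h1 h2 h3
    rw [h1, hg₂, indicator_of_mem h2, h3]
  have hgloc : ∀ x, LocallyIntegrable fun y => g (x, y) := by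
    intro x
    by_cases hx : x ∈ S
    · have : MemLp (fun y => g (x, y)) 2 volume := by
        rw [memLp_two_iff_lintegral]
        have e : ∀ y, g (x, y) = g₂ (x, y) :=
          fun y => indicator_of_mem (s := Prod.fst ⁻¹' S) (show (x, y) ∈ _ from hx) _
        simp only [e]
        exact ⟨(hg₂m.comp_measurable measurable_prodMk_left).aestronglyMeasurable, hx⟩
      exact this.locallyIntegrable (by norm_num)
    · have e : (fun y => g (x, y)) = fun y => 0 :=
        funext fun y => indicator_of_notMem (s := Prod.fst ⁻¹' S) (show (x, y) ∉ _ from hx) _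
      rw [e]
      exact locallyIntegrable_zero
  set Q : ℝ × ℝ → ℂ := fun z => ∫ s in (0 : ℝ)..z.2, g (z.1, s) with hQ
  have hQm : StronglyMeasurable Q := stronglyMeasurable_vertPrimitive hgm
  have hQl : LocallyIntegrable Q :=
    locallyIntegrable_vertPrimitive hgm (hgL.locallyIntegrable (by norm_num))
  have hQp : IsVertPrimitive Q g := ⟨hQm, hgm, hgloc, fun x y => by simp [hQ]⟩
  set u₁ : ℝ × ℝ → ℂ := (openRect a b).indicator (hu.1.mk u) with hu₁
  have hu₁m : StronglyMeasurable u₁ := hu.1.stronglyMeasurable_mk.indicator hR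
  have hu₁L : MemLp u₁ 2 volume :=
    (memLp_indicator_iff_restrict hR).2 ((memLp_congr_ae hu.1.ae_eq_mk).1 hu)
  have hu₁u : u₁ =ᵐ[volume.restrict (openRect a b)] u := by
    filter_upwards [ae_restrict_mem hR, hu.1.ae_eq_mk] with z h2 h3
    rw [hu₁, indicator_of_mem h2, h3]
  -- This difference has vanishing weak vertical derivative on the rectangle, so it should depend on
  -- `x` alone; its mean against the bump `θ` is the candidate for that function.
  set G : ℝ × ℝ → ℂ := fun z => u₁ z - Q z with hG
  have hGm : StronglyMeasurable G := hu₁m.sub hQm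
  have hGl : LocallyIntegrable G := (hu₁L.locallyIntegrable (by norm_num)).sub hQl
  obtain ⟨θ, hθ, hθc, hθs, hθ1⟩ := exists_normalized_bump hb
  set c : ℝ → ℂ := fun x => ∫ y, θ y • G (x, y) with hc
  have hcm : StronglyMeasurable c :=
    StronglyMeasurable.integral_prod_right'
      (f := fun z : ℝ × ℝ => θ z.2 • G z)
      ((hθ.continuous.comp continuous_snd).stronglyMeasurable.smul hGm)
  have hcl : LocallyIntegrable fun z : ℝ × ℝ => c z.1 := by
    rw [locallyIntegrable_iff]
    intro k hk
    obtain ⟨M, hM⟩ := hk.isBounded.subset_closedBall 0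
    have hkA : k ⊆ Metric.closedBall 0 M ×ˢ Metric.closedBall 0 M := fun z hz => by
      have h1 := hM hz
      rw [mem_closedBall_zero_iff] at h1
      exact ⟨by simpa using (norm_fst_le z).trans h1, by simpa using (norm_snd_le z).trans h1⟩
    refine IntegrableOn.mono_set ?_ hkA
    have hb1 : Continuous fun z : ℝ × ℝ => θ z.2 := hθ.continuous.comp continuous_snd
    have hi : Integrable (fun z : ℝ × ℝ => θ z.2 • G z)
        ((volume.restrict (Metric.closedBall (0 : ℝ) M)).prod (volume : Measure ℝ)) := by
      have h1 : IntegrableOn (fun z : ℝ × ℝ => θ z.2 • G z)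
          (Metric.closedBall (0 : ℝ) M ×ˢ tsupport θ) :=
        (hGl.integrableOn_isCompact ((isCompact_closedBall 0 M).prod hθc.isCompact)).continuousOn_smul
          hb1.continuousOn ((isCompact_closedBall 0 M).prod hθc.isCompact)
      have h2 : IntegrableOn (fun z : ℝ × ℝ => θ z.2 • G z)
          (Metric.closedBall (0 : ℝ) M ×ˢ univ) := by
        refine h1.of_forall_sdiff_eq_zero (Metric.isClosed_closedBall.measurableSet.prod .univ)
          fun z hz => ?_
        have : z.2 ∉ tsupport θ := fun h' => hz.2 ⟨hz.1.1, h'⟩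
        rw [image_eq_zero_of_notMem_tsupport this, zero_smul]
      rw [IntegrableOn, show (volume : Measure (ℝ × ℝ)) = (volume : Measure ℝ).prod volume from rfl,
        ← Measure.prod_restrict, Measure.restrict_univ] at h2
      exact h2
    have : IsFiniteMeasure ((volume : Measure ℝ).restrict (Metric.closedBall (0 : ℝ) M)) :=
      ⟨by
        rw [Measure.restrict_apply_univ]
        exact (isCompact_closedBall (0 : ℝ) M).measure_lt_top⟩
    have hi2 := hi.integral_prod_left.comp_fst
      ((volume : Measure ℝ).restrict (Metric.closedBall (0 : ℝ) M))
    rw [Measure.prod_restrict] at hi2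
    exact hi2
  refine ⟨fun z => c z.1 + Q z, g, ⟨(hcm.comp_measurable measurable_fst).add hQm, hgm, hgloc,
    fun x y => by simp [hQ]⟩, ?_, hgq⟩
  -- Du Bois-Reymond argument: up to `θ` times its vertical mean, any test function `η` is a
  -- vertical derivative `∂φ`, and `∂φ` integrates to zero against `G`. What remains of `∫ η G` is
  -- `∫ η c`.
  have hfin : ∀ᵐ z : ℝ × ℝ, z ∈ openRect a b → G z - c z.1 = 0 := by
    refine (isOpen_openRect a b).ae_eq_zero_of_integral_contDiff_smul_eq_zero
      ((hGl.sub hcl).locallyIntegrableOn _) fun η hη hηc hηs => ?_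
    obtain ⟨φ, hφ, hφc, hφs, hφd⟩ := exists_test_antideriv hη hηc hηs hθ hθc hθs hθ1
    have hφ1 : ContDiff ℝ 1 φ := hφ.of_le (by exact_mod_cast le_top)
    have hφyc : Continuous fun z => fderiv ℝ φ z (0, 1) :=
      (hφ1.continuous_fderiv one_ne_zero).clm_apply continuous_const
    have hφys : HasCompactSupport fun z => fderiv ℝ φ z (0, 1) :=
      (hφc.fderiv (𝕜 := ℝ)).comp_left (g := fun l : ℝ × ℝ →L[ℝ] ℝ => l (0, 1)) (by simp)
    have e1 := h φ hφ hφc hφs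
    have e2 := hQp.integral_fderiv_smul (hQl.locallyIntegrableOn _)
      ((hgL.locallyIntegrable (by norm_num)).locallyIntegrableOn _) hφ hφc hφs
    have e3 : ∫ z in openRect a b, φ z • g z = ∫ z in openRect a b, φ z • q z :=
      integral_congr_ae (by filter_upwards [hgq] with z hz; rw [hz])
    have e4 : ∫ z in openRect a b, fderiv ℝ φ z (0, 1) • u₁ z =
        ∫ z in openRect a b, fderiv ℝ φ z (0, 1) • u z :=
      integral_congr_ae (by filter_upwards [hu₁u] with z hz; rw [hz])
    have iu : Integrable fun z => fderiv ℝ φ z (0, 1) • u₁ z :=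
      (hu₁L.locallyIntegrable (by norm_num)).integrable_smul_left_of_hasCompactSupport hφyc hφys
    have iQ : Integrable fun z => fderiv ℝ φ z (0, 1) • Q z :=
      hQl.integrable_smul_left_of_hasCompactSupport hφyc hφys
    have e5 : ∫ z, fderiv ℝ φ z (0, 1) • G z = 0 := by
      rw [← setIntegral_eq_integral_of_forall_compl_eq_zero (s := openRect a b)]
      · simp only [hG, smul_sub]
        rw [integral_sub iu.integrableOn iQ.integrableOn, e4, e1, e2, e3, sub_self]
      · intro z hz
        have : fderiv ℝ φ z = 0 := by
          by_contra h'
          exact hz (hφs (support_fderiv_subset ℝ h'))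
        simp [this]
    set m : ℝ → ℝ := fun x => ∫ s, η (x, s) with hm
    have iη : Integrable fun z => η z • G z :=
      hGl.integrable_smul_left_of_hasCompactSupport hη.continuous hηc
    have iηc : Integrable fun z => η z • c z.1 :=
      hcl.integrable_smul_left_of_hasCompactSupport hη.continuous hηc
    have iθ : Integrable fun z : ℝ × ℝ => (θ z.2 * m z.1) • G z := by
      have : (fun z : ℝ × ℝ => (θ z.2 * m z.1) • G z) =
          fun z => η z • G z - fderiv ℝ φ z (0, 1) • G z := by
        funext z
        rw [hφd, sub_smul, sub_sub_cancel]
      rw [this]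
      exact iη.sub (hGl.integrable_smul_left_of_hasCompactSupport hφyc hφys)
    have e6 : ∫ z, η z • G z = ∫ z : ℝ × ℝ, (θ z.2 * m z.1) • G z := by
      rw [← sub_eq_zero, ← integral_sub iη iθ, ← e5]
      congr 1 with z
      rw [hφd, sub_smul]
    have e7 : ∫ z : ℝ × ℝ, (θ z.2 * m z.1) • G z = ∫ x, m x • c x := by
      refine (integral_prod _ iθ).trans ?_
      congr 1 with x
      simp only [hc]
      rw [← integral_smul]
      congr 1 with y
      rw [smul_smul, mul_comm]
    have e8 : ∫ z : ℝ × ℝ, η z • c z.1 = ∫ x, m x • c x := by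
      refine (integral_prod _ iηc).trans ?_
      congr 1 with x
      exact integral_smul_const (fun y => η (x, y)) (c x)
    have e9 : (fun z : ℝ × ℝ => η z • (G z - c z.1)) = fun z => η z • G z - η z • c z.1 := by
      funext z
      rw [smul_sub]
    rw [e9, integral_sub iη iηc, e6, e7, e8, sub_self]
  filter_upwards [ae_restrict_of_ae hfin, ae_restrict_mem hR, hu₁u] with z h1 h2 h3
  have := h1 h2
  rw [← h3]
  simp only [hG] at this
  linear_combination -this

/-! ### Weak derivatives of compositions on rectangles -/

/-- `g` is the weak derivative of `u` in the direction `e` on the set `R`. -/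
def WeakDerivOn (R : Set (ℝ × ℝ)) (e : ℝ × ℝ) (u g : ℝ × ℝ → ℂ) : Prop :=
  ∀ φ : ℝ × ℝ → ℝ, ContDiff ℝ ((⊤ : ℕ∞) : WithTop ℕ∞) φ → HasCompactSupport φ → tsupport φ ⊆ R →
    ∫ z in R, fderiv ℝ φ z e • u z = -∫ z in R, φ z • g z

theorem swap_preimage_openRect (a b : ℝ≥0∞) :
    Prod.swap ⁻¹' openRect a b = openRect b a := by
  ext z
  simp [openRect]
  tauto

theorem measurePreserving_swap_openRect (a b : ℝ≥0∞) :
    MeasurePreserving (Prod.swap : ℝ × ℝ → ℝ × ℝ) (volume.restrict (openRect b a))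
      (volume.restrict (openRect a b)) := by
  have h : MeasurePreserving (Prod.swap : ℝ × ℝ → ℝ × ℝ) volume volume :=
    Measure.measurePreserving_swap
  have := h.restrict_preimage (measurableSet_openRect a b)
  rwa [swap_preimage_openRect] at this

theorem setIntegral_swap_openRect {E : Type*} [NormedAddCommGroup E] [NormedSpace ℝ E]
    (a b : ℝ≥0∞) (f : ℝ × ℝ → E) :
    ∫ z in openRect b a, f z.swap = ∫ z in openRect a b, f z :=
  (measurePreserving_swap_openRect a b).integral_comp
    (MeasurableEquiv.prodComm (α := ℝ) (β := ℝ)).measurableEmbedding f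

/-- Exchanging the coordinates turns statements on horizontal derivatives into statements on
vertical ones, so only the latter have to be proved. -/
theorem WeakDerivOn.swap {a b : ℝ≥0∞} {e : ℝ × ℝ} {u g : ℝ × ℝ → ℂ}
    (h : WeakDerivOn (openRect a b) e u g) :
    WeakDerivOn (openRect b a) e.swap (fun z => u z.swap) fun z => g z.swap := by
  intro φ hφ hc hs
  let s : (ℝ × ℝ) ≃L[ℝ] (ℝ × ℝ) := ContinuousLinearEquiv.prodComm ℝ ℝ ℝ
  have h1 : ContDiff ℝ ((⊤ : ℕ∞) : WithTop ℕ∞) fun z : ℝ × ℝ => φ z.swap :=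
    hφ.comp s.contDiff
  have h2 : HasCompactSupport fun z : ℝ × ℝ => φ z.swap :=
    hc.comp_homeomorph s.toHomeomorph
  have h3 : tsupport (fun z : ℝ × ℝ => φ z.swap) ⊆ openRect a b := by
    have : tsupport (fun z : ℝ × ℝ => φ z.swap) = Prod.swap ⁻¹' tsupport φ :=
      tsupport_comp_eq_preimage φ s.toHomeomorph
    rw [this, ← swap_preimage_openRect b a]
    exact preimage_mono hs
  have h4 := h _ h1 h2 h3
  have h5 : ∀ z, fderiv ℝ (fun z : ℝ × ℝ => φ z.swap) z e = fderiv ℝ φ z.swap e.swap := by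
    intro z
    have := s.comp_right_fderiv (f := φ) (x := z)
    exact congrArg (fun l => l e) this
  simp only [h5] at h4
  rw [← setIntegral_swap_openRect a b, ← setIntegral_swap_openRect a b] at h4
  simpa using h4

theorem WeakDerivOn.congr {R : Set (ℝ × ℝ)} {e : ℝ × ℝ} {u g u' g' : ℝ × ℝ → ℂ}
    (h : WeakDerivOn R e u g) (hu : u =ᵐ[volume.restrict R] u') (hg : g =ᵐ[volume.restrict R] g') :
    WeakDerivOn R e u' g' := by
  intro φ hφ hc hs
  have e1 : ∫ z in R, fderiv ℝ φ z e • u z = ∫ z in R, fderiv ℝ φ z e • u' z :=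
    integral_congr_ae (by filter_upwards [hu] with z hz; rw [hz])
  have e2 : ∫ z in R, φ z • g z = ∫ z in R, φ z • g' z :=
    integral_congr_ae (by filter_upwards [hg] with z hz; rw [hz])
  rw [← e1, ← e2]
  exact h φ hφ hc hs

theorem WeakDerivOn.comp_snd {a b : ℝ≥0∞} (hb : 0 < b) {u q : ℝ × ℝ → ℂ}
    (hu : MemLp u 2 (volume.restrict (openRect a b)))
    (hq : MemLp q 2 (volume.restrict (openRect a b)))
    (h : WeakDerivOn (openRect a b) (0, 1) u q) {F : ℝ × ℂ → ℂ} (hF : ContDiff ℝ 1 F)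
    (e₁ e₂ : ℝ)
    (hv : MemLp (fun z => F (e₁ * z.1 + e₂ * z.2, u z)) 2 (volume.restrict (openRect a b)))
    (hw : MemLp (fun z => fderiv ℝ F (e₁ * z.1 + e₂ * z.2, u z) (e₂, q z)) 2
      (volume.restrict (openRect a b))) :
    WeakDerivOn (openRect a b) (0, 1) (fun z => F (e₁ * z.1 + e₂ * z.2, u z))
      fun z => fderiv ℝ F (e₁ * z.1 + e₂ * z.2, u z) (e₂, q z) := by
  obtain ⟨U, g, hUg, hU, hg⟩ := exists_isVertPrimitive hb hu hq h
  have hc := hUg.comp hF e₁ e₂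
  have h1 : (fun z => F (e₁ * z.1 + e₂ * z.2, U z)) =ᵐ[volume.restrict (openRect a b)]
      fun z => F (e₁ * z.1 + e₂ * z.2, u z) := by
    filter_upwards [hU] with z hz
    rw [hz]
  have h2 : (fun z => fderiv ℝ F (e₁ * z.1 + e₂ * z.2, U z) (e₂, g z))
      =ᵐ[volume.restrict (openRect a b)]
      fun z => fderiv ℝ F (e₁ * z.1 + e₂ * z.2, u z) (e₂, q z) := by
    filter_upwards [hU, hg] with z hz hz'
    rw [hz, hz']
  refine WeakDerivOn.congr (fun φ hφ hφc hφs => ?_) h1 h2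
  exact hc.integral_fderiv_smul
    (locallyIntegrableOn_of_locallyIntegrable_restrict
      (((memLp_congr_ae h1).2 hv).locallyIntegrable (by norm_num)))
    (locallyIntegrableOn_of_locallyIntegrable_restrict
      (((memLp_congr_ae h2).2 hw).locallyIntegrable (by norm_num))) hφ hφc hφs

theorem MeasureTheory.MemLp.swap_openRect {a b : ℝ≥0∞} {u : ℝ × ℝ → ℂ}
    (hu : MemLp u 2 (volume.restrict (openRect a b))) :
    MemLp (fun z => u z.swap) 2 (volume.restrict (openRect b a)) :=
  hu.comp_measurePreserving (measurePreserving_swap_openRect a b)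

theorem WeakDerivOn.comp_fst {a b : ℝ≥0∞} (ha : 0 < a) {u p : ℝ × ℝ → ℂ}
    (hu : MemLp u 2 (volume.restrict (openRect a b)))
    (hp : MemLp p 2 (volume.restrict (openRect a b)))
    (h : WeakDerivOn (openRect a b) (1, 0) u p) {F : ℝ × ℂ → ℂ} (hF : ContDiff ℝ 1 F)
    (e₁ e₂ : ℝ)
    (hv : MemLp (fun z => F (e₁ * z.1 + e₂ * z.2, u z)) 2 (volume.restrict (openRect a b)))
    (hw : MemLp (fun z => fderiv ℝ F (e₁ * z.1 + e₂ * z.2, u z) (e₁, p z)) 2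
      (volume.restrict (openRect a b))) :
    WeakDerivOn (openRect a b) (1, 0) (fun z => F (e₁ * z.1 + e₂ * z.2, u z))
      fun z => fderiv ℝ F (e₁ * z.1 + e₂ * z.2, u z) (e₁, p z) := by
  have h1 := WeakDerivOn.comp_snd ha hu.swap_openRect hp.swap_openRect h.swap hF e₂ e₁
    (by simpa [add_comm] using hv.swap_openRect) (by simpa [add_comm] using hw.swap_openRect)
  simpa [add_comm] using h1.swap

/-! ### Radial cut-offs -/

/-- The partial derivative of a function of two real variables in the first variable. -/
noncomputable def derivFst (G : ℝ × ℝ → ℝ) (r s : ℝ) : ℝ := fderiv ℝ G (r, s) (1, 0)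

/-- The partial derivative of a function of two real variables in the second variable. -/
noncomputable def derivSnd (G : ℝ × ℝ → ℝ) (r s : ℝ) : ℝ := fderiv ℝ G (r, s) (0, 1)

/-- `G (r, s)` is `C¹` and vanishes for `s` below a positive continuous function of `r`. -/
structure IsCutoff (G : ℝ × ℝ → ℝ) : Prop where
  contDiff : ContDiff ℝ 1 G
  vanish : ∃ ψ : ℝ → ℝ, Continuous ψ ∧ (∀ r, 0 < ψ r) ∧ ∀ r s, s ≤ ψ r → G (r, s) = 0

namespace IsCutoff

variable {G : ℝ × ℝ → ℝ}

/-- Vanishing for small second argument removes the singularity of the norm at the origin, so that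
`G (r, |ξ|)` is `C¹` in `ξ`. -/
theorem eventually_eq_zero (hG : IsCutoff G) (r : ℝ) :
    (fun x : ℝ × ℂ => G (x.1, ‖x.2‖)) =ᶠ[𝓝 (r, 0)] fun _ => 0 := by
  obtain ⟨ψ, hψ, hψ0, h⟩ := hG.vanish
  have : ∀ᶠ x : ℝ × ℂ in 𝓝 (r, 0), ‖x.2‖ < ψ x.1 := by
    refine (continuous_snd.norm.continuousAt).eventually_lt
      ((hψ.comp continuous_fst).continuousAt) ?_
    simpa using hψ0 r
  filter_upwards [this] with x hx
  exact h _ _ hx.le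

theorem contDiff_norm (hG : IsCutoff G) : ContDiff ℝ 1 fun x : ℝ × ℂ => G (x.1, ‖x.2‖) := by
  rw [contDiff_iff_contDiffAt]
  rintro ⟨r, ξ⟩
  by_cases hξ : ξ = 0
  · subst hξ
    exact contDiffAt_const.congr_of_eventuallyEq (hG.eventually_eq_zero r)
  · exact hG.contDiff.contDiffAt.comp (r, ξ)
      (contDiffAt_fst.prodMk ((contDiffAt_norm ℝ (x := ξ) hξ).comp (r, ξ) contDiffAt_snd))

theorem fderiv_of_nonpos (hG : IsCutoff G) {r s : ℝ} (hs : s ≤ 0) : fderiv ℝ G (r, s) = 0 := by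
  obtain ⟨ψ, hψ, hψ0, h⟩ := hG.vanish
  have : G =ᶠ[𝓝 (r, s)] fun _ => 0 := by
    have : ∀ᶠ x : ℝ × ℝ in 𝓝 (r, s), x.2 < ψ x.1 :=
      continuous_snd.continuousAt.eventually_lt ((hψ.comp continuous_fst).continuousAt)
        (lt_of_le_of_lt hs (hψ0 r))
    filter_upwards [this] with x hx
    exact h _ _ hx.le
  rw [this.fderiv_eq]
  simp

theorem fderiv_apply (G : ℝ × ℝ → ℝ) (r s dr ds : ℝ) :
    fderiv ℝ G (r, s) (dr, ds) = derivFst G r s * dr + derivSnd G r s * ds := by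
  have : ((dr, ds) : ℝ × ℝ) = dr • ((1 : ℝ), (0 : ℝ)) + ds • ((0 : ℝ), (1 : ℝ)) := by simp
  rw [this, map_add, map_smul, map_smul, derivFst, derivSnd, smul_eq_mul, smul_eq_mul, mul_comm,
    mul_comm ds]

/-- At `ξ = 0` both partial derivatives of `G` vanish, so the quotient with zero denominator does no
harm there. -/
theorem fderiv_norm (hG : IsCutoff G) (r dr : ℝ) (ξ η : ℂ) :
    fderiv ℝ (fun x : ℝ × ℂ => G (x.1, ‖x.2‖)) (r, ξ) (dr, η) =
      derivFst G r ‖ξ‖ * dr + derivSnd G r ‖ξ‖ * (inner ℝ ξ η / ‖ξ‖) := by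
  by_cases hξ : ξ = 0
  · subst hξ
    rw [(hG.eventually_eq_zero r).fderiv_eq]
    simp [derivFst, derivSnd, hG.fderiv_of_nonpos (s := 0) le_rfl]
  · have h1 : HasFDerivAt (fun x : ℂ => ‖x‖) (‖ξ‖⁻¹ • innerSL ℝ ξ) ξ := by
      have h2 : HasFDerivAt (fun x : ℂ => ‖x‖ ^ 2) _ ξ := (hasStrictFDerivAt_norm_sq ξ).hasFDerivAt
      have h3 := h2.sqrt (by positivity)
      simp only [Real.sqrt_sq (norm_nonneg _)] at h3
      have h4 : (1 / (2 * ‖ξ‖)) • 2 • innerSL ℝ ξ = ‖ξ‖⁻¹ • innerSL ℝ ξ := by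
        rw [two_smul, ← two_smul ℝ, smul_smul]
        congr 1
        field_simp
      rwa [h4] at h3
    have h2 : HasFDerivAt (fun x : ℝ × ℂ => (x.1, ‖x.2‖))
        ((ContinuousLinearMap.fst ℝ ℝ ℂ).prod
          ((‖ξ‖⁻¹ • innerSL ℝ ξ).comp (ContinuousLinearMap.snd ℝ ℝ ℂ))) (r, ξ) :=
      hasFDerivAt_fst.prodMk (h1.comp (r, ξ) hasFDerivAt_snd)
    have h3 : HasFDerivAt G (fderiv ℝ G (r, ‖ξ‖)) (r, ‖ξ‖) :=
      (hG.contDiff.differentiable one_ne_zero _).hasFDerivAt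
    have h4 := HasFDerivAt.comp (r, ξ) (g := G) (f := fun x : ℝ × ℂ => (x.1, ‖x.2‖)) h3 h2
    refine (congrArg (fun l => l (dr, η)) h4.fderiv).trans ?_
    refine Eq.trans ?_ (fderiv_apply G r ‖ξ‖ dr (inner ℝ ξ η / ‖ξ‖))
    simp [div_eq_inv_mul]

theorem contDiff_smul (hG : IsCutoff G) :
    ContDiff ℝ 1 fun x : ℝ × ℂ => G (x.1, ‖x.2‖) • x.2 :=
  hG.contDiff_norm.smul contDiff_snd

theorem fderiv_smul (hG : IsCutoff G) (r dr : ℝ) (ξ η : ℂ) :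
    fderiv ℝ (fun x : ℝ × ℂ => G (x.1, ‖x.2‖) • x.2) (r, ξ) (dr, η) =
      G (r, ‖ξ‖) • η +
        (derivFst G r ‖ξ‖ * dr + derivSnd G r ‖ξ‖ * (inner ℝ ξ η / ‖ξ‖)) • ξ := by
  have h1 := (hG.contDiff_norm.differentiable one_ne_zero (r, ξ)).hasFDerivAt.smul
    (hasFDerivAt_snd (𝕜 := ℝ) (E := ℝ) (F := ℂ) (p := (r, ξ)))
  refine (congrArg (fun l => l (dr, η)) h1.fderiv).trans ?_
  simp [hG.fderiv_norm]

end IsCutoff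

/-- The bounds on a cut-off `G` under which `G (r, |ξ|) ξ` is a Lipschitz function of `ξ`. -/
structure IsCutoff.Bounded (G : ℝ × ℝ → ℝ) (B : ℝ) : Prop where
  isCutoff : IsCutoff G
  le : ∀ r s, 0 ≤ r → 0 ≤ s → |G (r, s)| ≤ B
  le_fst : ∀ r s, 0 ≤ r → 0 ≤ s → |derivFst G r s| ≤ B
  le_snd : ∀ r s, 0 ≤ r → 0 ≤ s → |derivSnd G r s| * s ≤ B

namespace IsCutoff.Bounded

variable {G : ℝ × ℝ → ℝ} {B : ℝ}

theorem nonneg (h : IsCutoff.Bounded G B) : 0 ≤ B :=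
  (abs_nonneg _).trans (h.le 0 0 le_rfl le_rfl)

theorem norm_deriv_le (h : IsCutoff.Bounded G B) {r : ℝ} (hr : 0 ≤ r) (ξ η : ℂ) :
    ‖(derivSnd G r ‖ξ‖ * (inner ℝ ξ η / ‖ξ‖)) • ξ‖ ≤ B * ‖η‖ := by
  rw [norm_smul, Real.norm_eq_abs, abs_mul, abs_div, abs_norm]
  by_cases hξ : ξ = 0
  · subst hξ
    simp
    exact mul_nonneg h.nonneg (norm_nonneg _)
  · have h1 := h.le_snd r ‖ξ‖ hr (norm_nonneg _)
    have h2 : |inner ℝ ξ η| / ‖ξ‖ ≤ ‖η‖ := by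
      rw [div_le_iff₀ (norm_pos_iff.2 hξ), mul_comm]
      exact abs_real_inner_le_norm ξ η
    calc |derivSnd G r ‖ξ‖| * (|inner ℝ ξ η| / ‖ξ‖) * ‖ξ‖
        = (|derivSnd G r ‖ξ‖| * ‖ξ‖) * (|inner ℝ ξ η| / ‖ξ‖) := by ring
      _ ≤ B * ‖η‖ := mul_le_mul h1 h2 (by positivity) h.nonneg

/-- The mean value inequality is used first in `ξ` at fixed `r'`, then in `r` at fixed `ξ`. The
second error is later the distance to a side, which disappears in the trace. -/
theorem norm_sub_le (h : IsCutoff.Bounded G B) {r r' : ℝ} (hr : 0 ≤ r) (hr' : 0 ≤ r') (ξ ξ' : ℂ) :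
    ‖G (r, ‖ξ‖) • ξ - G (r', ‖ξ'‖) • ξ'‖ ≤ 2 * B * ‖ξ - ξ'‖ + B * |r - r'| * ‖ξ‖ := by
  have hd : ∀ y, HasFDerivAt (fun x : ℝ × ℂ => G (x.1, ‖x.2‖) • x.2)
      (fderiv ℝ (fun x : ℝ × ℂ => G (x.1, ‖x.2‖) • x.2) y) y := fun y =>
    (h.isCutoff.contDiff_smul.differentiable one_ne_zero y).hasFDerivAt
  have h1 : ‖G (r', ‖ξ‖) • ξ - G (r', ‖ξ'‖) • ξ'‖ ≤ 2 * B * ‖ξ - ξ'‖ := by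
    have hc : ∀ x : ℂ, HasFDerivAt (fun x : ℂ => ((r', x) : ℝ × ℂ))
        (ContinuousLinearMap.inr ℝ ℝ ℂ) x := fun x => hasFDerivAt_prodMk_right r' x
    refine (convex_univ (𝕜 := ℝ) (E := ℂ)).norm_image_sub_le_of_norm_hasFDerivWithin_le
      (f := fun x : ℂ => G (r', ‖x‖) • x)
      (fun x _ => ((hd (r', x)).comp x (hc x)).hasFDerivWithinAt) (fun x _ => ?_)
      (mem_univ ξ') (mem_univ ξ)
    refine ContinuousLinearMap.opNorm_le_bound _ (mul_nonneg zero_le_two h.nonneg) fun η => ?_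
    have e : ((fderiv ℝ (fun x : ℝ × ℂ => G (x.1, ‖x.2‖) • x.2) (r', x)).comp
      (ContinuousLinearMap.inr ℝ ℝ ℂ)) η =
      fderiv ℝ (fun x : ℝ × ℂ => G (x.1, ‖x.2‖) • x.2) (r', x) (0, η) := rfl
    rw [e, h.isCutoff.fderiv_smul, mul_zero, zero_add]
    refine (norm_add_le _ _).trans ?_
    have h2 : ‖G (r', ‖x‖) • η‖ ≤ B * ‖η‖ := by
      rw [norm_smul]
      exact mul_le_mul_of_nonneg_right (h.le _ _ hr' (norm_nonneg _)) (norm_nonneg _)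
    linarith [h.norm_deriv_le hr' x η]
  have h2 : |G (r, ‖ξ‖) - G (r', ‖ξ‖)| ≤ B * |r - r'| := by
    have hc : ∀ x : ℝ, HasDerivAt (fun x : ℝ => G (x, ‖ξ‖)) (derivFst G x ‖ξ‖) x := fun x =>
      ((h.isCutoff.contDiff.differentiable one_ne_zero (x, ‖ξ‖)).hasFDerivAt).comp_hasDerivAt x
        ((hasDerivAt_id x).prodMk (hasDerivAt_const x _))
    exact (convex_Ici (0 : ℝ)).norm_image_sub_le_of_norm_hasDerivWithin_le
      (fun x _ => (hc x).hasDerivWithinAt) (fun x hx => h.le_fst x _ hx (norm_nonneg _)) hr' hr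
  have h3 : G (r, ‖ξ‖) • ξ - G (r', ‖ξ'‖) • ξ' =
      (G (r', ‖ξ‖) • ξ - G (r', ‖ξ'‖) • ξ') + (G (r, ‖ξ‖) - G (r', ‖ξ‖)) • ξ := by
    rw [sub_smul]
    abel
  rw [h3]
  refine (norm_add_le _ _).trans (add_le_add h1 ?_)
  rw [norm_smul]
  exact mul_le_mul_of_nonneg_right h2 (norm_nonneg _)

end IsCutoff.Bounded

/-! ### Test functions on an open book -/

namespace OpenBook

variable {J K : Type*} (L : OpenBook J K)

open Classical in
/-- `1` for the pages which are infinite in the first direction, `0` for the others. -/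
noncomputable def wt₁ (k : K) : ℝ := if L.len₁ k = ∞ then 1 else 0

open Classical in
/-- `1` for the pages which are infinite in the second direction, `0` for the others. -/
noncomputable def wt₂ (k : K) : ℝ := if L.len₂ k = ∞ then 1 else 0

/-- The sum of those coordinates of a point of a page which run in infinite directions. -/
noncomputable def height (k : K) (z : ℝ × ℝ) : ℝ := L.wt₁ k * z.1 + L.wt₂ k * z.2

theorem wt₁_nonneg (k : K) : 0 ≤ L.wt₁ k := by unfold wt₁; split_ifs <;> simp

theorem wt₂_nonneg (k : K) : 0 ≤ L.wt₂ k := by unfold wt₂; split_ifs <;> simp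

theorem wt₁_le_one (k : K) : L.wt₁ k ≤ 1 := by unfold wt₁; split_ifs <;> simp

theorem wt₂_le_one (k : K) : L.wt₂ k ≤ 1 := by unfold wt₂; split_ifs <;> simp

theorem height_nonneg {k : K} {z : ℝ × ℝ} (hz : z ∈ L.page k) : 0 ≤ L.height k z :=
  add_nonneg (mul_nonneg (L.wt₁_nonneg k) hz.1.le) (mul_nonneg (L.wt₂_nonneg k) hz.2.2.1.le)

theorem continuous_height (k : K) : Continuous (L.height k) := by
  unfold height
  fun_prop

theorem measurableSet_page (k : K) : MeasurableSet (L.page k) := measurableSet_openRect _ _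

variable {L}

theorem MemL2.memLp {u : K → ℝ × ℝ → ℂ} (hu : L.MemL2 u) (k : K) :
    MemLp (u k) 2 (volume.restrict (L.page k)) :=
  memLp_two_iff_lintegral.2 ⟨hu.1 k, (ENNReal.le_tsum k).trans_lt hu.2⟩

theorem enorm_sq_eq_ofReal {E : Type*} [NormedAddCommGroup E] (x : E) :
    ‖x‖ₑ ^ 2 = ENNReal.ofReal (‖x‖ ^ 2) := by
  rw [ENNReal.ofReal_pow (norm_nonneg _), ofReal_norm]

theorem enorm_sq_le_of_norm_le {E F H : Type*} [NormedAddCommGroup E] [NormedAddCommGroup F]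
    [NormedAddCommGroup H] {a : E} {b : F} {c : H} {A : ℝ}
    (h : ‖a‖ ≤ A * (‖b‖ + ‖c‖)) :
    ‖a‖ₑ ^ 2 ≤ ENNReal.ofReal (2 * A ^ 2) * (‖b‖ₑ ^ 2 + ‖c‖ₑ ^ 2) := by
  rw [enorm_sq_eq_ofReal, enorm_sq_eq_ofReal, enorm_sq_eq_ofReal, ← ENNReal.ofReal_add (by positivity) (by positivity),
    ← ENNReal.ofReal_mul (by positivity)]
  refine ENNReal.ofReal_le_ofReal ?_
  have h1 : ‖a‖ ^ 2 ≤ (A * (‖b‖ + ‖c‖)) ^ 2 := pow_le_pow_left₀ (norm_nonneg _) h 2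
  have h2 : (‖b‖ + ‖c‖) ^ 2 ≤ 2 * (‖b‖ ^ 2 + ‖c‖ ^ 2) := by nlinarith [sq_nonneg (‖b‖ - ‖c‖)]
  calc ‖a‖ ^ 2 ≤ A ^ 2 * (‖b‖ + ‖c‖) ^ 2 := by rw [← mul_pow]; exact h1
    _ ≤ A ^ 2 * (2 * (‖b‖ ^ 2 + ‖c‖ ^ 2)) := mul_le_mul_of_nonneg_left h2 (by positivity)
    _ = _ := by ring

theorem MemL2.of_norm_le {u p v : K → ℝ × ℝ → ℂ} (hu : L.MemL2 u) (hp : L.MemL2 p)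
    (hv : ∀ k, AEStronglyMeasurable (v k) (volume.restrict (L.page k))) {A : ℝ}
    (h : ∀ k, ∀ z ∈ L.page k, ‖v k z‖ ≤ A * (‖u k z‖ + ‖p k z‖)) : L.MemL2 v := by
  refine ⟨hv, ?_⟩
  have h1 : ∀ k, ∫⁻ z in L.page k, ‖v k z‖ₑ ^ 2 ≤ ENNReal.ofReal (2 * A ^ 2) *
      ((∫⁻ z in L.page k, ‖u k z‖ₑ ^ 2) + ∫⁻ z in L.page k, ‖p k z‖ₑ ^ 2) := by
    intro k
    rw [← lintegral_add_left' ((hu.1 k).enorm.pow_const 2),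
      ← lintegral_const_mul' _ _ ENNReal.ofReal_ne_top]
    exact setLIntegral_mono' (L.measurableSet_page k) fun z hz =>
      enorm_sq_le_of_norm_le (h k z hz)
  refine (ENNReal.tsum_le_tsum h1).trans_lt ?_
  rw [ENNReal.tsum_mul_left, ENNReal.tsum_add]
  exact ENNReal.mul_lt_top ENNReal.ofReal_lt_top (ENNReal.add_lt_top.2 ⟨hu.2, hp.2⟩)

variable (L)

/-- The function `G (height, |u|) u` on the pages in `C`, continued by zero. -/
noncomputable def cut (C : Set K) (G : ℝ × ℝ → ℝ) (u : K → ℝ × ℝ → ℂ) : K → ℝ × ℝ → ℂ :=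
  C.indicator fun k z => G (L.height k z, ‖u k z‖) • u k z

/-- The derivative of `cut` in a direction in which `u` has the derivative `p` and the height has the
derivative `wt`. -/
noncomputable def cutDeriv (C : Set K) (G : ℝ × ℝ → ℝ) (wt : K → ℝ) (u p : K → ℝ × ℝ → ℂ) :
    K → ℝ × ℝ → ℂ :=
  C.indicator fun k z => G (L.height k z, ‖u k z‖) • p k z +
    (derivFst G (L.height k z) ‖u k z‖ * wt k +
      derivSnd G (L.height k z) ‖u k z‖ * (inner ℝ (u k z) (p k z) / ‖u k z‖)) • u k z

variable {L}
variable {C : Set K} {G : ℝ × ℝ → ℝ} {B : ℝ} {u p q : K → ℝ × ℝ → ℂ}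

theorem memL2_cut (hG : IsCutoff.Bounded G B) (hu : L.MemL2 u) : L.MemL2 (L.cut C G u) := by
  refine hu.of_norm_le hu (A := B) (fun k => ?_) fun k z hz => ?_
  · by_cases hk : k ∈ C
    · rw [cut, indicator_of_mem hk]
      exact hG.isCutoff.contDiff_smul.continuous.comp_aestronglyMeasurable
        ((L.continuous_height k).aestronglyMeasurable.prodMk (hu.1 k))
    · rw [cut, indicator_of_notMem hk]
      exact aestronglyMeasurable_zero
  · by_cases hk : k ∈ C
    · rw [cut, indicator_of_mem hk, norm_smul]
      refine mul_le_mul (hG.le _ _ (L.height_nonneg hz) (norm_nonneg _)) ?_ (norm_nonneg _)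
        hG.nonneg
      linarith [norm_nonneg (u k z)]
    · rw [cut, indicator_of_notMem hk]
      simpa using mul_nonneg hG.nonneg (by positivity)

theorem memL2_cutDeriv (hG : IsCutoff.Bounded G B) (hu : L.MemL2 u) (hp : L.MemL2 p) {wt : K → ℝ}
    (hwt : ∀ k, |wt k| ≤ 1) : L.MemL2 (L.cutDeriv C G wt u p) := by
  refine hu.of_norm_le hp (fun k => ?_) (A := 2 * B) fun k z hz => ?_
  · by_cases hk : k ∈ C
    · rw [cutDeriv, indicator_of_mem hk]
      have h1 := (L.continuous_height k).aestronglyMeasurable (μ := volume.restrict (L.page k))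
      have := (isBoundedBilinearMap_apply (𝕜 := ℝ) (E := ℝ × ℂ) (F := ℂ)).continuous
        |>.comp_aestronglyMeasurable
          (((hG.isCutoff.contDiff_smul.continuous_fderiv one_ne_zero).comp_aestronglyMeasurable
            (h1.prodMk (hu.1 k))).prodMk
          ((aestronglyMeasurable_const (b := wt k)).prodMk (hp.1 k)))
      simpa only [hG.isCutoff.fderiv_smul] using this
    · rw [cutDeriv, indicator_of_notMem hk]
      exact aestronglyMeasurable_zero
  · by_cases hk : k ∈ C
    · rw [cutDeriv, indicator_of_mem hk, add_smul]
      have hh := L.height_nonneg hz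
      have h1 : ‖G (L.height k z, ‖u k z‖) • p k z‖ ≤ B * ‖p k z‖ := by
        rw [norm_smul]
        exact mul_le_mul_of_nonneg_right (hG.le _ _ hh (norm_nonneg _)) (norm_nonneg _)
      have h2 : ‖(derivFst G (L.height k z) ‖u k z‖ * wt k) • u k z‖ ≤ B * ‖u k z‖ := by
        rw [norm_smul, Real.norm_eq_abs, abs_mul]
        refine mul_le_mul_of_nonneg_right ?_ (norm_nonneg _)
        calc _ ≤ B * 1 := mul_le_mul (hG.le_fst _ _ hh (norm_nonneg _)) (hwt k) (abs_nonneg _)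
              hG.nonneg
          _ = B := mul_one B
      have h3 := hG.norm_deriv_le hh (u k z) (p k z)
      refine (norm_add_le _ _).trans ((add_le_add_right (norm_add_le _ _) _).trans ?_)
      have : 0 ≤ B * ‖u k z‖ := mul_nonneg hG.nonneg (norm_nonneg _)
      linarith
    · rw [cutDeriv, indicator_of_notMem hk]
      simpa using mul_nonneg (mul_nonneg zero_le_two hG.nonneg) (by positivity)

theorem weakDerivOn_zero (R : Set (ℝ × ℝ)) (e : ℝ × ℝ) : WeakDerivOn R e 0 0 := by
  intro φ _ _ _
  simp

theorem abs_wt₁_le (k : K) : |L.wt₁ k| ≤ 1 := by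
  rw [abs_of_nonneg (L.wt₁_nonneg k)]
  exact L.wt₁_le_one k

theorem abs_wt₂_le (k : K) : |L.wt₂ k| ≤ 1 := by
  rw [abs_of_nonneg (L.wt₂_nonneg k)]
  exact L.wt₂_le_one k

theorem isH1_cut (hG : IsCutoff.Bounded G B) (hu : L.IsH1 u p q) :
    L.IsH1 (L.cut C G u) (L.cutDeriv C G L.wt₁ u p) (L.cutDeriv C G L.wt₂ u q) := by
  obtain ⟨hu, hp, hq, hup, huq⟩ := hu
  have m0 := memL2_cut (C := C) hG hu
  have m1 := memL2_cutDeriv (C := C) hG hu hp (wt := L.wt₁) abs_wt₁_le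
  have m2 := memL2_cutDeriv (C := C) hG hu hq (wt := L.wt₂) abs_wt₂_le
  refine ⟨m0, m1, m2, fun k => ?_, fun k => ?_⟩
  · change WeakDerivOn (L.page k) (1, 0) (L.cut C G u k) (L.cutDeriv C G L.wt₁ u p k)
    have n0 := m0.memLp k
    have n1 := m1.memLp k
    by_cases hk : k ∈ C
    · rw [cut, indicator_of_mem hk] at n0 ⊢
      rw [cutDeriv, indicator_of_mem hk] at n1 ⊢
      simp only [← hG.isCutoff.fderiv_smul] at n1 ⊢
      exact WeakDerivOn.comp_fst (L.len₁_pos k) (hu.memLp k) (hp.memLp k) (hup k)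
        hG.isCutoff.contDiff_smul (L.wt₁ k) (L.wt₂ k) n0 n1
    · rw [cut, cutDeriv, indicator_of_notMem hk, indicator_of_notMem hk]
      exact weakDerivOn_zero _ _
  · change WeakDerivOn (L.page k) (0, 1) (L.cut C G u k) (L.cutDeriv C G L.wt₂ u q k)
    have n0 := m0.memLp k
    have n1 := m2.memLp k
    by_cases hk : k ∈ C
    · rw [cut, indicator_of_mem hk] at n0 ⊢
      rw [cutDeriv, indicator_of_mem hk] at n1 ⊢
      simp only [← hG.isCutoff.fderiv_smul] at n1 ⊢
      exact WeakDerivOn.comp_snd (L.len₂_pos k) (hu.memLp k) (hq.memLp k) (huq k)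
        hG.isCutoff.contDiff_smul (L.wt₁ k) (L.wt₂ k) n0 n1
    · rw [cut, cutDeriv, indicator_of_notMem hk, indicator_of_notMem hk]
      exact weakDerivOn_zero _ _

/-- The trace of a function that is close, near the side, to a function of a function with a trace. -/
theorem HasTrace.of_norm_sub_le {v : K → ℝ × ℝ → ℂ} {k : K} {s : Side} {τ σ : ℝ → ℂ} {A : ℝ}
    (hA : 0 ≤ A) (h : L.HasTrace u k s τ) (hu : L.MemL2 u)
    (hσ : MemLp σ 2 (volume.restrict (ray (s.length (L.len₁ k) (L.len₂ k)))))
    (hle : ∀ z ∈ L.page k, ‖v k z - σ (s.along z)‖ ≤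
      A * (‖u k z - τ (s.along z)‖ + s.depth (L.len₁ k) (L.len₂ k) z * ‖u k z‖)) : L.HasTrace v k s σ := by
  refine ⟨hσ, ?_⟩
  set D : ℝ → Set (ℝ × ℝ) := fun δ => {z ∈ L.page k | s.depth (L.len₁ k) (L.len₂ k) z < δ} with hD
  set I := ∫⁻ z in L.page k, ‖u k z‖ₑ ^ 2 with hI
  have hIfin : I < ∞ := (memLp_two_iff_lintegral.1 (hu.memLp k)).2
  have hdm : Measurable (s.depth (L.len₁ k) (L.len₂ k)) := by
    cases s
    · exact measurable_fst
    · exact measurable_const.sub measurable_fst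
    · exact measurable_snd
    · exact measurable_const.sub measurable_snd
  have hDm : ∀ δ, MeasurableSet (D δ) := fun δ =>
    (L.measurableSet_page k).inter (measurableSet_lt hdm measurable_const)
  -- In the strip the depth is below `δ`, so the depth term contributes at most `δ² ∫ |u|²`; after
  -- division by `δ` it still tends to zero.
  have hb : ∀ δ > 0, (ENNReal.ofReal δ)⁻¹ * ∫⁻ z in D δ, ‖v k z - σ (s.along z)‖ₑ ^ 2 ≤
      ENNReal.ofReal (2 * A ^ 2) * ((ENNReal.ofReal δ)⁻¹ *
        (∫⁻ z in D δ, ‖u k z - τ (s.along z)‖ₑ ^ 2)) +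
      ENNReal.ofReal (2 * A ^ 2) * (ENNReal.ofReal δ * I) := by
    intro δ hδ
    have h1 : ∫⁻ z in D δ, ‖v k z - σ (s.along z)‖ₑ ^ 2 ≤
        ENNReal.ofReal (2 * A ^ 2) * ((∫⁻ z in D δ, ‖u k z - τ (s.along z)‖ₑ ^ 2) +
          ENNReal.ofReal (δ ^ 2) * I) := by
      have h2 : ∫⁻ z in D δ, ENNReal.ofReal (δ ^ 2) * ‖u k z‖ₑ ^ 2 ≤ ENNReal.ofReal (δ ^ 2) * I := by
        rw [lintegral_const_mul' _ _ ENNReal.ofReal_ne_top]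
        exact mul_le_mul_right (lintegral_mono_set fun z hz => hz.1) _
      refine le_trans ?_ (mul_le_mul_right (add_le_add_right h2 _) _)
      have hm : AEMeasurable (fun z => ENNReal.ofReal (δ ^ 2) * ‖u k z‖ₑ ^ 2)
          (volume.restrict (D δ)) :=
        ((((hu.1 k).mono_set fun z hz => hz.1).enorm.pow_const 2)).const_mul _
      rw [← lintegral_add_right' _ hm, ← lintegral_const_mul' _ _ ENNReal.ofReal_ne_top]
      refine setLIntegral_mono' (hDm δ) fun z hz => ?_
      have h3 := hle z hz.1
      have h4 : ‖v k z - σ (s.along z)‖ ≤ A * (‖u k z - τ (s.along z)‖ + ‖δ • u k z‖) := by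
        refine h3.trans (mul_le_mul_of_nonneg_left (add_le_add_right ?_ _) hA)
        rw [norm_smul, Real.norm_of_nonneg hδ.le]
        exact mul_le_mul_of_nonneg_right hz.2.le (norm_nonneg _)
      refine (enorm_sq_le_of_norm_le h4).trans (le_of_eq ?_)
      rw [enorm_smul, mul_pow, ENNReal.ofReal_pow hδ.le, Real.enorm_of_nonneg hδ.le]
    refine (mul_le_mul_right h1 _).trans (le_of_eq ?_)
    have hδ0 : ENNReal.ofReal δ ≠ 0 := by simpa using hδ
    have e : (ENNReal.ofReal δ)⁻¹ * (ENNReal.ofReal (δ ^ 2) * I) = ENNReal.ofReal δ * I := by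
      rw [ENNReal.ofReal_pow hδ.le, pow_two, ← mul_assoc, ← mul_assoc,
        ENNReal.inv_mul_cancel hδ0 ENNReal.ofReal_ne_top, one_mul]
    rw [mul_left_comm, mul_add, mul_add, e]
  have ht1 := ENNReal.Tendsto.const_mul (a := ENNReal.ofReal (2 * A ^ 2)) h.2
    (Or.inr ENNReal.ofReal_ne_top)
  have ht2 : Tendsto (fun δ : ℝ => ENNReal.ofReal (2 * A ^ 2) * (ENNReal.ofReal δ * I)) (𝓝[>] 0)
      (𝓝 (ENNReal.ofReal (2 * A ^ 2) * (ENNReal.ofReal 0 * I))) := by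
    refine ENNReal.Tendsto.const_mul (ENNReal.Tendsto.mul_const ?_ (Or.inr hIfin.ne))
      (Or.inr ENNReal.ofReal_ne_top)
    exact (ENNReal.continuous_ofReal.tendsto 0).mono_left nhdsWithin_le_nhds
  have ht := ht1.add ht2
  simp only [mul_zero, ENNReal.ofReal_zero, zero_mul, add_zero] at ht
  refine tendsto_of_tendsto_of_tendsto_of_le_of_le' tendsto_const_nhds ht
    (Eventually.of_forall fun _ => zero_le) ?_
  filter_upwards [self_mem_nhdsWithin] with δ hδ
  exact hb δ hδ

-- Up to the distance to the side, the height is the coordinate along an infinite side and zero on a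
-- finite one. Its boundary value is thus the same from all pages on a binding.
open Classical in
theorem abs_height_sub_le {k : K} {s : Side} (hs : s.Present (L.len₁ k) (L.len₂ k)) {z : ℝ × ℝ}
    (hz : z ∈ L.page k) :
    0 ≤ (if s.length (L.len₁ k) (L.len₂ k) = ∞ then s.along z else 0) ∧
    |L.height k z - if s.length (L.len₁ k) (L.len₂ k) = ∞ then s.along z else 0| ≤
      s.depth (L.len₁ k) (L.len₂ k) z := by
  obtain ⟨h1, h2, h3, h4⟩ := hz
  have b1 : L.len₁ k ≠ ∞ → z.1 ≤ (L.len₁ k).toReal := fun h =>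
    (ENNReal.ofReal_le_iff_le_toReal h).1 h2.le
  have b2 : L.len₂ k ≠ ∞ → z.2 ≤ (L.len₂ k).toReal := fun h =>
    (ENNReal.ofReal_le_iff_le_toReal h).1 h4.le
  have a1 := abs_of_pos h1
  have a2 := abs_of_pos h3
  cases s <;> simp only [Side.Present, ne_eq] at hs <;>
    simp only [Side.length, Side.along, Side.depth, height, wt₁, wt₂]
  · by_cases e1 : L.len₁ k = ∞ <;> by_cases e2 : L.len₂ k = ∞ <;> simp [e1, e2, a1, h1.le, h3.le]
  · have := b1 hs
    by_cases e2 : L.len₂ k = ∞ <;> simp [hs, e2, h3.le, this]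
  · by_cases e1 : L.len₁ k = ∞ <;> by_cases e2 : L.len₂ k = ∞ <;> simp [e1, e2, a2, h1.le, h3.le]
  · have := b2 hs
    by_cases e1 : L.len₁ k = ∞ <;> simp [hs, e1, h1.le, this]

/-- An infinite side cannot be reversed, so on an infinite binding all pages use the same parameter.
-/
theorem param_of_top {k : K} {s : Side} (hs : s.Present (L.len₁ k) (L.len₂ k))
    (h : s.length (L.len₁ k) (L.len₂ k) = ∞) (t : ℝ) : L.param k s t = t := by
  rw [param, if_neg]
  intro hf
  exact L.flip_finite k s hs hf ((L.len_binding k s hs).trans h)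

theorem hasTrace_zero (k : K) (s : Side) {v : K → ℝ × ℝ → ℂ} (hv : v k = 0) :
    L.HasTrace v k s 0 := by
  refine ⟨MemLp.zero, ?_⟩
  simp [hv]

open Classical in
theorem hasTrace_cut (hG : IsCutoff.Bounded G B) (hu : L.MemL2 u) {k : K} {s : Side}
    (hk : k ∈ C) (hs : s.Present (L.len₁ k) (L.len₂ k)) {τ : ℝ → ℂ} (h : L.HasTrace u k s τ) :
    L.HasTrace (L.cut C G u) k s fun t =>
      G (if s.length (L.len₁ k) (L.len₂ k) = ∞ then t else 0, ‖τ t‖) • τ t := by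
  have hr : Measurable fun t : ℝ => if s.length (L.len₁ k) (L.len₂ k) = ∞ then t else 0 := by
    split_ifs
    · exact measurable_id
    · exact measurable_const
  refine HasTrace.of_norm_sub_le (A := 2 * B) (mul_nonneg zero_le_two hG.nonneg) h hu ?_ ?_
  · have hτ := h.1
    refine MemLp.of_le_mul (c := B) hτ ?_ ?_
    · exact hG.isCutoff.contDiff_smul.continuous.comp_aestronglyMeasurable
        (hr.aestronglyMeasurable.prodMk hτ.1)
    · filter_upwards [ae_restrict_mem (measurableSet_ray _)] with t ht
      rw [norm_smul]
      refine mul_le_mul_of_nonneg_right (hG.le _ _ ?_ (norm_nonneg _)) (norm_nonneg _)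
      split_ifs
      · exact ht.1.le
      · exact le_rfl
  · intro z hz
    rw [cut, indicator_of_mem hk]
    obtain ⟨h1, h2⟩ := L.abs_height_sub_le hs hz
    refine (hG.norm_sub_le (L.height_nonneg hz) h1 _ _).trans ?_
    have h3 := mul_le_mul_of_nonneg_left (mul_le_mul_of_nonneg_right h2 (norm_nonneg (u k z)))
      hG.nonneg
    have h4 : 0 ≤ B * (s.depth (L.len₁ k) (L.len₂ k) z * ‖u k z‖) :=
      mul_nonneg hG.nonneg (mul_nonneg ((abs_nonneg _).trans h2) (norm_nonneg _))
    linarith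

/-- If infinite bindings do not separate `C` from its complement, and the cut-off vanishes at height
zero unless `C` contains all pages, then `cut` preserves `H¹_D`. -/
theorem isH1D_cut (hG : IsCutoff.Bounded G B) (hu : L.IsH1D u p q)
    (hC : ∀ j, L.len j = ∞ → ∀ k s k' s', L.Incident k s j → L.Incident k' s' j → k ∈ C → k' ∈ C)
    (h0 : C = univ ∨ ∀ s, G (0, s) = 0) :
    L.IsH1D (L.cut C G u) (L.cutDeriv C G L.wt₁ u p) (L.cutDeriv C G L.wt₂ u q) := by
  classical
  refine ⟨isH1_cut hG hu.1, fun j => ?_⟩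
  obtain ⟨τ, hτ⟩ := hu.2 j
  by_cases hj : ∃ k s, L.Incident k s j ∧ k ∈ C
  · obtain ⟨k₀, s₀, hi₀, hk₀⟩ := hj
    refine ⟨fun t => G (if L.len j = ∞ then t else 0, ‖τ t‖) • τ t, fun k s hi => ?_⟩
    have hlen : L.len j = s.length (L.len₁ k) (L.len₂ k) := by
      rw [← hi.2]
      exact L.len_binding k s hi.1
    by_cases hk : k ∈ C
    · convert hasTrace_cut hG hu.1.1 hk hi.1 (hτ k s hi) using 5 with t
      rw [hlen]
      split_ifs with hs
      · exact L.param_of_top hi.1 hs t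
      · rfl
    -- A page outside `C` shares this binding with a page in `C`, so the binding is finite. Its
    -- height is zero, where the cut-off vanishes: the trace from inside matches the extension by
    -- zero.
    · have hfin : L.len j ≠ ∞ := fun h => hk (hC j h k₀ s₀ k s hi₀ hi hk₀)
      have hG0 : ∀ s, G (0, s) = 0 := by
        rcases h0 with h0 | h0
        · exact absurd (h0 ▸ mem_univ k) hk
        · exact h0
      simp only [if_neg hfin, hG0, zero_smul]
      exact hasTrace_zero k s (by rw [cut, indicator_of_notMem hk])
  · refine ⟨0, fun k s hi => ?_⟩
    have hk : k ∉ C := fun hk => hj ⟨k, s, hi, hk⟩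
    exact hasTrace_zero k s (by rw [cut, indicator_of_notMem hk])

end OpenBook

/-! ### The measure of a family of pages -/

namespace OpenBook

variable {J K : Type*} (L : OpenBook J K)

/-- The sum of the Lebesgue measures of the pages in `C`. -/
noncomputable def vol (C : Set K) : Measure (Σ _ : K, ℝ × ℝ) :=
  Measure.sum fun k : C => (volume.restrict (L.page k)).map fun z => ⟨k.1, z⟩

theorem measurableEmbedding_sigmaMk (k : K) :
    MeasurableEmbedding (fun z : ℝ × ℝ => (⟨k, z⟩ : Σ _ : K, ℝ × ℝ)) where
  injective := fun z z' h => by simpa using h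
  measurable := measurable_iff_le_map.2 (iInf_le _ k)
  measurableSet_image' := fun {s} hs => by
    rw [MeasurableSpace.measurableSet_iInf]
    intro k'
    change MeasurableSet ((fun z : ℝ × ℝ => (⟨k', z⟩ : Σ _ : K, ℝ × ℝ)) ⁻¹'
      ((fun z : ℝ × ℝ => (⟨k, z⟩ : Σ _ : K, ℝ × ℝ)) '' s))
    by_cases h : k' = k
    · subst h
      rw [preimage_image_eq _ fun z z' h => by simpa using h]
      exact hs
    · convert MeasurableSet.empty
      ext z
      simp [Ne.symm h]

variable {L} {C : Set K}

theorem lintegral_vol (f : (Σ _ : K, ℝ × ℝ) → ℝ≥0∞) :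
    ∫⁻ x, f x ∂L.vol C = ∑' k : C, ∫⁻ z in L.page k, f ⟨k, z⟩ := by
  rw [vol, lintegral_sum_measure]
  congr 1 with k
  rw [(measurableEmbedding_sigmaMk k.1).lintegral_map]

theorem integral_vol {f : (Σ _ : K, ℝ × ℝ) → ℝ} (hf : Integrable f (L.vol C)) :
    ∫ x, f x ∂L.vol C = ∑' k : C, ∫ z in L.page k, f ⟨k, z⟩ := by
  rw [vol, integral_sum_measure hf]
  congr 1 with k
  rw [(measurableEmbedding_sigmaMk k.1).integral_map]

theorem ae_vol [Countable K] {P : (Σ _ : K, ℝ × ℝ) → Prop} :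
    (∀ᵐ x ∂L.vol C, P x) ↔ ∀ k ∈ C, ∀ᵐ z ∂volume.restrict (L.page k), P ⟨k, z⟩ := by
  rw [vol, Measure.ae_sum_iff]
  constructor
  · intro h k hk
    exact (measurableEmbedding_sigmaMk k).ae_map_iff.1 (h ⟨k, hk⟩)
  · intro h k
    exact (measurableEmbedding_sigmaMk k.1).ae_map_iff.2 (h k k.2)

theorem aestronglyMeasurable_vol [Countable K] {E : Type*} [TopologicalSpace E]
    [TopologicalSpace.PseudoMetrizableSpace E] {f : (Σ _ : K, ℝ × ℝ) → E}
    (h : ∀ k ∈ C, AEStronglyMeasurable (fun z => f ⟨k, z⟩) (volume.restrict (L.page k))) :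
    AEStronglyMeasurable f (L.vol C) := by
  rw [vol, aestronglyMeasurable_sum_measure_iff]
  intro k
  exact (measurableEmbedding_sigmaMk k.1).aestronglyMeasurable_map_iff.2 (h k k.2)

theorem MemL2.memLp_vol [Countable K] {u : K → ℝ × ℝ → ℂ} (hu : L.MemL2 u) (C : Set K) :
    MemLp (fun x : Σ _ : K, ℝ × ℝ => u x.1 x.2) 2 (L.vol C) := by
  rw [memLp_two_iff_lintegral]
  refine ⟨aestronglyMeasurable_vol fun k _ => hu.1 k, ?_⟩
  rw [lintegral_vol]
  exact (ENNReal.tsum_comp_le_tsum_of_injective Subtype.val_injective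
    (fun k => ∫⁻ z in L.page k, ‖u k z‖ₑ ^ 2)).trans_lt hu.2

theorem measurable_height : Measurable fun x : Σ _ : K, ℝ × ℝ => L.height x.1 x.2 :=
  fun s hs => by
    rw [MeasurableSpace.measurableSet_iInf]
    intro k
    exact (L.continuous_height k).measurable hs

/-- Pages outside `C` do not contribute because `b` vanishes there. Integrability over the union
ensures that the sum over the pages is the genuine one and not a default value. -/
theorem scalar_eq_integral [Countable K] {a b : K → ℝ × ℝ → ℂ} (ha : L.MemL2 a) (hb : L.MemL2 b)
    (h0 : ∀ k ∉ C, b k = 0) :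
    Integrable (fun x : Σ _ : K, ℝ × ℝ => inner ℝ (a x.1 x.2) (b x.1 x.2)) (L.vol C) ∧
      L.scalar a b = ∫ x, inner ℝ (a x.1 x.2) (b x.1 x.2) ∂L.vol C := by
  have hi : Integrable (fun x : Σ _ : K, ℝ × ℝ => inner ℝ (a x.1 x.2) (b x.1 x.2)) (L.vol C) := by
    have h1 := ha.memLp_vol C
    have h2 := hb.memLp_vol C
    refine Integrable.mono' (h1.norm.integrable_mul h2.norm) (h1.1.inner h2.1)
      (Eventually.of_forall fun x => ?_)
    exact norm_inner_le_norm _ _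
  refine ⟨hi, ?_⟩
  rw [integral_vol hi, scalar]
  exact (tsum_subtype_eq_of_support_subset
    (f := fun k => ∫ z in L.page k, inner ℝ (a k z) (b k z)) (s := C) fun k hk => by
      by_contra hkC
      exact hk (by simp [h0 k hkC])).symm

/-! ### The energy identity -/

/-- `u`, with weak gradient `(p, q)`, solves the stationary equation with right-hand side `w`. -/
structure IsSolution (L : OpenBook J K) (ω ϖ : ℝ) (u p q w : K → ℝ × ℝ → ℂ) : Prop where
  isH1D : L.IsH1D u p q
  memL2 : L.MemL2 w
  weak : ∀ v p' q', L.IsH1D v p' q' → L.scalar w v = L.scalar p p' + L.scalar q q'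
  eqn : ∀ k, ∀ᵐ z ∂volume.restrict (L.page k),
    w k z = ((‖u k z‖ ^ (ϖ - 1) - ω : ℝ) : ℂ) * u k z

theorem SolvesNLS.exists_isSolution {ω ϖ : ℝ} {u : K → ℝ × ℝ → ℂ} (h : L.SolvesNLS ω ϖ u) :
    ∃ p q w, L.IsSolution ω ϖ u p q w := by
  obtain ⟨w, ⟨hw, p, q, h1, h2⟩, h3⟩ := h
  refine ⟨p, q, w, h1, hw, h2, fun k => ?_⟩
  filter_upwards [h3 k] with z hz
  push_cast at hz ⊢
  linear_combination hz

/-- The density of the energy `∇u · ∇(G (height, |u|) u)`. -/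
noncomputable def energyDensity (L : OpenBook J K) (G : ℝ × ℝ → ℝ) (u p q : K → ℝ × ℝ → ℂ)
    (x : Σ _ : K, ℝ × ℝ) : ℝ :=
  G (L.height x.1 x.2, ‖u x.1 x.2‖) * (‖p x.1 x.2‖ ^ 2 + ‖q x.1 x.2‖ ^ 2) +
    derivSnd G (L.height x.1 x.2) ‖u x.1 x.2‖ / ‖u x.1 x.2‖ *
      (inner ℝ (u x.1 x.2) (p x.1 x.2) ^ 2 + inner ℝ (u x.1 x.2) (q x.1 x.2) ^ 2) +
    derivFst G (L.height x.1 x.2) ‖u x.1 x.2‖ *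
      (L.wt₁ x.1 * inner ℝ (u x.1 x.2) (p x.1 x.2) + L.wt₂ x.1 * inner ℝ (u x.1 x.2) (q x.1 x.2))

/-- The condition on a set of pages and a cut-off under which `cut` preserves `H¹_D`. -/
def Compatible (L : OpenBook J K) (C : Set K) (G : ℝ × ℝ → ℝ) : Prop :=
  (∀ j, L.len j = ∞ → ∀ k s k' s', L.Incident k s j → L.Incident k' s' j → k ∈ C → k' ∈ C) ∧
    (C = univ ∨ ∀ s, G (0, s) = 0)

/-- This is the weak equation tested with `cut`. Almost everywhere `w` is a real multiple of `u`,
which makes the right-hand side radial. -/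
theorem IsSolution.integral_energyDensity [Countable K] {ω ϖ : ℝ} {u p q w : K → ℝ × ℝ → ℂ}
    (h : L.IsSolution ω ϖ u p q w) {G : ℝ × ℝ → ℝ} {B : ℝ} (hG : IsCutoff.Bounded G B)
    (hC : L.Compatible C G) :
    Integrable (L.energyDensity G u p q) (L.vol C) ∧
    Integrable (fun x : Σ _ : K, ℝ × ℝ => G (L.height x.1 x.2, ‖u x.1 x.2‖) *
      ((‖u x.1 x.2‖ ^ (ϖ - 1) - ω) * ‖u x.1 x.2‖ ^ 2)) (L.vol C) ∧
    ∫ x, L.energyDensity G u p q x ∂L.vol C =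
      ∫ x, G (L.height x.1 x.2, ‖u x.1 x.2‖) *
        ((‖u x.1 x.2‖ ^ (ϖ - 1) - ω) * ‖u x.1 x.2‖ ^ 2) ∂L.vol C := by
  obtain ⟨⟨hu, hp, hq, -, -⟩, -⟩ := h.isH1D
  have hv := isH1D_cut hG h.isH1D hC.1 hC.2
  obtain ⟨i1, e1⟩ := scalar_eq_integral (C := C) h.memL2 hv.1.1
    (fun k hk => by rw [cut, indicator_of_notMem hk])
  obtain ⟨i2, e2⟩ := scalar_eq_integral (C := C) hp hv.1.2.1
    (fun k hk => by rw [cutDeriv, indicator_of_notMem hk])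
  obtain ⟨i3, e3⟩ := scalar_eq_integral (C := C) hq hv.1.2.2.1
    (fun k hk => by rw [cutDeriv, indicator_of_notMem hk])
  have a1 : (fun x : Σ _ : K, ℝ × ℝ => inner ℝ (w x.1 x.2) (L.cut C G u x.1 x.2)) =ᵐ[L.vol C]
      fun x => G (L.height x.1 x.2, ‖u x.1 x.2‖) *
        ((‖u x.1 x.2‖ ^ (ϖ - 1) - ω) * ‖u x.1 x.2‖ ^ 2) := by
    refine ae_vol.2 fun k hk => ?_
    filter_upwards [h.eqn k] with z hz
    simp only [cut, indicator_of_mem hk]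
    rw [hz, ← Complex.real_smul, real_inner_smul_left, real_inner_smul_right,
      real_inner_self_eq_norm_sq]
    ring
  have a2 : (fun x : Σ _ : K, ℝ × ℝ => inner ℝ (p x.1 x.2) (L.cutDeriv C G L.wt₁ u p x.1 x.2) +
      inner ℝ (q x.1 x.2) (L.cutDeriv C G L.wt₂ u q x.1 x.2)) =ᵐ[L.vol C]
      L.energyDensity G u p q := by
    refine ae_vol.2 fun k hk => Eventually.of_forall fun z => ?_
    simp only [cutDeriv, indicator_of_mem hk, energyDensity]
    rw [inner_add_right, inner_add_right, real_inner_smul_right, real_inner_smul_right,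
      real_inner_smul_right, real_inner_smul_right, real_inner_self_eq_norm_sq,
      real_inner_self_eq_norm_sq, real_inner_comm (p k z), real_inner_comm (q k z)]
    ring
  refine ⟨(i2.add i3).congr a2, i1.congr a1, ?_⟩
  rw [← integral_congr_ae a2, ← integral_congr_ae a1, integral_add i2 i3, ← e1, ← e2, ← e3]
  exact (h.weak _ _ _ hv).symm

end OpenBook

/-! ### Bounds on vertical lines -/

namespace IsVertPrimitive

variable {E : Type*} [NormedAddCommGroup E] [NormedSpace ℝ E] {U g : ℝ × ℝ → E}

/-- The interval `[0, b]`, read as `[0, ∞)` if `b = ∞`. -/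
def _root_.closedRay (b : ℝ≥0∞) : Set ℝ := {t | 0 ≤ t ∧ ENNReal.ofReal t ≤ b}

theorem _root_.Ioo_subset_ray_of_mem_closedRay {b : ℝ≥0∞} {y y' : ℝ} (hy : y ∈ closedRay b)
    (hy' : y' ∈ closedRay b) : Ioo y y' ⊆ ray b := fun _ ht =>
  ⟨hy.1.trans_lt ht.1, ((ENNReal.ofReal_lt_ofReal_iff
    (hy.1.trans_lt (ht.1.trans ht.2))).2 ht.2).trans_le hy'.2⟩

theorem enorm_sub_le (h : IsVertPrimitive U g) (x : ℝ) {b : ℝ≥0∞} {y y' : ℝ}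
    (hy : y ∈ closedRay b) (hy' : y' ∈ closedRay b) :
    ‖U (x, y') - U (x, y)‖ₑ ≤ ∫⁻ s in ray b, ‖g (x, s)‖ₑ := by
  wlog hle : y ≤ y' generalizing y y'
  · rw [← enorm_neg, neg_sub]
    exact this hy' hy (le_of_not_ge hle)
  rw [h.sub_eq, intervalIntegral.integral_of_le hle, ← restrict_Ioo_eq_restrict_Ioc]
  exact (enorm_integral_le_lintegral_enorm _).trans
    (lintegral_mono_set (Ioo_subset_ray_of_mem_closedRay hy hy'))

/-- The value at `y` differs from any other value on the line by at most the total variation;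
averaging over the values on `(0, d)` produces the factor `d⁻¹`. -/
theorem enorm_le_lintegral (h : IsVertPrimitive U g) (x : ℝ) {b : ℝ≥0∞} {d : ℝ} (hd : 0 < d)
    (hdb : ENNReal.ofReal d ≤ b) {y : ℝ} (hy : y ∈ closedRay b) :
    ‖U (x, y)‖ₑ ≤ ∫⁻ s in ray b, (ENNReal.ofReal d⁻¹ * ‖U (x, s)‖ₑ + ‖g (x, s)‖ₑ) := by
  set T := ∫⁻ s in ray b, ‖g (x, s)‖ₑ with hT
  have hgm : Measurable fun s => ‖g (x, s)‖ₑ :=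
    (h.measg.comp_measurable measurable_prodMk_left).enorm
  have hUm : Measurable fun s => ‖U (x, s)‖ₑ :=
    (h.measU.comp_measurable measurable_prodMk_left).enorm
  have hsub := Ioo_subset_ray hdb
  have h1 : ∀ s ∈ Ioo 0 d, ‖U (x, y)‖ₑ ≤ ‖U (x, s)‖ₑ + T := fun s hs => by
    have hs' : s ∈ closedRay b := ⟨(hsub hs).1.le, (hsub hs).2.le⟩
    calc ‖U (x, y)‖ₑ = ‖U (x, s) + (U (x, y) - U (x, s))‖ₑ := by rw [add_sub_cancel]
      _ ≤ ‖U (x, s)‖ₑ + ‖U (x, y) - U (x, s)‖ₑ := enorm_add_le _ _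
      _ ≤ _ := add_le_add_right (h.enorm_sub_le x hs' hy) _
  have h2 : ENNReal.ofReal d * ‖U (x, y)‖ₑ ≤
      (∫⁻ s in ray b, ‖U (x, s)‖ₑ) + ENNReal.ofReal d * T := by
    calc ENNReal.ofReal d * ‖U (x, y)‖ₑ = ∫⁻ _ in Ioo 0 d, ‖U (x, y)‖ₑ := by
          rw [setLIntegral_const, Real.volume_Ioo, sub_zero, mul_comm]
      _ ≤ ∫⁻ s in Ioo 0 d, (‖U (x, s)‖ₑ + T) := setLIntegral_mono' measurableSet_Ioo h1
      _ = (∫⁻ s in Ioo 0 d, ‖U (x, s)‖ₑ) + ENNReal.ofReal d * T := by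
          rw [lintegral_add_left hUm, setLIntegral_const, Real.volume_Ioo, sub_zero, mul_comm T]
      _ ≤ _ := add_le_add_left (lintegral_mono_set hsub) _
  have hd0 : ENNReal.ofReal d ≠ 0 := by simpa using hd
  have e : ENNReal.ofReal d⁻¹ * ENNReal.ofReal d = 1 := by
    rw [← ENNReal.ofReal_mul (by positivity), inv_mul_cancel₀ hd.ne', ENNReal.ofReal_one]
  rw [lintegral_add_right _ hgm, lintegral_const_mul _ hUm]
  calc ‖U (x, y)‖ₑ = ENNReal.ofReal d⁻¹ * (ENNReal.ofReal d * ‖U (x, y)‖ₑ) := by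
        rw [← mul_assoc, e, one_mul]
    _ ≤ ENNReal.ofReal d⁻¹ * ((∫⁻ s in ray b, ‖U (x, s)‖ₑ) + ENNReal.ofReal d * T) :=
        mul_le_mul_right h2 _
    _ = _ := by rw [mul_add, ← mul_assoc, e, one_mul]

/-- A function of the horizontal variable that is approached in mean square on shrinking intervals
next to the height `y₀` is the value at `y₀` of the vertical primitive. -/
theorem ae_eq_of_tendsto {U g : ℝ × ℝ → ℂ} (h : IsVertPrimitive U g) {a : ℝ≥0∞} {τ : ℝ → ℂ}
    (hτ : AEStronglyMeasurable τ (volume.restrict (ray a))) {y₀ : ℝ} {I : ℝ → Set ℝ}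
    (hIm : ∀ δ, MeasurableSet (I δ))
    (hI : ∀ᶠ δ in 𝓝[>] 0, volume (I δ) = ENNReal.ofReal δ)
    (hI' : ∀ δ, I δ ⊆ Metric.closedBall y₀ δ)
    (ht : Tendsto (fun δ : ℝ => (ENNReal.ofReal δ)⁻¹ *
      ∫⁻ z in ray a ×ˢ I δ, ‖U z - τ z.1‖ₑ ^ 2) (𝓝[>] 0) (𝓝 0)) :
    ∀ᵐ t ∂volume.restrict (ray a), U (t, y₀) = τ t := by
  have hδ : Tendsto (fun n : ℕ => 1 / ((n : ℝ) + 1)) atTop (𝓝[>] 0) :=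
    tendsto_nhdsWithin_iff.2 ⟨tendsto_one_div_add_atTop_nhds_zero_nat,
      Eventually.of_forall fun n => by simp only [mem_Ioi]; positivity⟩
  set δ : ℕ → ℝ := fun n => 1 / ((n : ℝ) + 1) with hδdef
  have hm : ∀ n, AEMeasurable (fun z : ℝ × ℝ => ‖U z - τ z.1‖ₑ ^ 2)
      ((volume.restrict (ray a)).prod (volume.restrict (I (δ n)))) := fun n =>
    ((h.measU.aestronglyMeasurable.sub hτ.comp_fst).enorm.pow_const 2)
  set f : ℕ → ℝ → ℝ≥0∞ := fun n t => (ENNReal.ofReal (δ n))⁻¹ *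
    ∫⁻ y in I (δ n), ‖U (t, y) - τ t‖ₑ ^ 2 with hf
  have hfm : ∀ n, AEMeasurable (f n) (volume.restrict (ray a)) := fun n =>
    (hm n).lintegral_prod_right'.const_mul _
  have hfi : ∀ n, ∫⁻ t in ray a, f n t = (ENNReal.ofReal (δ n))⁻¹ *
      ∫⁻ z in ray a ×ˢ I (δ n), ‖U z - τ z.1‖ₑ ^ 2 := fun n => by
    rw [hf, lintegral_const_mul'' _ (hm n).lintegral_prod_right', ← lintegral_prod _ (hm n),
      Measure.prod_restrict]
    rfl
  have hlim : Tendsto (fun n => ∫⁻ t in ray a, f n t) atTop (𝓝 0) := by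
    simp only [hfi]
    exact ht.comp hδ
  -- Fatou along `δ = 1/(n+1)` makes the lower limit of the means vanish for almost every `t`. Since
  -- `U` is continuous on the line, that lower limit is at least the squared distance at `y₀`.
  have hfatou : ∫⁻ t in ray a, liminf (fun n => f n t) atTop = 0 := by
    refine le_antisymm ((lintegral_liminf_le' hfm).trans ?_) zero_le
    rw [hlim.liminf_eq]
  have hlow : ∀ t, ‖U (t, y₀) - τ t‖ₑ ^ 2 ≤ liminf (fun n => f n t) atTop := by
    intro t
    refine le_of_forall_lt fun c hc => ?_
    obtain ⟨c', hc, hc'⟩ := exists_between hc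
    refine lt_of_lt_of_le hc (le_liminf_of_le (by isBoundedDefault) ?_)
    have hcont : Continuous fun y => ‖U (t, y) - τ t‖ₑ ^ 2 :=
      ((ENNReal.continuous_pow 2).comp ((h.continuous t).sub continuous_const).enorm)
    have hev : ∀ᶠ y in 𝓝 y₀, c' < ‖U (t, y) - τ t‖ₑ ^ 2 :=
      hcont.continuousAt.eventually_const_lt hc'
    obtain ⟨ε, hε, hball⟩ := Metric.eventually_nhds_iff_ball.1 hev
    have hsmall : ∀ᶠ n in atTop, δ n < ε :=
      (tendsto_nhdsWithin_iff.1 hδ).1.eventually_lt_const hε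
    filter_upwards [hsmall, hδ.eventually hI] with n hn hv
    have hδpos : 0 < δ n := by simp only [hδdef]; positivity
    have h0 : ENNReal.ofReal (δ n) ≠ 0 := by simpa using hδpos
    have h1 : ENNReal.ofReal (δ n) * c' ≤ ∫⁻ y in I (δ n), ‖U (t, y) - τ t‖ₑ ^ 2 := by
      calc ENNReal.ofReal (δ n) * c' = ∫⁻ _ in I (δ n), c' := by
            rw [setLIntegral_const, hv, mul_comm]
        _ ≤ _ := setLIntegral_mono' (hIm _) fun y hy =>
            (hball y (Metric.closedBall_subset_ball hn (hI' _ hy))).le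
    calc c' = (ENNReal.ofReal (δ n))⁻¹ * (ENNReal.ofReal (δ n) * c') := by
          rw [← mul_assoc, ENNReal.inv_mul_cancel h0 ENNReal.ofReal_ne_top, one_mul]
      _ ≤ _ := mul_le_mul_right h1 _
  have hzero : ∫⁻ t in ray a, ‖U (t, y₀) - τ t‖ₑ ^ 2 = 0 :=
    le_antisymm ((lintegral_mono hlow).trans hfatou.le) zero_le
  have hmeas : AEMeasurable (fun t => ‖U (t, y₀) - τ t‖ₑ ^ 2) (volume.restrict (ray a)) :=
    ((((h.measU.comp_measurable measurable_prodMk_right).aestronglyMeasurable).sub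
      hτ).enorm.pow_const 2)
  filter_upwards [(lintegral_eq_zero_iff' hmeas).1 hzero] with t ht
  have : ‖U (t, y₀) - τ t‖ₑ = 0 := by simpa using ht
  rwa [enorm_eq_zero, sub_eq_zero] at this

end IsVertPrimitive

/-- A function on a product is bounded in mean square by a bound along horizontal lines and a bound
along vertical lines. -/
theorem lintegral_sq_le_mul {μ ν : Measure ℝ} [SFinite μ] [SFinite ν] {h : ℝ × ℝ → ℝ≥0∞}
    {α β : ℝ → ℝ≥0∞} (hα : AEMeasurable α μ) (hβ : AEMeasurable β ν)
    (h1 : ∀ᵐ z ∂μ.prod ν, h z ≤ α z.1) (h2 : ∀ᵐ z ∂μ.prod ν, h z ≤ β z.2) :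
    ∫⁻ z, h z ^ 2 ∂μ.prod ν ≤ (∫⁻ x, α x ∂μ) * ∫⁻ y, β y ∂ν := by
  rw [← lintegral_prod_mul hα hβ]
  refine lintegral_mono_ae ?_
  filter_upwards [h1, h2] with z hz1 hz2
  rw [pow_two]
  exact mul_le_mul' hz1 hz2

/-! ### Oriented pages -/

/-- The identity or the exchange of the coordinates. -/
def turn (o : Bool) (z : ℝ × ℝ) : ℝ × ℝ := cond o z.swap z

/-- The side at height zero of a page in the given orientation. -/
def lowSide (o : Bool) : Side := cond o Side.west Side.south

/-- The side opposite to `lowSide`. -/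
def highSide (o : Bool) : Side := cond o Side.east Side.north

theorem exists_eq_lowSide_or_highSide (s : Side) : ∃ o, s = lowSide o ∨ s = highSide o := by
  cases s
  · exact ⟨true, Or.inl rfl⟩
  · exact ⟨true, Or.inr rfl⟩
  · exact ⟨false, Or.inl rfl⟩
  · exact ⟨false, Or.inr rfl⟩

namespace OpenBook

variable {J K : Type*} (L : OpenBook J K)

/-- The horizontal length of a page in the given orientation. -/
def lenA (o : Bool) (k : K) : ℝ≥0∞ := cond o (L.len₂ k) (L.len₁ k)

/-- The vertical length of a page in the given orientation. -/
def lenB (o : Bool) (k : K) : ℝ≥0∞ := cond o (L.len₁ k) (L.len₂ k)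

/-- The horizontal derivative of the height in the given orientation. -/
noncomputable def wtA (o : Bool) (k : K) : ℝ := cond o (L.wt₂ k) (L.wt₁ k)

/-- The vertical derivative of the height in the given orientation. -/
noncomputable def wtB (o : Bool) (k : K) : ℝ := cond o (L.wt₁ k) (L.wt₂ k)

theorem lenA_not (o : Bool) (k : K) : L.lenA (!o) k = L.lenB o k := by cases o <;> rfl

theorem lenB_not (o : Bool) (k : K) : L.lenB (!o) k = L.lenA o k := by cases o <;> rfl

theorem lenB_pos (o : Bool) (k : K) : 0 < L.lenB o k := by
  cases o
  · exact L.len₂_pos k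
  · exact L.len₁_pos k

theorem wtA_of_top {o : Bool} {k : K} (h : L.lenA o k = ∞) : L.wtA o k = 1 := by
  cases o
  · exact if_pos h
  · exact if_pos h

theorem wtB_of_ne_top {o : Bool} {k : K} (h : L.lenB o k ≠ ∞) : L.wtB o k = 0 := by
  cases o
  · exact if_neg h
  · exact if_neg h

theorem height_turn (o : Bool) (k : K) (z : ℝ × ℝ) :
    L.height k (turn o z) = L.wtA o k * z.1 + L.wtB o k * z.2 := by
  cases o
  · rfl
  · exact add_comm _ _

theorem present_lowSide (o : Bool) (k : K) : (lowSide o).Present (L.len₁ k) (L.len₂ k) := by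
  cases o <;> trivial

theorem present_highSide (o : Bool) (k : K) :
    (highSide o).Present (L.len₁ k) (L.len₂ k) ↔ L.lenB o k ≠ ∞ := by
  cases o <;> rfl

theorem length_lowSide (o : Bool) (k : K) :
    (lowSide o).length (L.len₁ k) (L.len₂ k) = L.lenA o k := by
  cases o <;> rfl

theorem length_highSide (o : Bool) (k : K) :
    (highSide o).length (L.len₁ k) (L.len₂ k) = L.lenA o k := by
  cases o <;> rfl

theorem along_lowSide (o : Bool) (z : ℝ × ℝ) : (lowSide o).along (turn o z) = z.1 := by
  cases o <;> rfl

theorem along_highSide (o : Bool) (z : ℝ × ℝ) : (highSide o).along (turn o z) = z.1 := by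
  cases o <;> rfl

theorem depth_lowSide (o : Bool) (k : K) (z : ℝ × ℝ) :
    (lowSide o).depth (L.len₁ k) (L.len₂ k) (turn o z) = z.2 := by
  cases o <;> rfl

theorem depth_highSide (o : Bool) (k : K) (z : ℝ × ℝ) :
    (highSide o).depth (L.len₁ k) (L.len₂ k) (turn o z) = (L.lenB o k).toReal - z.2 := by
  cases o <;> rfl

theorem measurableEmbedding_turn (o : Bool) : MeasurableEmbedding (turn o) := by
  cases o
  · exact MeasurableEmbedding.id
  · exact (MeasurableEquiv.prodComm (α := ℝ) (β := ℝ)).measurableEmbedding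

theorem measurePreserving_turn_volume (o : Bool) : MeasurePreserving (turn o) volume volume := by
  cases o
  · exact MeasurePreserving.id _
  · exact Measure.measurePreserving_swap

theorem turn_preimage_page (o : Bool) (k : K) :
    turn o ⁻¹' L.page k = openRect (L.lenA o k) (L.lenB o k) := by
  cases o
  · rfl
  · exact swap_preimage_openRect _ _

theorem measurePreserving_turn (o : Bool) (k : K) :
    MeasurePreserving (turn o) (volume.restrict (openRect (L.lenA o k) (L.lenB o k)))
      (volume.restrict (L.page k)) := by
  rw [← turn_preimage_page]
  exact (measurePreserving_turn_volume o).restrict_preimage (L.measurableSet_page k)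

theorem lintegral_turn (o : Bool) (k : K) (f : ℝ × ℝ → ℝ≥0∞) :
    ∫⁻ z in openRect (L.lenA o k) (L.lenB o k), f (turn o z) = ∫⁻ z in L.page k, f z :=
  (L.measurePreserving_turn o k).lintegral_comp_emb (measurableEmbedding_turn o) f

theorem ae_turn (o : Bool) (k : K) {P : ℝ × ℝ → Prop} :
    (∀ᵐ z ∂volume.restrict (L.page k), P z) ↔
      ∀ᵐ z ∂volume.restrict (openRect (L.lenA o k) (L.lenB o k)), P (turn o z) := by
  rw [← (L.measurePreserving_turn o k).map_eq, (measurableEmbedding_turn o).ae_map_iff]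

variable {L} {u p q : K → ℝ × ℝ → ℂ}

/-- In each orientation, an `H¹` function is on each page almost everywhere a vertical primitive. -/
theorem IsH1.exists_isVertPrimitive (hu : L.IsH1 u p q) (o : Bool) (k : K) :
    ∃ U g, IsVertPrimitive U g ∧
      (∀ᵐ z ∂volume.restrict (openRect (L.lenA o k) (L.lenB o k)), U z = u k (turn o z)) ∧
      ∀ᵐ z ∂volume.restrict (openRect (L.lenA o k) (L.lenB o k)),
        g z = (cond o p q) k (turn o z) := by
  obtain ⟨hu, hp, hq, hup, huq⟩ := hu
  cases o
  · exact _root_.exists_isVertPrimitive (L.len₂_pos k) (hu.memLp k) (hq.memLp k) (huq k)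
  · exact _root_.exists_isVertPrimitive (L.len₁_pos k) (hu.memLp k).swap_openRect
      (hp.memLp k).swap_openRect (WeakDerivOn.swap (hup k))

/-- The trace on the low side is the value at height zero of the vertical primitive. -/
theorem HasTrace.ae_eq_low {o : Bool} {k : K} {τ : ℝ → ℂ} (h : L.HasTrace u k (lowSide o) τ)
    {U g : ℝ × ℝ → ℂ} (hU : IsVertPrimitive U g)
    (hUu : ∀ᵐ z ∂volume.restrict (openRect (L.lenA o k) (L.lenB o k)), U z = u k (turn o z)) :
    ∀ᵐ t ∂volume.restrict (ray (L.lenA o k)), U (t, 0) = τ t := by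
  obtain ⟨h1, h2⟩ := h
  rw [length_lowSide] at h1
  refine hU.ae_eq_of_tendsto h1.1 (I := fun δ => ray (L.lenB o k) ∩ Iio δ)
    (fun δ => (measurableSet_ray _).inter measurableSet_Iio) ?_ ?_ (h2.congr fun δ => ?_)
  · obtain ⟨d, hd, -, hdb⟩ := exists_ofReal_le (L.lenB_pos o k)
    filter_upwards [Ioo_mem_nhdsGT hd] with δ hδ
    have : ray (L.lenB o k) ∩ Iio δ = Ioo 0 δ := by
      ext t
      exact ⟨fun ht => ⟨ht.1.1, ht.2⟩, fun ht =>
        ⟨Ioo_subset_ray hdb ⟨ht.1, ht.2.trans hδ.2⟩, ht.2⟩⟩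
    rw [this, Real.volume_Ioo, sub_zero]
  · intro δ t ht
    have h3 : 0 < t := ht.1.1
    have h4 : t < δ := ht.2
    rw [Metric.mem_closedBall, Real.dist_eq, sub_zero, abs_of_pos h3]
    exact h4.le
  · congr 1
    have hset : turn o ⁻¹' {z ∈ L.page k | (lowSide o).depth (L.len₁ k) (L.len₂ k) z < δ} =
        ray (L.lenA o k) ×ˢ (ray (L.lenB o k) ∩ Iio δ) := by
      have := L.turn_preimage_page o k
      rw [openRect_eq] at this
      ext z
      have h5 : turn o z ∈ L.page k ↔ z ∈ ray (L.lenA o k) ×ˢ ray (L.lenB o k) := by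
        rw [← this]
        rfl
      simp only [mem_preimage, mem_ofPred_eq, h5, depth_lowSide, mem_prod, mem_inter_iff, mem_Iio]
      tauto
    rw [← (measurePreserving_turn_volume o).setLIntegral_comp_preimage_emb
      (measurableEmbedding_turn o), hset]
    refine setLIntegral_congr_fun_ae ((measurableSet_ray _).prod
      ((measurableSet_ray _).inter measurableSet_Iio)) ?_
    rw [ae_restrict_iff' (measurableSet_openRect _ _)] at hUu
    filter_upwards [hUu] with z hz hz'
    rw [along_lowSide, hz]
    rw [openRect_eq]
    exact ⟨hz'.1, hz'.2.1⟩

/-- The trace on the high side is the value at maximal height of the vertical primitive. -/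
theorem HasTrace.ae_eq_high {o : Bool} {k : K} {τ : ℝ → ℂ} (h : L.HasTrace u k (highSide o) τ)
    (hfin : L.lenB o k ≠ ∞) {U g : ℝ × ℝ → ℂ} (hU : IsVertPrimitive U g)
    (hUu : ∀ᵐ z ∂volume.restrict (openRect (L.lenA o k) (L.lenB o k)), U z = u k (turn o z)) :
    ∀ᵐ t ∂volume.restrict (ray (L.lenA o k)), U (t, (L.lenB o k).toReal) = τ t := by
  obtain ⟨h1, h2⟩ := h
  rw [length_highSide] at h1
  have hb0 : 0 < (L.lenB o k).toReal := ENNReal.toReal_pos (L.lenB_pos o k).ne' hfin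
  have hray : ray (L.lenB o k) = Ioo 0 (L.lenB o k).toReal := by
    ext t
    exact and_congr_right fun ht => by rw [ENNReal.ofReal_lt_iff_lt_toReal ht.le hfin]
  refine hU.ae_eq_of_tendsto h1.1 (I := fun δ => ray (L.lenB o k) ∩ Ioi ((L.lenB o k).toReal - δ))
    (fun δ => (measurableSet_ray _).inter measurableSet_Ioi) ?_ ?_ (h2.congr fun δ => ?_)
  · filter_upwards [Ioo_mem_nhdsGT hb0] with δ hδ
    have : ray (L.lenB o k) ∩ Ioi ((L.lenB o k).toReal - δ) =
        Ioo ((L.lenB o k).toReal - δ) (L.lenB o k).toReal := by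
      rw [hray]
      ext t
      exact ⟨fun ht => ⟨ht.2, ht.1.2⟩, fun ht =>
        ⟨⟨lt_trans (by linarith [hδ.2]) ht.1, ht.2⟩, ht.1⟩⟩
    rw [this, Real.volume_Ioo]
    congr 1
    ring
  · intro δ t ht
    rw [hray] at ht
    have h3 : t < (L.lenB o k).toReal := ht.1.2
    have h4 : (L.lenB o k).toReal - δ < t := ht.2
    rw [Metric.mem_closedBall, Real.dist_eq, abs_le]
    exact ⟨by linarith, by linarith⟩
  · congr 1
    have hset : turn o ⁻¹' {z ∈ L.page k | (highSide o).depth (L.len₁ k) (L.len₂ k) z < δ} =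
        ray (L.lenA o k) ×ˢ (ray (L.lenB o k) ∩ Ioi ((L.lenB o k).toReal - δ)) := by
      have := L.turn_preimage_page o k
      rw [openRect_eq] at this
      ext z
      have h5 : turn o z ∈ L.page k ↔ z ∈ ray (L.lenA o k) ×ˢ ray (L.lenB o k) := by
        rw [← this]
        rfl
      simp only [mem_preimage, mem_ofPred_eq, h5, depth_highSide, mem_prod, mem_inter_iff, mem_Ioi,
        sub_lt_comm]
      tauto
    rw [← (measurePreserving_turn_volume o).setLIntegral_comp_preimage_emb
      (measurableEmbedding_turn o), hset]
    refine setLIntegral_congr_fun_ae ((measurableSet_ray _).prod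
      ((measurableSet_ray _).inter measurableSet_Ioi)) ?_
    rw [ae_restrict_iff' (measurableSet_openRect _ _)] at hUu
    filter_upwards [hUu] with z hz hz'
    rw [along_highSide, hz]
    rw [openRect_eq]
    exact ⟨hz'.1, hz'.2.1⟩

end OpenBook

/-! ### The Sobolev inequality -/

/-- The `W^{1,1}`-norm on a vertical line, with the value weighted by `d⁻¹`. -/
noncomputable def vertNorm (d : ℝ) (b : ℝ≥0∞) (V W : ℝ × ℝ → ℝ) (t : ℝ) : ℝ≥0∞ :=
  ∫⁻ s in ray b, (ENNReal.ofReal d⁻¹ * ‖V (t, s)‖ₑ + ‖W (t, s)‖ₑ)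

theorem IsVertPrimitive.measurable_vertNorm {V W : ℝ × ℝ → ℝ} (h : IsVertPrimitive V W) (d : ℝ)
    (b : ℝ≥0∞) : Measurable (vertNorm d b V W) :=
  Measurable.lintegral_prod_right' (f := fun z => ENNReal.ofReal d⁻¹ * ‖V z‖ₑ + ‖W z‖ₑ)
    ((h.measU.enorm.const_mul _).add h.measg.enorm)

theorem IsVertPrimitive.lintegral_vertNorm {V W : ℝ × ℝ → ℝ} (h : IsVertPrimitive V W) (d : ℝ)
    (a b : ℝ≥0∞) : ∫⁻ t in ray a, vertNorm d b V W t =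
      ∫⁻ z in openRect a b, (ENNReal.ofReal d⁻¹ * ‖V z‖ₑ + ‖W z‖ₑ) := by
  rw [restrict_openRect, lintegral_prod]
  · rfl
  · exact ((h.measU.enorm.const_mul _).add h.measg.enorm).aemeasurable

namespace OpenBook

variable {J K : Type*} (L : OpenBook J K)

/-- The function `H (height, |u|)`. -/
noncomputable def radial (H : ℝ × ℝ → ℝ) (u : K → ℝ × ℝ → ℂ) (k : K) (z : ℝ × ℝ) : ℝ :=
  H (L.height k z, ‖u k z‖)

/-- The derivative of `radial` in a direction in which `u` has the derivative `p` and the height has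
the derivative `wt`. -/
noncomputable def radialDeriv (H : ℝ × ℝ → ℝ) (wt : K → ℝ) (u p : K → ℝ × ℝ → ℂ) (k : K)
    (z : ℝ × ℝ) : ℝ :=
  derivFst H (L.height k z) ‖u k z‖ * wt k +
    derivSnd H (L.height k z) ‖u k z‖ * (inner ℝ (u k z) (p k z) / ‖u k z‖)

/-- The density of the `W^{1,1}`-norm of `radial`. -/
noncomputable def radialDensity (H : ℝ × ℝ → ℝ) (u p q : K → ℝ × ℝ → ℂ) (k : K) (z : ℝ × ℝ) :
    ℝ≥0∞ :=
  ‖L.radial H u k z‖ₑ + ‖L.radialDeriv H L.wt₁ u p k z‖ₑ + ‖L.radialDeriv H L.wt₂ u q k z‖ₑ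

/-- The Sobolev inequality for the embedding of `W^{1,1}` into `L²`, on the pages in `C`, with
constant `M`. -/
def SobolevOn (C : Set K) (u p q : K → ℝ × ℝ → ℂ) (M : ℝ≥0∞) : Prop :=
  ∀ H : ℝ × ℝ → ℝ, IsCutoff H → ∫⁻ x, ‖L.radial H u x.1 x.2‖ₑ ^ 2 ∂L.vol C ≤
    M * (∫⁻ x, L.radialDensity H u p q x.1 x.2 ∂L.vol C) ^ 2

/-- The function `H (height, |U|)` in oriented coordinates. -/
noncomputable def turned (H : ℝ × ℝ → ℝ) (o : Bool) (k : K) (U : ℝ × ℝ → ℂ) (z : ℝ × ℝ) : ℝ :=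
  H (L.wtA o k * z.1 + L.wtB o k * z.2, ‖U z‖)

/-- The vertical derivative of `turned`. -/
noncomputable def turnedDeriv (H : ℝ × ℝ → ℝ) (o : Bool) (k : K) (U g : ℝ × ℝ → ℂ) (z : ℝ × ℝ) :
    ℝ :=
  derivFst H (L.wtA o k * z.1 + L.wtB o k * z.2) ‖U z‖ * L.wtB o k +
    derivSnd H (L.wtA o k * z.1 + L.wtB o k * z.2) ‖U z‖ * (inner ℝ (U z) (g z) / ‖U z‖)

theorem isVertPrimitive_turned {H : ℝ × ℝ → ℝ} (hH : IsCutoff H) {U g : ℝ × ℝ → ℂ}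
    (hU : IsVertPrimitive U g) (o : Bool) (k : K) :
    IsVertPrimitive (L.turned H o k U) (L.turnedDeriv H o k U g) := by
  have := hU.comp hH.contDiff_norm (L.wtA o k) (L.wtB o k)
  simp only [hH.fderiv_norm] at this
  exact this

variable {L} {u p q : K → ℝ × ℝ → ℂ}

theorem turned_eq (H : ℝ × ℝ → ℝ) {o : Bool} {k : K} {U : ℝ × ℝ → ℂ} {z : ℝ × ℝ}
    (h : U z = u k (turn o z)) : L.turned H o k U z = L.radial H u k (turn o z) := by
  rw [turned, radial, height_turn, h]

theorem enorm_turnedDeriv_le (H : ℝ × ℝ → ℝ) {o : Bool} {k : K} {U g : ℝ × ℝ → ℂ} {z : ℝ × ℝ}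
    (h : U z = u k (turn o z)) (hg : g z = (cond o p q) k (turn o z)) :
    ‖L.turned H o k U z‖ₑ + ‖L.turnedDeriv H o k U g z‖ₑ ≤ L.radialDensity H u p q k (turn o z) := by
  have e : L.turnedDeriv H o k U g z =
      cond o (L.radialDeriv H L.wt₁ u p k (turn o z)) (L.radialDeriv H L.wt₂ u q k (turn o z)) := by
    cases o <;> rw [turnedDeriv, ← height_turn, h, hg] <;> rfl
  rw [turned_eq H h, e, radialDensity]
  cases o
  · exact add_le_add_left le_self_add _
  · exact le_self_add

theorem lintegral_vertNorm_le {H : ℝ × ℝ → ℝ} (hH : IsCutoff H) {o : Bool} {k : K}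
    {U g : ℝ × ℝ → ℂ} (hU : IsVertPrimitive U g)
    (hUu : ∀ᵐ z ∂volume.restrict (openRect (L.lenA o k) (L.lenB o k)), U z = u k (turn o z))
    (hg : ∀ᵐ z ∂volume.restrict (openRect (L.lenA o k) (L.lenB o k)),
        g z = (cond o p q) k (turn o z)) {d : ℝ} (hd : 0 < d) (hd1 : d ≤ 1) :
    ∫⁻ t in ray (L.lenA o k), vertNorm d (L.lenB o k) (L.turned H o k U) (L.turnedDeriv H o k U g) t
      ≤ ENNReal.ofReal d⁻¹ * ∫⁻ z in L.page k, L.radialDensity H u p q k z := by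
  rw [(L.isVertPrimitive_turned hH hU o k).lintegral_vertNorm, ← L.lintegral_turn o k,
    ← lintegral_const_mul' _ _ ENNReal.ofReal_ne_top]
  refine lintegral_mono_ae ?_
  filter_upwards [hUu, hg] with z h1 h2
  refine le_trans ?_ (mul_le_mul_right (enorm_turnedDeriv_le H h1 h2) _)
  rw [mul_add]
  refine add_le_add_right ?_ _
  have : (1 : ℝ≥0∞) ≤ ENNReal.ofReal d⁻¹ := by
    rw [ENNReal.one_le_ofReal]
    exact (one_le_inv₀ hd).2 hd1
  calc _ = 1 * ‖L.turnedDeriv H o k U g z‖ₑ := (one_mul _).symm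
    _ ≤ _ := mul_le_mul_left this _

theorem turn_turn (o : Bool) (z : ℝ × ℝ) : turn o (turn o z) = z := by
  cases o <;> rfl

theorem turn_not_turn (o : Bool) (z : ℝ × ℝ) : (turn (!o) (turn o z)).1 = z.2 := by
  cases o <;> rfl

theorem exists_vert_bound (hu : L.IsH1 u p q) {H : ℝ × ℝ → ℝ} (hH : IsCutoff H) (o : Bool) (k : K)
    {d : ℝ} (hd : 0 < d) (hd1 : d ≤ 1) (hdb : ENNReal.ofReal d ≤ L.lenB o k) :
    ∃ α : ℝ → ℝ≥0∞, Measurable α ∧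
      (∀ᵐ z ∂volume.restrict (L.page k), ‖L.radial H u k z‖ₑ ≤ α (turn o z).1) ∧
      ∫⁻ t in ray (L.lenA o k), α t ≤
        ENNReal.ofReal d⁻¹ * ∫⁻ z in L.page k, L.radialDensity H u p q k z := by
  obtain ⟨U, g, hU, hUu, hg⟩ := hu.exists_isVertPrimitive o k
  have hV := L.isVertPrimitive_turned hH hU o k
  refine ⟨_, hV.measurable_vertNorm d (L.lenB o k), ?_, lintegral_vertNorm_le hH hU hUu hg hd hd1⟩
  rw [L.ae_turn o k]
  filter_upwards [hUu, ae_restrict_mem (measurableSet_openRect _ _)] with z h1 h2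
  rw [turn_turn, ← turned_eq H h1]
  exact hV.enorm_le_lintegral z.1 hd hdb ⟨h2.2.2.1.le, h2.2.2.2.le⟩

/-- The Gagliardo–Nirenberg argument: one factor of the square is bounded by a function of one
coordinate, the other factor by a function of the other coordinate, and the integral of the product
splits. -/
theorem lintegral_page_radial_sq_le (hu : L.IsH1 u p q) {H : ℝ × ℝ → ℝ} (hH : IsCutoff H) (o : Bool)
    (k : K) {d : ℝ} (hd : 0 < d) (hd1 : d ≤ 1) (hda : ENNReal.ofReal d ≤ L.lenA o k)
    {S : ℝ → ℝ≥0∞} (hS : AEMeasurable S (volume.restrict (ray (L.lenA o k))))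
    (h : ∀ᵐ z ∂volume.restrict (L.page k), ‖L.radial H u k z‖ₑ ≤ S (turn o z).1) :
    ∫⁻ z in L.page k, ‖L.radial H u k z‖ₑ ^ 2 ≤ (∫⁻ t in ray (L.lenA o k), S t) *
      (ENNReal.ofReal d⁻¹ * ∫⁻ z in L.page k, L.radialDensity H u p q k z) := by
  obtain ⟨β, hβm, hβ, hβi⟩ := exists_vert_bound hu hH (!o) k hd hd1
    (by rwa [lenB_not])
  rw [lenA_not] at hβi
  rw [L.ae_turn o k] at h hβ
  rw [← L.lintegral_turn o k, restrict_openRect]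
  rw [restrict_openRect] at h hβ
  refine (lintegral_sq_le_mul hS hβm.aemeasurable ?_ ?_).trans (mul_le_mul_right hβi _)
  · filter_upwards [h] with z hz
    rwa [turn_turn] at hz
  · filter_upwards [hβ] with z hz
    rwa [turn_not_turn] at hz

/-- One of the two line bounds may involve the whole family `C`; the other is local to the page.
Summing the local one over the pages then gives the square of the total norm. -/
theorem sobolevOn_of_le (hu : L.IsH1 u p q) {C : Set K} {d : ℝ} (hd : 0 < d) (hd1 : d ≤ 1)
    (h : ∀ H : ℝ × ℝ → ℝ, IsCutoff H → ∀ k ∈ C, ∃ o, ENNReal.ofReal d ≤ L.lenA o k ∧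
      ∃ S : ℝ → ℝ≥0∞, AEMeasurable S (volume.restrict (ray (L.lenA o k))) ∧
      (∀ᵐ z ∂volume.restrict (L.page k), ‖L.radial H u k z‖ₑ ≤ S (turn o z).1) ∧
      ∫⁻ t in ray (L.lenA o k), S t ≤ 6 * (ENNReal.ofReal d⁻¹ *
        ∫⁻ x, L.radialDensity H u p q x.1 x.2 ∂L.vol C)) :
    L.SobolevOn C u p q (6 * ENNReal.ofReal d⁻¹ ^ 2) := by
  intro H hH
  set N := ∫⁻ x, L.radialDensity H u p q x.1 x.2 ∂L.vol C with hN
  have hpage : ∀ k : C, ∫⁻ z in L.page k, ‖L.radial H u k z‖ₑ ^ 2 ≤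
      6 * (ENNReal.ofReal d⁻¹ * N) *
        (ENNReal.ofReal d⁻¹ * ∫⁻ z in L.page k, L.radialDensity H u p q k z) := by
    intro k
    obtain ⟨o, hda, S, hS, hle, hi⟩ := h H hH k k.2
    exact (lintegral_page_radial_sq_le hu hH o k hd hd1 hda hS hle).trans (mul_le_mul_left hi _)
  rw [lintegral_vol]
  refine (ENNReal.tsum_le_tsum hpage).trans ?_
  rw [ENNReal.tsum_mul_left, ENNReal.tsum_mul_left, ← lintegral_vol
    (fun x => L.radialDensity H u p q x.1 x.2), ← hN]
  refine le_of_eq ?_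
  ring

/-- The Sobolev inequality on pages whose lengths are bounded below. -/
theorem sobolevOn_of_length (hu : L.IsH1 u p q) {C : Set K} {d : ℝ} (hd : 0 < d) (hd1 : d ≤ 1)
    (h : ∀ k ∈ C, ∀ o, ENNReal.ofReal d ≤ L.lenA o k) :
    L.SobolevOn C u p q (6 * ENNReal.ofReal d⁻¹ ^ 2) := by
  refine sobolevOn_of_le hu hd hd1 fun H hH k hk => ⟨false, h k hk false, ?_⟩
  obtain ⟨α, hαm, hα, hαi⟩ := exists_vert_bound hu hH false k hd hd1 (h k hk true)
  refine ⟨α, hαm.aemeasurable, hα, hαi.trans ?_⟩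
  have h1 : ∫⁻ z in L.page k, L.radialDensity H u p q k z ≤
      ∫⁻ x, L.radialDensity H u p q x.1 x.2 ∂L.vol C := by
    rw [lintegral_vol]
    exact ENNReal.le_tsum (f := fun k : C => ∫⁻ z in L.page k, L.radialDensity H u p q k z) ⟨k, hk⟩
  calc _ ≤ ENNReal.ofReal d⁻¹ * ∫⁻ x, L.radialDensity H u p q x.1 x.2 ∂L.vol C :=
        mul_le_mul_right h1 _
    _ = 1 * _ := (one_mul _).symm
    _ ≤ _ := mul_le_mul_left (by norm_num) _

end OpenBook

/-! ### Families of pages connected by infinite bindings -/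

namespace OpenBook

variable {J K : Type*} (L : OpenBook J K)

/-- Two pages with sides on the same infinite binding. -/
def Adj (k k' : K) : Prop :=
  ∃ j, L.len j = ∞ ∧ ∃ s s', L.Incident k s j ∧ L.Incident k' s' j

/-- The pages connected to `k₀` through infinite bindings. -/
def component (k₀ : K) : Set K := {k | Relation.ReflTransGen L.Adj k₀ k}

variable {L}

theorem mem_component_of_incident {k₀ : K} (j : J) (hj : L.len j = ∞) (k : K) (s : Side) (k' : K)
    (s' : Side) (h : L.Incident k s j) (h' : L.Incident k' s' j) (hk : k ∈ L.component k₀) :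
    k' ∈ L.component k₀ :=
  Relation.ReflTransGen.tail hk ⟨j, hj, s, s', h, h'⟩

theorem Incident.exists_lenA {k : K} {s : Side} {j : J} (h : L.Incident k s j)
    (hj : L.len j = ∞) : ∃ o, L.lenA o k = ∞ ∧ (s = lowSide o ∨ s = highSide o) := by
  obtain ⟨o, ho⟩ := exists_eq_lowSide_or_highSide s
  refine ⟨o, ?_, ho⟩
  have h1 := L.len_binding k s h.1
  rw [h.2, hj] at h1
  rcases ho with rfl | rfl
  · rw [h1, length_lowSide]
  · rw [h1, length_highSide]

theorem exists_lenA_of_mem_component {k₀ : K} {o₀ : Bool} (h₀ : L.lenA o₀ k₀ = ∞) {k : K}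
    (hk : k ∈ L.component k₀) : ∃ o, L.lenA o k = ∞ := by
  rcases Relation.ReflTransGen.cases_tail hk with rfl | ⟨k', -, j, hj, -, s', -, h⟩
  · exact ⟨o₀, h₀⟩
  · obtain ⟨o, ho, -⟩ := h.exists_lenA hj
    exact ⟨o, ho⟩

theorem eq_of_lenA {k : K} {o o' : Bool} (h' : L.lenA o' k = ∞)
    (hB : L.lenB o k ≠ ∞) : o' = o := by
  by_contra hne
  have : o' = !o := Bool.eq_not_of_ne hne
  rw [this, lenA_not] at h'
  exact hB h'

/-- The pages of a component together with their infinite orientations. -/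
abbrev InfIndex (L : OpenBook J K) (k₀ : K) : Type _ :=
  {x : Bool × K // x.2 ∈ L.component k₀ ∧ L.lenA x.1 x.2 = ∞}

/-- A function on the bindings is bounded on the infinite bindings of a component if it is bounded on
one page and on all pages without opposite sides, and its increments across pages are summable. -/
theorem ofReal_le_of_mem_component [Countable K] {k₀ : K} {o₀ : Bool} (h₀ : L.lenA o₀ k₀ = ∞) {d : ℝ}
    (hd : ENNReal.ofReal d ≤ L.lenB o₀ k₀) {T : J → ℝ} {S : ℝ≥0∞} (hS : S ≠ ∞)
    {v : L.InfIndex k₀ → ℝ≥0∞}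
    (hanchor : ∀ x : L.InfIndex k₀, ENNReal.ofReal d ≤ L.lenB x.1.1 x.1.2 →
      ∀ s, s = lowSide x.1.1 ∨ s = highSide x.1.1 → s.Present (L.len₁ x.1.2) (L.len₂ x.1.2) →
        ENNReal.ofReal (T (L.binding x.1.2 s)) ≤ S)
    (hosc : ∀ x : L.InfIndex k₀, L.lenB x.1.1 x.1.2 ≠ ∞ →
      ENNReal.ofReal |T (L.binding x.1.2 (highSide x.1.1)) - T (L.binding x.1.2 (lowSide x.1.1))|
        ≤ v x)
    (hv : ∑' x, v x ≤ S) {k : K} (hk : k ∈ L.component k₀) {s : Side} {j : J}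
    (hi : L.Incident k s j) (hj : L.len j = ∞) : ENNReal.ofReal (T j) ≤ 2 * S := by
  classical
  set I : L.InfIndex k₀ → Set ℝ := fun x => if L.lenB x.1.1 x.1.2 ≠ ∞ then
    uIoc (T (L.binding x.1.2 (lowSide x.1.1))) (T (L.binding x.1.2 (highSide x.1.1))) else ∅ with hI
  -- Every value reached along a path of pages stays in this set. A page that is crossed several
  -- times contributes its interval only once, so paths need not be simple.
  set W : Set ℝ := Ioc 0 S.toReal ∪ ⋃ x, I x with hW
  have hA : ∀ x : L.InfIndex k₀, ENNReal.ofReal d ≤ L.lenB x.1.1 x.1.2 →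
      ∀ s, s = lowSide x.1.1 ∨ s = highSide x.1.1 → s.Present (L.len₁ x.1.2) (L.len₂ x.1.2) →
        Ioc 0 (T (L.binding x.1.2 s)) ⊆ W := by
    intro x hx s hs hp t ht
    refine Or.inl ⟨ht.1, ht.2.trans ?_⟩
    exact (ENNReal.ofReal_le_iff_le_toReal hS).1 (hanchor x hx s hs hp)
  have hinv : ∀ k, Relation.ReflTransGen L.Adj k₀ k → ∀ s j, L.Incident k s j → L.len j = ∞ →
      Ioc 0 (T j) ⊆ W := by
    intro k hk
    induction hk with
    | refl =>
      intro s j hi hj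
      obtain ⟨o, ho, hs⟩ := hi.exists_lenA hj
      -- If `k₀` is entered in the orientation other than `o₀`, its width is the infinite length of
      -- `h₀`.
      have hdo : ENNReal.ofReal d ≤ L.lenB o k₀ := by
        by_cases h : o = o₀
        · rwa [h]
        · have : o = !o₀ := Bool.eq_not_of_ne h
          rw [this, lenB_not, h₀]
          exact le_top
      have := hA ⟨(o, k₀), Relation.ReflTransGen.refl, ho⟩ hdo s hs hi.1
      rwa [hi.2] at this
    | @tail k k' hk hadj ih =>
      intro s'' j'' hi'' hj''
      obtain ⟨j, hj, s, s', hi, hi'⟩ := hadj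
      have hinvj := ih s j hi hj
      have hk' : k' ∈ L.component k₀ := Relation.ReflTransGen.tail hk ⟨j, hj, s, s', hi, hi'⟩
      obtain ⟨o, ho, hs''⟩ := hi''.exists_lenA hj''
      by_cases hB : L.lenB o k' = ∞
      · have := hA ⟨(o, k'), hk', ho⟩ (by simp [hB]) s'' hs'' hi''.1
        rwa [hi''.2] at this
      · obtain ⟨o', ho', hs'⟩ := hi'.exists_lenA hj
        -- A page of finite width is infinite in one direction only, so its infinite sides are two
        -- opposite ones. Passing from one to the other changes the value within the interval
        -- attached to the page.
        obtain rfl := eq_of_lenA ho' hB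
        have hsub : uIoc (T (L.binding k' (lowSide o'))) (T (L.binding k' (highSide o'))) ⊆ W := by
          refine fun t ht => Or.inr (mem_iUnion.2 ⟨⟨(o', k'), hk', ho⟩, ?_⟩)
          simp only [hI]
          rw [if_pos hB]
          exact ht
        have hstep : ∀ a b : ℝ, Ioc 0 a ⊆ W → uIoc a b ⊆ W → Ioc 0 b ⊆ W := by
          intro a b h1 h2 t ht
          by_cases hta : t ≤ a
          · exact h1 ⟨ht.1, hta⟩
          · refine h2 ?_
            rw [mem_uIoc]
            exact Or.inl ⟨not_le.1 hta, ht.2⟩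
        rw [← hi'.2] at hinvj
        rw [← hi''.2]
        rcases hs' with rfl | rfl <;> rcases hs'' with rfl | rfl
        · exact hinvj
        · exact hstep _ _ hinvj hsub
        · exact hstep _ _ hinvj (by rwa [uIoc_comm])
        · exact hinvj
  have h1 := hinv k hk s j hi hj
  calc ENNReal.ofReal (T j) = volume (Ioc 0 (T j)) := by rw [Real.volume_Ioc, sub_zero]
    _ ≤ volume W := measure_mono h1
    _ ≤ volume (Ioc 0 S.toReal) + volume (⋃ x, I x) := measure_union_le _ _
    _ ≤ S + ∑' x, v x := by
        refine add_le_add ?_ ?_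
        · rw [Real.volume_Ioc, sub_zero, ENNReal.ofReal_toReal hS]
        · have : ∀ x, volume (I x) ≤ v x := by
            intro x
            simp only [hI]
            split_ifs with h
            · rw [Real.volume_uIoc]
              exact hosc x h
            · simp
          exact (measure_iUnion_le _).trans (ENNReal.tsum_le_tsum this)
    _ ≤ 2 * S := by
        rw [two_mul]
        exact add_le_add_right hv _

/-- A page has at most two infinite orientations. -/
theorem tsum_infIndex_le {k₀ : K} (f : K → ℝ≥0∞) :
    ∑' x : L.InfIndex k₀, f x.1.2 ≤ 2 * ∑' k : L.component k₀, f k := by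
  let φ : L.InfIndex k₀ → Bool × L.component k₀ := fun x => (x.1.1, ⟨x.1.2, x.2.1⟩)
  have hφ : Function.Injective φ := fun x y h => by
    have h1 : x.1.1 = y.1.1 := congrArg (fun z : Bool × L.component k₀ => z.1) h
    have h2 : x.1.2 = y.1.2 := congrArg (fun z : Bool × L.component k₀ => (z.2 : K)) h
    exact Subtype.ext (Prod.ext h1 h2)
  calc _ = ∑' x, (fun z : Bool × L.component k₀ => f z.2) (φ x) := rfl
    _ ≤ ∑' z : Bool × L.component k₀, f z.2 := ENNReal.tsum_comp_le_tsum_of_injective hφ _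
    _ = _ := by
      rw [ENNReal.tsum_prod', tsum_bool, two_mul]

variable {u p q : K → ℝ × ℝ → ℂ}

/-- The Sobolev inequality on a component of infinite pages. -/
theorem sobolevOn_component [Countable K] (hu : L.IsH1D u p q) {k₀ : K} {o₀ : Bool}
    (h₀ : L.lenA o₀ k₀ = ∞) : ∃ M, M ≠ ∞ ∧ L.SobolevOn (L.component k₀) u p q M := by
  -- Only the width of the starting page fixes `d`; the widths of the other pages of the component
  -- may tend to zero.
  obtain ⟨d, hd, hd1, hdB⟩ := exists_ofReal_le (L.lenB_pos o₀ k₀)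
  refine ⟨6 * ENNReal.ofReal d⁻¹ ^ 2, ENNReal.mul_ne_top (by norm_num)
    (ENNReal.pow_ne_top ENNReal.ofReal_ne_top), sobolevOn_of_le hu.1 hd hd1 fun H hH k hk => ?_⟩
  choose U g hU hUu hg using hu.1.exists_isVertPrimitive
  choose τ hτ using hu.2
  -- For almost every `t`, simultaneously for the countably many pages, the values of the primitives
  -- at the sides are the common traces on the bindings.
  have hlow : ∀ᵐ t ∂volume.restrict (ray ∞), ∀ x : L.InfIndex k₀,
      U x.1.1 x.1.2 (t, 0) = τ (L.binding x.1.2 (lowSide x.1.1)) t := by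
    refine ae_all_iff.2 fun x => ?_
    have h1 := (hτ _ x.1.2 (lowSide x.1.1) ⟨L.present_lowSide _ _, rfl⟩).ae_eq_low (hU _ _) (hUu _ _)
    rw [x.2.2] at h1
    filter_upwards [h1] with t ht
    rw [ht, param_of_top (L.present_lowSide _ _) ((L.length_lowSide _ _).trans x.2.2)]
  have hhigh : ∀ᵐ t ∂volume.restrict (ray ∞), ∀ x : L.InfIndex k₀, L.lenB x.1.1 x.1.2 ≠ ∞ →
      U x.1.1 x.1.2 (t, (L.lenB x.1.1 x.1.2).toReal) =
        τ (L.binding x.1.2 (highSide x.1.1)) t := by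
    refine ae_all_iff.2 fun x => ?_
    by_cases hB : L.lenB x.1.1 x.1.2 = ∞
    · exact Eventually.of_forall fun t h => absurd hB h
    have hp := (L.present_highSide x.1.1 x.1.2).2 hB
    have h1 := (hτ _ x.1.2 (highSide x.1.1) ⟨hp, rfl⟩).ae_eq_high hB (hU _ _) (hUu _ _)
    rw [x.2.2] at h1
    filter_upwards [h1] with t ht _
    rw [ht, param_of_top hp ((L.length_highSide _ _).trans x.2.2)]
  set V : L.InfIndex k₀ → ℝ × ℝ → ℝ := fun x => L.turned H x.1.1 x.1.2 (U x.1.1 x.1.2) with hVdef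
  set W : L.InfIndex k₀ → ℝ × ℝ → ℝ := fun x =>
    L.turnedDeriv H x.1.1 x.1.2 (U x.1.1 x.1.2) (g x.1.1 x.1.2) with hWdef
  have hV : ∀ x, IsVertPrimitive (V x) (W x) := fun x => L.isVertPrimitive_turned hH (hU _ _) _ _
  set v : L.InfIndex k₀ → ℝ → ℝ≥0∞ := fun x => vertNorm d (L.lenB x.1.1 x.1.2) (V x) (W x) with hv
  have hvm : ∀ x, Measurable (v x) := fun x => (hV x).measurable_vertNorm _ _
  set S : ℝ → ℝ≥0∞ := fun t => ∑' x, v x t with hS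
  have hSm : Measurable S := Measurable.tsum hvm
  have hsub : ∀ (x : L.InfIndex k₀) t y y', y ∈ closedRay (L.lenB x.1.1 x.1.2) →
      y' ∈ closedRay (L.lenB x.1.1 x.1.2) → ‖V x (t, y') - V x (t, y)‖ₑ ≤ v x t :=
    fun x t y y' hy hy' => ((hV x).enorm_sub_le t hy hy').trans
      (lintegral_mono fun s => le_add_self)
  have hzero : ∀ x : L.InfIndex k₀, (0 : ℝ) ∈ closedRay (L.lenB x.1.1 x.1.2) := fun x =>
    ⟨le_rfl, by simp⟩
  have htop : ∀ x : L.InfIndex k₀, L.lenB x.1.1 x.1.2 ≠ ∞ →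
      (L.lenB x.1.1 x.1.2).toReal ∈ closedRay (L.lenB x.1.1 x.1.2) := fun x hx =>
    ⟨ENNReal.toReal_nonneg, ENNReal.ofReal_toReal_le⟩
  -- At parameter `t`, propagation through the component bounds the value on the low side of any
  -- page by `2 S t`; moving inside the page costs at most another `S t`.
  have hmain : ∀ᵐ t ∂volume.restrict (ray ∞), ∀ x : L.InfIndex k₀,
      ∀ y ∈ closedRay (L.lenB x.1.1 x.1.2), ‖V x (t, y)‖ₑ ≤ 3 * S t := by
    filter_upwards [hlow, hhigh] with t h1 h2 x y hy
    by_cases hSt : S t = ∞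
    · rw [hSt]
      simp
    -- At a side of an infinite orientation the height is exactly `t`, so this modulus depends on
    -- the binding only.
    set T : J → ℝ := fun j => ‖H (t, ‖τ j t‖)‖ with hT
    have h3 : ∀ x : L.InfIndex k₀, ‖V x (t, 0)‖ = T (L.binding x.1.2 (lowSide x.1.1)) := by
      intro x
      simp only [hVdef, hT, turned]
      rw [L.wtA_of_top x.2.2, h1 x, one_mul, mul_zero, add_zero]
    have h4 : ∀ x : L.InfIndex k₀, L.lenB x.1.1 x.1.2 ≠ ∞ →
        ‖V x (t, (L.lenB x.1.1 x.1.2).toReal)‖ = T (L.binding x.1.2 (highSide x.1.1)) := by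
      intro x hx
      simp only [hVdef, hT, turned]
      rw [L.wtA_of_top x.2.2, L.wtB_of_ne_top hx, h2 x hx, one_mul, zero_mul, add_zero]
    have h5 : ENNReal.ofReal (T (L.binding x.1.2 (lowSide x.1.1))) ≤ 2 * S t := by
      refine ofReal_le_of_mem_component h₀ hdB (T := T) hSt (v := fun x => v x t)
        ?_ ?_ le_rfl x.2.1 (s := lowSide x.1.1) ⟨L.present_lowSide _ _, rfl⟩ ?_
      · rintro x hx s (rfl | rfl) hs
        · rw [← h3, ofReal_norm]
          exact ((hV x).enorm_le_lintegral t hd hx (hzero x)).trans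
            (ENNReal.le_tsum (f := fun x => v x t) x)
        · have hB := (L.present_highSide _ _).1 hs
          rw [← h4 x hB, ofReal_norm]
          exact ((hV x).enorm_le_lintegral t hd hx (htop x hB)).trans
            (ENNReal.le_tsum (f := fun x => v x t) x)
      · intro x hB
        rw [← h3, ← h4 x hB]
        refine le_trans ?_ (hsub x t _ _ (hzero x) (htop x hB))
        rw [← ofReal_norm]
        exact ENNReal.ofReal_le_ofReal (abs_norm_sub_norm_le _ _)
      · rw [L.len_binding _ _ (L.present_lowSide _ _), L.length_lowSide, x.2.2]
    rw [← h3, ofReal_norm] at h5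
    calc ‖V x (t, y)‖ₑ = ‖V x (t, 0) + (V x (t, y) - V x (t, 0))‖ₑ := by rw [add_sub_cancel]
      _ ≤ ‖V x (t, 0)‖ₑ + ‖V x (t, y) - V x (t, 0)‖ₑ := enorm_add_le _ _
      _ ≤ 2 * S t + S t := add_le_add h5 ((hsub x t _ _ (hzero x) hy).trans
          (ENNReal.le_tsum (f := fun x => v x t) x))
      _ = 3 * S t := by ring
  obtain ⟨o, ho⟩ := exists_lenA_of_mem_component h₀ hk
  refine ⟨o, by simp [ho], fun t => 3 * S t, (hSm.const_mul _).aemeasurable, ?_, ?_⟩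
  · rw [L.ae_turn o k]
    have h6 : ∀ᵐ z ∂volume.restrict (openRect (L.lenA o k) (L.lenB o k)), ∀ x : L.InfIndex k₀,
      ∀ y ∈ closedRay (L.lenB x.1.1 x.1.2), ‖V x (z.1, y)‖ₑ ≤ 3 * S z.1 := by
      rw [restrict_openRect, ho]
      exact Measure.quasiMeasurePreserving_fst.ae hmain
    filter_upwards [h6, hUu o k, ae_restrict_mem (measurableSet_openRect _ _)] with z h7 h8 h9
    rw [turn_turn, ← turned_eq H h8]
    exact h7 ⟨(o, k), hk, ho⟩ z.2 ⟨h9.2.2.1.le, h9.2.2.2.le⟩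
  · rw [lintegral_const_mul _ hSm, ho, lintegral_tsum fun x => (hvm x).aemeasurable, lintegral_vol]
    have h6 : ∀ x : L.InfIndex k₀, ∫⁻ t in ray ∞, v x t ≤ ENNReal.ofReal d⁻¹ *
        ∫⁻ z in L.page x.1.2, L.radialDensity H u p q x.1.2 z := fun x => by
      have := lintegral_vertNorm_le hH (hU x.1.1 x.1.2) (hUu _ _) (hg _ _) hd hd1
      rwa [x.2.2] at this
    -- The factor `3` is that of `hmain`, the factor `2` counts the orientations of a page. Together
    -- they give the `6` required by `sobolevOn_of_le`.
    calc _ ≤ 3 * (2 * ∑' k : L.component k₀, ENNReal.ofReal d⁻¹ *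
          ∫⁻ z in L.page k, L.radialDensity H u p q k z) :=
          mul_le_mul_right ((ENNReal.tsum_le_tsum h6).trans (tsum_infIndex_le fun k =>
            ENNReal.ofReal d⁻¹ * ∫⁻ z in L.page k, L.radialDensity H u p q k z)) _
      _ = _ := by
          rw [ENNReal.tsum_mul_left, ← mul_assoc]
          norm_num

end OpenBook

/-! ### Smooth steps -/

theorem derivFst_eq {G : ℝ × ℝ → ℝ} (hG : ContDiff ℝ 1 G) {r s d : ℝ}
    (h : HasDerivAt (fun r => G (r, s)) d r) : derivFst G r s = d := by
  refine HasDerivAt.unique ?_ h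
  exact (hG.differentiable one_ne_zero (r, s)).hasFDerivAt.comp_hasDerivAt r
    ((hasDerivAt_id r).prodMk (hasDerivAt_const r s))

theorem derivSnd_eq {G : ℝ × ℝ → ℝ} (hG : ContDiff ℝ 1 G) {r s d : ℝ}
    (h : HasDerivAt (fun s => G (r, s)) d s) : derivSnd G r s = d := by
  refine HasDerivAt.unique ?_ h
  exact (hG.differentiable one_ne_zero (r, s)).hasFDerivAt.comp_hasDerivAt s
    ((hasDerivAt_const s r).prodMk (hasDerivAt_id s))

/-- `χ` increases smoothly from `0` at `a` to `1` at `b`, with slope at most `D`. -/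
structure IsStep (χ : ℝ → ℝ) (a b D : ℝ) : Prop where
  contDiff : ContDiff ℝ 1 χ
  mono : Monotone χ
  zero : ∀ r ≤ a, χ r = 0
  pos : ∀ r, a < r → 0 < χ r
  one : ∀ r, b ≤ r → χ r = 1
  deriv_le : ∀ r, deriv χ r ≤ D

namespace IsStep

variable {χ : ℝ → ℝ} {a b D : ℝ}

theorem nonneg (h : IsStep χ a b D) (r : ℝ) : 0 ≤ χ r := by
  rw [← h.zero _ (min_le_right r a)]
  exact h.mono (min_le_left _ _)

theorem le_one (h : IsStep χ a b D) (r : ℝ) : χ r ≤ 1 := by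
  rw [← h.one _ (le_max_right r b)]
  exact h.mono (le_max_left _ _)

theorem deriv_nonneg (h : IsStep χ a b D) (r : ℝ) : 0 ≤ deriv χ r := h.mono.deriv_nonneg

theorem const_nonneg (h : IsStep χ a b D) : 0 ≤ D := (h.deriv_nonneg 0).trans (h.deriv_le 0)

theorem hasDerivAt (h : IsStep χ a b D) (r : ℝ) : HasDerivAt χ (deriv χ r) r :=
  (h.contDiff.differentiable one_ne_zero r).hasDerivAt

theorem deriv_of_le (h : IsStep χ a b D) {r : ℝ} (hr : r ≤ a) : deriv χ r = 0 :=
  IsLocalMin.deriv_eq_zero (Eventually.of_forall fun x => by rw [h.zero r hr]; exact h.nonneg x)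

theorem deriv_of_ge (h : IsStep χ a b D) {r : ℝ} (hr : b ≤ r) : deriv χ r = 0 :=
  IsLocalMax.deriv_eq_zero (Eventually.of_forall fun x => by rw [h.one r hr]; exact h.le_one x)

end IsStep

/-- All steps are affine rescalings of one smooth transition, so the slope is inversely proportional
to the length of the transition interval. -/
theorem exists_isStep : ∃ D : ℝ, 0 < D ∧ ∀ a b, a < b → ∃ χ, IsStep χ a b (D / (b - a)) := by
  have hc : ContDiff ℝ 1 Real.smoothTransition := Real.smoothTransition.contDiff
  obtain ⟨D, hD⟩ := isCompact_Icc.exists_bound_of_continuousOn (s := Icc (0 : ℝ) 1)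
    (hc.continuous_deriv_one).continuousOn
  have hD' : ∀ r, deriv Real.smoothTransition r ≤ max D 1 := by
    intro r
    by_cases h0 : r ≤ 0
    · rw [IsLocalMin.deriv_eq_zero (Eventually.of_forall fun x => by
        rw [Real.smoothTransition.zero_of_nonpos h0]; exact Real.smoothTransition.nonneg x)]
      positivity
    by_cases h1 : 1 ≤ r
    · rw [IsLocalMax.deriv_eq_zero (Eventually.of_forall fun x => by
        rw [Real.smoothTransition.one_of_one_le h1]; exact Real.smoothTransition.le_one x)]
      positivity
    · exact ((le_abs_self _).trans (hD r ⟨(not_le.1 h0).le, (not_le.1 h1).le⟩)).trans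
        (le_max_left _ _)
  refine ⟨max D 1, by positivity, fun a b hab =>
    ⟨fun r => Real.smoothTransition ((r - a) / (b - a)), ?_, ?_, ?_, ?_, ?_, ?_⟩⟩
  · exact hc.comp (by fun_prop)
  · intro x y hxy
    exact Real.smoothTransition.monotone
      (div_le_div_of_nonneg_right (by linarith) (by linarith))
  · intro r hr
    exact Real.smoothTransition.zero_of_nonpos
      (div_nonpos_of_nonpos_of_nonneg (by linarith) (by linarith))
  · intro r hr
    exact Real.smoothTransition.pos_of_pos (div_pos (by linarith) (by linarith))
  · intro r hr
    refine Real.smoothTransition.one_of_one_le ?_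
    rw [one_le_div (by linarith)]
    linarith
  · intro r
    have h1 := ((hc.differentiable one_ne_zero ((r - a) / (b - a))).hasDerivAt).comp r
      (((hasDerivAt_id r).sub_const a).div_const (b - a))
    rw [show (fun r => Real.smoothTransition ((r - a) / (b - a))) =
      Real.smoothTransition ∘ fun r => (id r - a) / (b - a) from rfl, h1.deriv, mul_one_div]
    exact div_le_div_of_nonneg_right (hD' _) (by linarith)

section

variable {χ κ : ℝ → ℝ} {a b D t t' D' : ℝ}

theorem contDiff_sq_mul_sq (hχ : IsStep χ a b D) (hκ : IsStep κ t t' D') :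
    ContDiff ℝ 1 fun z : ℝ × ℝ => χ z.1 ^ 2 * κ z.2 ^ 2 :=
  ((hχ.contDiff.comp contDiff_fst).pow 2).mul ((hκ.contDiff.comp contDiff_snd).pow 2)

theorem derivFst_sq_mul_sq (hχ : IsStep χ a b D) (hκ : IsStep κ t t' D') (r s : ℝ) :
    derivFst (fun z : ℝ × ℝ => χ z.1 ^ 2 * κ z.2 ^ 2) r s = 2 * χ r * deriv χ r * κ s ^ 2 := by
  refine derivFst_eq (contDiff_sq_mul_sq hχ hκ) ?_
  refine (((hχ.hasDerivAt r).pow 2).mul_const (κ s ^ 2)).congr_deriv ?_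
  simp

theorem derivSnd_sq_mul_sq (hχ : IsStep χ a b D) (hκ : IsStep κ t t' D') (r s : ℝ) :
    derivSnd (fun z : ℝ × ℝ => χ z.1 ^ 2 * κ z.2 ^ 2) r s =
      χ r ^ 2 * (2 * κ s * deriv κ s) := by
  refine derivSnd_eq (contDiff_sq_mul_sq hχ hκ) ?_
  refine (((hκ.hasDerivAt s).pow 2).const_mul (χ r ^ 2)).congr_deriv ?_
  simp

/-- The slope vanishes above `t'`, so only `s < t'` matters. -/
theorem IsStep.deriv_mul_le (hκ : IsStep κ t t' D') {s : ℝ} (ht' : 0 ≤ t') :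
    deriv κ s * s ≤ D' * t' := by
  by_cases h : t' ≤ s
  · rw [hκ.deriv_of_ge h, zero_mul]
    exact mul_nonneg hκ.const_nonneg ht'
  · calc deriv κ s * s ≤ deriv κ s * t' :=
        mul_le_mul_of_nonneg_left (not_le.1 h).le (hκ.deriv_nonneg s)
      _ ≤ D' * t' := mul_le_mul_of_nonneg_right (hκ.deriv_le s) ht'

theorem bounded_sq_mul_sq (hχ : IsStep χ a b D) (hκ : IsStep κ t t' D') (ht : 0 < t)
    (ht' : 0 ≤ t') :
    IsCutoff.Bounded (fun z : ℝ × ℝ => χ z.1 ^ 2 * κ z.2 ^ 2) (1 + 2 * D + 2 * (D' * t')) := by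
  have hD := hχ.const_nonneg
  have hD' := mul_nonneg hκ.const_nonneg ht'
  refine ⟨⟨contDiff_sq_mul_sq hχ hκ, fun _ => t, continuous_const, fun _ => ht, fun r s hs => ?_⟩,
    fun r s _ _ => ?_, fun r s _ _ => ?_, fun r s _ hs => ?_⟩
  · simp [hκ.zero s hs]
  · have h1 : χ r ^ 2 ≤ 1 := pow_le_one₀ (hχ.nonneg r) (hχ.le_one r)
    have h2 : κ s ^ 2 ≤ 1 := pow_le_one₀ (hκ.nonneg s) (hκ.le_one s)
    rw [abs_of_nonneg (by positivity)]
    nlinarith [mul_le_one₀ h1 (by positivity) h2]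
  · rw [derivFst_sq_mul_sq hχ hκ]
    have h1 := hχ.deriv_nonneg r
    have h2 : κ s ^ 2 ≤ 1 := pow_le_one₀ (hκ.nonneg s) (hκ.le_one s)
    have h3 := hχ.nonneg r
    rw [abs_of_nonneg (by positivity)]
    have h4 : χ r * deriv χ r ≤ D := by
      nlinarith [hχ.le_one r, hχ.deriv_le r]
    have h5 : χ r * deriv χ r * κ s ^ 2 ≤ D := by
      nlinarith [mul_nonneg h3 h1]
    nlinarith
  · rw [derivSnd_sq_mul_sq hχ hκ]
    have h0 := hκ.nonneg s
    have h1 := hκ.deriv_nonneg s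
    rw [abs_of_nonneg (by positivity)]
    have h2 : χ r ^ 2 ≤ 1 := pow_le_one₀ (hχ.nonneg r) (hχ.le_one r)
    have h3 := hκ.deriv_mul_le ht' (s := s)
    have h4 : κ s * (deriv κ s * s) ≤ D' * t' := by
      nlinarith [hκ.le_one s, mul_nonneg h1 hs]
    have h5 : χ r ^ 2 * (κ s * (deriv κ s * s)) ≤ D' * t' := by
      nlinarith [mul_nonneg h0 (mul_nonneg h1 hs)]
    nlinarith

/-- The function estimated by the Sobolev inequality. With `κ²` instead of `κ`, its derivative in
`s` keeps a factor `χ κ`, which is the square root of the weight in the energy estimate. -/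
theorem contDiff_mul_sq_mul (hχ : IsStep χ a b D) (hκ : IsStep κ t t' D') :
    ContDiff ℝ 1 fun z : ℝ × ℝ => χ z.1 * (κ z.2 ^ 2 * z.2) :=
  (hχ.contDiff.comp contDiff_fst).mul (((hκ.contDiff.comp contDiff_snd).pow 2).mul contDiff_snd)

theorem derivFst_mul_sq_mul (hχ : IsStep χ a b D) (hκ : IsStep κ t t' D') (r s : ℝ) :
    derivFst (fun z : ℝ × ℝ => χ z.1 * (κ z.2 ^ 2 * z.2)) r s = deriv χ r * (κ s ^ 2 * s) :=
  derivFst_eq (contDiff_mul_sq_mul hχ hκ) ((hχ.hasDerivAt r).mul_const (κ s ^ 2 * s))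

theorem derivSnd_mul_sq_mul (hχ : IsStep χ a b D) (hκ : IsStep κ t t' D') (r s : ℝ) :
    derivSnd (fun z : ℝ × ℝ => χ z.1 * (κ z.2 ^ 2 * z.2)) r s =
      χ r * κ s * (2 * (deriv κ s * s) + κ s) := by
  refine derivSnd_eq (contDiff_mul_sq_mul hχ hκ) ?_
  refine ((((hκ.hasDerivAt s).pow 2).mul (hasDerivAt_id s)).const_mul (χ r)).congr_deriv ?_
  simp
  ring

theorem isCutoff_mul_sq_mul (hχ : IsStep χ a b D) (hκ : IsStep κ t t' D') (ht : 0 < t) :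
    IsCutoff fun z : ℝ × ℝ => χ z.1 * (κ z.2 ^ 2 * z.2) :=
  ⟨contDiff_mul_sq_mul hχ hκ, fun _ => t, continuous_const, fun _ => ht, fun r s hs => by
    simp [hκ.zero s hs]⟩

end

theorem integral_mul_le_sqrt_mul_sqrt {α : Type*} [MeasurableSpace α] {μ : Measure α}
    {f g : α → ℝ} (hf : MemLp f 2 μ) (hg : MemLp g 2 μ) (hf0 : ∀ x, 0 ≤ f x) (hg0 : ∀ x, 0 ≤ g x) :
    ∫ x, f x * g x ∂μ ≤ √(∫ x, f x ^ 2 ∂μ) * √(∫ x, g x ^ 2 ∂μ) := by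
  have h := integral_mul_le_Lp_mul_Lq_of_nonneg Real.HolderConjugate.two_two
    (Eventually.of_forall hf0) (Eventually.of_forall hg0) (by simpa using hf) (by simpa using hg)
  simpa [Real.sqrt_eq_rpow] using h

/-! ### The truncation step -/

namespace OpenBook

variable {J K : Type*} (L : OpenBook J K)

/-- The function `|u|` where it is above `t` and the height is above `R`, and `0` elsewhere. -/
noncomputable def upper (u : K → ℝ × ℝ → ℂ) (R t : ℝ) : (Σ _ : K, ℝ × ℝ) → ℝ :=
  {x : Σ _ : K, ℝ × ℝ | R < L.height x.1 x.2 ∧ t < ‖u x.1 x.2‖}.indicator fun x => ‖u x.1 x.2‖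

/-- The `L²`-norm of `upper`. -/
noncomputable def excess (C : Set K) (u : K → ℝ × ℝ → ℂ) (R t : ℝ) : ℝ :=
  √(∫ x, L.upper u R t x ^ 2 ∂L.vol C)

variable {L} {C : Set K} {u p q w : K → ℝ × ℝ → ℂ} {R R' t t' D D' : ℝ} {χ κ : ℝ → ℝ}

theorem upper_nonneg (x : Σ _ : K, ℝ × ℝ) : 0 ≤ L.upper u R t x :=
  indicator_nonneg (fun _ _ => norm_nonneg _) x

theorem upper_le (x : Σ _ : K, ℝ × ℝ) : L.upper u R t x ≤ ‖u x.1 x.2‖ :=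
  indicator_le_self' (fun _ _ => norm_nonneg _) x

theorem excess_nonneg : 0 ≤ L.excess C u R t := Real.sqrt_nonneg _

theorem excess_sq : L.excess C u R t ^ 2 = ∫ x, L.upper u R t x ^ 2 ∂L.vol C :=
  Real.sq_sqrt (integral_nonneg fun _ => sq_nonneg _)

theorem nullMeasurableSet_level [Countable K] (hu : L.MemL2 u) (C : Set K) (R t : ℝ) :
    NullMeasurableSet {x : Σ _ : K, ℝ × ℝ | R < L.height x.1 x.2 ∧ t < ‖u x.1 x.2‖} (L.vol C) :=
  (measurableSet_lt measurable_const measurable_height).nullMeasurableSet.inter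
    (nullMeasurableSet_lt aemeasurable_const (hu.memLp_vol C).1.norm.aemeasurable)

theorem memLp_upper [Countable K] (hu : L.MemL2 u) (C : Set K) (R t : ℝ) :
    MemLp (L.upper u R t) 2 (L.vol C) :=
  (hu.memLp_vol C).norm.of_le ((hu.memLp_vol C).1.norm.indicator₀ (nullMeasurableSet_level hu C R t))
    (Eventually.of_forall fun x => by
      rw [Real.norm_of_nonneg (upper_nonneg x), norm_norm]
      exact upper_le x)

/-- A product of two steps vanishes unless its arguments are above both thresholds. -/
theorem mul_eq_zero_or_upper_eq (hχ : IsStep χ R R' D) (hκ : IsStep κ t t' D')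
    (x : Σ _ : K, ℝ × ℝ) : χ (L.height x.1 x.2) = 0 ∧ deriv χ (L.height x.1 x.2) = 0 ∨
      κ ‖u x.1 x.2‖ = 0 ∨ L.upper u R t x = ‖u x.1 x.2‖ := by
  by_cases h1 : R < L.height x.1 x.2
  · by_cases h2 : t < ‖u x.1 x.2‖
    · exact Or.inr (Or.inr (indicator_of_mem (s := {x : Σ _ : K, ℝ × ℝ | R < L.height x.1 x.2 ∧
        t < ‖u x.1 x.2‖}) ⟨h1, h2⟩ _))
    · exact Or.inr (Or.inl (hκ.zero _ (not_lt.1 h2)))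
  · exact Or.inl ⟨hχ.zero _ (not_lt.1 h1), hχ.deriv_of_le (not_lt.1 h1)⟩

/-- The term with the derivative of `κ` is nonnegative and is dropped. The term with the derivative
of `χ` is split by Young's inequality; half of the gradient term absorbs it, at the cost of `4 D²
|u|²` above the thresholds. -/
theorem half_le_energyDensity (hχ : IsStep χ R R' D) (hκ : IsStep κ t t' D')
    (x : Σ _ : K, ℝ × ℝ) :
    (χ (L.height x.1 x.2) * κ ‖u x.1 x.2‖) ^ 2 * (‖p x.1 x.2‖ ^ 2 + ‖q x.1 x.2‖ ^ 2) / 2 ≤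
      L.energyDensity (fun z : ℝ × ℝ => χ z.1 ^ 2 * κ z.2 ^ 2) u p q x +
        4 * D ^ 2 * L.upper u R t x ^ 2 := by
  rw [energyDensity, derivFst_sq_mul_sq hχ hκ, derivSnd_sq_mul_sq hχ hκ]
  have hcase := mul_eq_zero_or_upper_eq (L := L) (u := u) hχ hκ x
  have hp := abs_real_inner_le_norm (u x.1 x.2) (p x.1 x.2)
  have hq := abs_real_inner_le_norm (u x.1 x.2) (q x.1 x.2)
  have hw₁ := L.wt₁_nonneg x.1
  have hw₁' := L.wt₁_le_one x.1
  have hw₂ := L.wt₂_nonneg x.1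
  have hw₂' := L.wt₂_le_one x.1
  generalize hr : L.height x.1 x.2 = r at *
  generalize hs : u x.1 x.2 = ξ at *
  generalize p x.1 x.2 = η at *
  generalize q x.1 x.2 = ζ at *
  generalize hi : inner ℝ ξ η = i at *
  generalize hj : inner ℝ ξ ζ = j at *
  have hsnd : 0 ≤ χ r ^ 2 * (2 * κ ‖ξ‖ * deriv κ ‖ξ‖) / ‖ξ‖ * (i ^ 2 + j ^ 2) := by
    have := hκ.nonneg ‖ξ‖
    have := hκ.deriv_nonneg ‖ξ‖
    positivity
  have hU : 0 ≤ D ^ 2 * L.upper u R t x ^ 2 := by positivity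
  rcases hcase with ⟨h1, h2⟩ | h1 | h1
  · rw [h1] at hsnd ⊢
    simp only [zero_mul, mul_zero, ne_eq, OfNat.ofNat_ne_zero, not_false_eq_true, zero_pow,
      zero_div, zero_add] at hsnd ⊢
    linarith
  · rw [h1] at hsnd ⊢
    simp only [zero_mul, mul_zero, ne_eq, OfNat.ofNat_ne_zero, not_false_eq_true, zero_pow,
      zero_div, zero_add] at hsnd ⊢
    linarith
  · rw [h1]
    set S := ‖ξ‖ with hS
    have hS0 : 0 ≤ S := norm_nonneg _
    have hP0 : 0 ≤ ‖η‖ := norm_nonneg _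
    have hQ0 : 0 ≤ ‖ζ‖ := norm_nonneg _
    have hc0 := hχ.nonneg r
    have hd0 := hχ.deriv_nonneg r
    have hd1 := hχ.deriv_le r
    have hk0 := hκ.nonneg S
    have hk1 : κ S ^ 2 ≤ 1 := pow_le_one₀ hk0 (hκ.le_one S)
    have ha : -(S * ‖η‖) ≤ L.wt₁ x.1 * i := by
      have := mul_nonneg hS0 hP0
      nlinarith [(abs_le.1 hp).1]
    have hb : -(S * ‖ζ‖) ≤ L.wt₂ x.1 * j := by
      have := mul_nonneg hS0 hQ0
      nlinarith [(abs_le.1 hq).1]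
    have hfst : -(2 * χ r * deriv χ r * κ S ^ 2 * (S * ‖η‖ + S * ‖ζ‖)) ≤
        2 * χ r * deriv χ r * κ S ^ 2 * (L.wt₁ x.1 * i + L.wt₂ x.1 * j) := by
      rw [← mul_neg]
      exact mul_le_mul_of_nonneg_left (by linarith) (by positivity)
    have hy : 2 * χ r * deriv χ r * (S * ‖η‖ + S * ‖ζ‖) ≤
        χ r ^ 2 * (‖η‖ ^ 2 + ‖ζ‖ ^ 2) / 2 + 4 * (deriv χ r * S) ^ 2 := by
      nlinarith [sq_nonneg (χ r * ‖η‖ - 2 * (deriv χ r * S)),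
        sq_nonneg (χ r * ‖ζ‖ - 2 * (deriv χ r * S))]
    have hz : (deriv χ r * S) ^ 2 ≤ D ^ 2 * S ^ 2 := by
      rw [← mul_pow]
      exact pow_le_pow_left₀ (by positivity) (mul_le_mul_of_nonneg_right hd1 hS0) 2
    have hz' : κ S ^ 2 * (deriv χ r * S) ^ 2 ≤ D ^ 2 * S ^ 2 := by
      nlinarith [sq_nonneg (deriv χ r * S)]
    have hy' := mul_le_mul_of_nonneg_left hy (sq_nonneg (κ S))
    rw [mul_pow]
    linarith

theorem abs_radialDeriv_le (hχ : IsStep χ R R' D) (hκ : IsStep κ t t' D') (ht' : 0 ≤ t')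
    {wt : K → ℝ} (hwt : ∀ k, 0 ≤ wt k) (hwt' : ∀ k, wt k ≤ 1) (x : Σ _ : K, ℝ × ℝ) :
    |L.radialDeriv (fun z : ℝ × ℝ => χ z.1 * (κ z.2 ^ 2 * z.2)) wt u p x.1 x.2| ≤
      D * L.upper u R t x + (2 * (D' * t') + 1) *
        (χ (L.height x.1 x.2) * κ ‖u x.1 x.2‖ * ‖p x.1 x.2‖) := by
  rw [radialDeriv, derivFst_mul_sq_mul hχ hκ, derivSnd_mul_sq_mul hχ hκ]
  have hcase := mul_eq_zero_or_upper_eq (L := L) (u := u) hχ hκ x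
  have hU : 0 ≤ L.upper u R t x := upper_nonneg x
  have hw := hwt x.1
  have hw' := hwt' x.1
  have hin : |inner ℝ (u x.1 x.2) (p x.1 x.2) / ‖u x.1 x.2‖| ≤ ‖p x.1 x.2‖ := by
    rw [abs_div, abs_norm]
    refine div_le_of_le_mul₀ (norm_nonneg _) (norm_nonneg _) ?_
    rw [mul_comm]
    exact abs_real_inner_le_norm _ _
  generalize L.height x.1 x.2 = r at *
  generalize inner ℝ (u x.1 x.2) (p x.1 x.2) / ‖u x.1 x.2‖ = i at *
  have hS0 : 0 ≤ ‖u x.1 x.2‖ := norm_nonneg _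
  generalize ‖u x.1 x.2‖ = S at *
  have hD := hχ.const_nonneg
  have hDt : 0 ≤ D' * t' := mul_nonneg hκ.const_nonneg ht'
  have hc0 := hχ.nonneg r
  have hd0 := hχ.deriv_nonneg r
  have hd1 := hχ.deriv_le r
  have hk0 := hκ.nonneg S
  have hk1 := hκ.le_one S
  have hkd := hκ.deriv_mul_le ht' (s := S)
  have hkd0 := mul_nonneg (hκ.deriv_nonneg S) hS0
  refine (abs_add_le _ _).trans (add_le_add ?_ ?_)
  · rw [abs_of_nonneg (by positivity)]
    have h1 : deriv χ r * (κ S ^ 2 * S) * wt x.1 ≤ deriv χ r * (κ S ^ 2 * S) :=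
      mul_le_of_le_one_right (by positivity) hw'
    refine h1.trans ?_
    rcases hcase with ⟨h1, h2⟩ | h1 | h1
    · rw [h2, zero_mul]
      positivity
    · rw [h1]
      simp only [ne_eq, OfNat.ofNat_ne_zero, not_false_eq_true, zero_pow, zero_mul, mul_zero]
      positivity
    · rw [h1]
      have h2 : κ S ^ 2 * S ≤ S := mul_le_of_le_one_left hS0 (pow_le_one₀ hk0 hk1)
      exact mul_le_mul hd1 h2 (by positivity) hD
  · rw [abs_mul, abs_of_nonneg (by positivity)]
    calc χ r * κ S * (2 * (deriv κ S * S) + κ S) * |i|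
        ≤ χ r * κ S * (2 * (D' * t') + 1) * ‖p x.1 x.2‖ := by gcongr
      _ = _ := by ring

theorem radialDensity_le (hχ : IsStep χ R R' D) (hκ : IsStep κ t t' D') (ht' : 0 ≤ t')
    (x : Σ _ : K, ℝ × ℝ) :
    L.radialDensity (fun z : ℝ × ℝ => χ z.1 * (κ z.2 ^ 2 * z.2)) u p q x.1 x.2 ≤
      ENNReal.ofReal ((1 + 2 * D) * L.upper u R t x + (2 * (D' * t') + 1) *
        (χ (L.height x.1 x.2) * κ ‖u x.1 x.2‖ * (‖p x.1 x.2‖ + ‖q x.1 x.2‖))) := by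
  have h1 := abs_radialDeriv_le (L := L) (u := u) (p := p) hχ hκ ht' L.wt₁_nonneg L.wt₁_le_one x
  have h2 := abs_radialDeriv_le (L := L) (u := u) (p := q) hχ hκ ht' L.wt₂_nonneg L.wt₂_le_one x
  have h3 : |L.radial (fun z : ℝ × ℝ => χ z.1 * (κ z.2 ^ 2 * z.2)) u x.1 x.2| ≤
      L.upper u R t x := by
    have hS0 : 0 ≤ ‖u x.1 x.2‖ := norm_nonneg _
    have hc0 := hχ.nonneg (L.height x.1 x.2)
    have hk0 := hκ.nonneg ‖u x.1 x.2‖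
    rw [radial, abs_of_nonneg (by positivity)]
    rcases mul_eq_zero_or_upper_eq (L := L) (u := u) hχ hκ x with ⟨h1, -⟩ | h1 | h1
    · rw [h1, zero_mul]
      exact upper_nonneg x
    · rw [h1]
      simpa using upper_nonneg x
    · rw [h1]
      have h2 : κ ‖u x.1 x.2‖ ^ 2 * ‖u x.1 x.2‖ ≤ ‖u x.1 x.2‖ :=
        mul_le_of_le_one_left hS0 (pow_le_one₀ hk0 (hκ.le_one _))
      exact (mul_le_of_le_one_left (by positivity) (hχ.le_one _)).trans h2
  rw [radialDensity, ← ofReal_norm, ← ofReal_norm, ← ofReal_norm,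
    ← ENNReal.ofReal_add (norm_nonneg _) (norm_nonneg _),
    ← ENNReal.ofReal_add (by positivity) (norm_nonneg _)]
  refine ENNReal.ofReal_le_ofReal ?_
  simp only [Real.norm_eq_abs]
  linarith

theorem memLp_step_mul [Countable K] (hu : L.MemL2 u) {g : (Σ _ : K, ℝ × ℝ) → ℝ}
    (hg : MemLp g 2 (L.vol C)) (hχ : IsStep χ R R' D) (hκ : IsStep κ t t' D') :
    MemLp (fun x : Σ _ : K, ℝ × ℝ => χ (L.height x.1 x.2) * κ ‖u x.1 x.2‖ * g x) 2 (L.vol C) := by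
  refine hg.norm.of_le ?_ (Eventually.of_forall fun x => ?_)
  · have h1 : AEStronglyMeasurable (fun x : Σ _ : K, ℝ × ℝ => χ (L.height x.1 x.2)) (L.vol C) :=
      hχ.contDiff.continuous.comp_aestronglyMeasurable
        measurable_height.stronglyMeasurable.aestronglyMeasurable
    have h2 : AEStronglyMeasurable (fun x : Σ _ : K, ℝ × ℝ => κ ‖u x.1 x.2‖) (L.vol C) :=
      hκ.contDiff.continuous.comp_aestronglyMeasurable (hu.memLp_vol C).1.norm
    exact (h1.mul h2).mul hg.1
  · rw [norm_mul, norm_norm, Real.norm_of_nonneg (mul_nonneg (hχ.nonneg _) (hκ.nonneg _))]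
    exact mul_le_of_le_one_left (norm_nonneg _)
      (mul_le_one₀ (hχ.le_one _) (hκ.nonneg _) (hκ.le_one _))

/-- A Caccioppoli estimate. The right-hand side of the energy identity is at most the integral of
`|w| |u|` above the thresholds, and Cauchy–Schwarz leaves it linear in the excess. -/
theorem IsSolution.integral_step_le [Countable K] {ω ϖ : ℝ} (h : L.IsSolution ω ϖ u p q w)
    (hχ : IsStep χ R R' D) (hκ : IsStep κ t t' D') (ht : 0 < t) (ht' : 0 ≤ t')
    (hC : L.Compatible C fun z : ℝ × ℝ => χ z.1 ^ 2 * κ z.2 ^ 2) :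
    ∫ x, (χ (L.height x.1 x.2) * κ ‖u x.1 x.2‖) ^ 2 * (‖p x.1 x.2‖ ^ 2 + ‖q x.1 x.2‖ ^ 2) ∂L.vol C ≤
      2 * (√(∫ x, ‖w x.1 x.2‖ ^ 2 ∂L.vol C) * L.excess C u R t +
        4 * D ^ 2 * L.excess C u R t ^ 2) := by
  obtain ⟨hu, hp, hq, -, -⟩ := h.isH1D.1
  obtain ⟨i1, i2, he⟩ := h.integral_energyDensity (bounded_sq_mul_sq hχ hκ ht ht') hC
  have hU := memLp_upper hu C R t
  have hw := (h.memL2.memLp_vol C).norm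
  have i3 : Integrable (fun x => 4 * D ^ 2 * L.upper u R t x ^ 2) (L.vol C) :=
    hU.integrable_sq.const_mul _
  have i4 : Integrable (fun x : Σ _ : K, ℝ × ℝ => (χ (L.height x.1 x.2) * κ ‖u x.1 x.2‖) ^ 2 *
      (‖p x.1 x.2‖ ^ 2 + ‖q x.1 x.2‖ ^ 2)) (L.vol C) := by
    refine ((memLp_step_mul hu (hp.memLp_vol C).norm hχ hκ).integrable_sq.add
      (memLp_step_mul hu (hq.memLp_vol C).norm hχ hκ).integrable_sq).congr
      (Eventually.of_forall fun x => ?_)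
    simp only [Pi.add_apply]
    ring
  have h1 := integral_mono (i4.div_const 2) (i1.add i3)
    (half_le_energyDensity (L := L) (u := u) (p := p) (q := q) hχ hκ)
  simp only [Pi.add_apply] at h1
  rw [integral_div, integral_add i1 i3, integral_const_mul, ← excess_sq, he] at h1
  have i5 : Integrable (fun x => L.upper u R t x * ‖w x.1 x.2‖) (L.vol C) := hU.integrable_mul hw
  have h2 : ∫ x, χ (L.height x.1 x.2) ^ 2 * κ ‖u x.1 x.2‖ ^ 2 *
      ((‖u x.1 x.2‖ ^ (ϖ - 1) - ω) * ‖u x.1 x.2‖ ^ 2) ∂L.vol C ≤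
      ∫ x, L.upper u R t x * ‖w x.1 x.2‖ ∂L.vol C := by
    refine integral_mono_ae i2 i5 (ae_vol.2 fun k _ => ?_)
    filter_upwards [h.eqn k] with z hz
    have hwz : ‖w k z‖ = |‖u k z‖ ^ (ϖ - 1) - ω| * ‖u k z‖ := by
      rw [hz, norm_mul, Complex.norm_real, Real.norm_eq_abs]
    rw [hwz]
    have hX := le_abs_self (‖u k z‖ ^ (ϖ - 1) - ω)
    have hc0 := hχ.nonneg (L.height k z)
    have hk0 := hκ.nonneg ‖u k z‖
    have hG : χ (L.height k z) ^ 2 * κ ‖u k z‖ ^ 2 ≤ 1 :=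
      mul_le_one₀ (pow_le_one₀ hc0 (hχ.le_one _)) (by positivity) (pow_le_one₀ hk0 (hκ.le_one _))
    have hpos : 0 ≤ L.upper u R t ⟨k, z⟩ * (|‖u k z‖ ^ (ϖ - 1) - ω| * ‖u k z‖) :=
      mul_nonneg (upper_nonneg _) (by positivity)
    rcases mul_eq_zero_or_upper_eq (L := L) (u := u) hχ hκ ⟨k, z⟩ with ⟨h1, -⟩ | h1 | h1
    · simp only at h1
      rw [h1]
      simpa using hpos
    · simp only at h1
      rw [h1]
      simpa using hpos
    · rw [h1]
      calc _ ≤ χ (L.height k z) ^ 2 * κ ‖u k z‖ ^ 2 *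
            (|‖u k z‖ ^ (ϖ - 1) - ω| * ‖u k z‖ ^ 2) := by gcongr
        _ ≤ 1 * (|‖u k z‖ ^ (ϖ - 1) - ω| * ‖u k z‖ ^ 2) := by gcongr
        _ = _ := by simp only; ring
  have h3 := integral_mul_le_sqrt_mul_sqrt hU hw upper_nonneg (fun x => norm_nonneg _)
  have h4 : √(∫ x, L.upper u R t x ^ 2 ∂L.vol C) = L.excess C u R t := rfl
  rw [h4] at h3
  linarith

theorem upper_sq_le (hχ : IsStep χ R R' D) (hκ : IsStep κ t t' D') (x : Σ _ : K, ℝ × ℝ) :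
    L.upper u R' t' x ^ 2 ≤ ‖L.radial (fun z : ℝ × ℝ => χ z.1 * (κ z.2 ^ 2 * z.2)) u x.1 x.2‖ ^ 2 := by
  by_cases h : R' < L.height x.1 x.2 ∧ t' < ‖u x.1 x.2‖
  · have h1 : L.upper u R' t' x = ‖u x.1 x.2‖ := indicator_of_mem (s := {x : Σ _ : K, ℝ × ℝ |
      R' < L.height x.1 x.2 ∧ t' < ‖u x.1 x.2‖}) h _
    rw [h1, radial, hχ.one _ h.1.le, hκ.one _ h.2.le]
    simp
  · have h1 : L.upper u R' t' x = 0 := indicator_of_notMem (s := {x : Σ _ : K, ℝ × ℝ |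
      R' < L.height x.1 x.2 ∧ t' < ‖u x.1 x.2‖}) h _
    rw [h1, zero_pow two_ne_zero]
    positivity

/-- The bound is cubic in a small excess: the Sobolev norm is an `L¹` norm on the set above the
thresholds, so Cauchy–Schwarz yields the measure of this set, quadratic in the excess by Chebyshev,
times an energy that is linear in it. -/
theorem IsSolution.excess_sq_le [Countable K] {ω ϖ : ℝ} (h : L.IsSolution ω ϖ u p q w)
    {M : ℝ≥0∞} (hM : M ≠ ∞) (hS : L.SobolevOn C u p q M)
    (hχ : IsStep χ R R' D) (hκ : IsStep κ t t' D') (ht : 0 < t) (ht' : 0 ≤ t')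
    (hC : L.Compatible C fun z : ℝ × ℝ => χ z.1 ^ 2 * κ z.2 ^ 2) :
    L.excess C u R' t' ^ 2 ≤ M.toReal * (L.excess C u R t / t) ^ 2 *
      (2 * (1 + 2 * D) ^ 2 * L.excess C u R t ^ 2 + 8 * (2 * (D' * t') + 1) ^ 2 *
        (√(∫ x, ‖w x.1 x.2‖ ^ 2 ∂L.vol C) * L.excess C u R t +
          4 * D ^ 2 * L.excess C u R t ^ 2)) := by
  obtain ⟨hu, hp, hq, -, -⟩ := h.isH1D.1
  have hE := h.integral_step_le hχ hκ ht ht' hC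
  set y := L.excess C u R t with hy
  set V := √(∫ x, ‖w x.1 x.2‖ ^ 2 ∂L.vol C)
  have hy0 : 0 ≤ y := excess_nonneg
  have hD := hχ.const_nonneg
  have hDt : 0 ≤ D' * t' := mul_nonneg hκ.const_nonneg ht'
  have hU := memLp_upper hu C R t
  set e : (Σ _ : K, ℝ × ℝ) → ℝ :=
    {x : Σ _ : K, ℝ × ℝ | R < L.height x.1 x.2 ∧ t < ‖u x.1 x.2‖}.indicator 1 with he
  have he0 : ∀ x, 0 ≤ e x := fun x => indicator_nonneg (fun _ _ => zero_le_one) x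
  have hec : ∀ x, (e x = 1 ∧ t < ‖u x.1 x.2‖ ∧ L.upper u R t x = ‖u x.1 x.2‖) ∨
      (e x = 0 ∧ L.upper u R t x = 0 ∧ χ (L.height x.1 x.2) * κ ‖u x.1 x.2‖ = 0) := by
    intro x
    by_cases hx : x ∈ {x : Σ _ : K, ℝ × ℝ | R < L.height x.1 x.2 ∧ t < ‖u x.1 x.2‖}
    · exact Or.inl ⟨indicator_of_mem hx _, hx.2, indicator_of_mem hx _⟩
    · refine Or.inr ⟨indicator_of_notMem hx _, indicator_of_notMem hx _, ?_⟩
      rw [mem_ofPred_eq, not_and_or, not_lt, not_lt] at hx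
      rcases hx with hx | hx
      · rw [hχ.zero _ hx, zero_mul]
      · rw [hκ.zero _ hx, mul_zero]
  have heU : ∀ x, e x ≤ (1 / t) * L.upper u R t x := by
    intro x
    rcases hec x with ⟨h1, h2, h3⟩ | ⟨h1, h2, -⟩
    · rw [h1, h3, one_div, ← div_eq_inv_mul, one_le_div ht]
      exact h2.le
    · rw [h1, h2, mul_zero]
  have heL : MemLp e 2 (L.vol C) := by
    refine (hU.const_mul (1 / t)).of_le (aestronglyMeasurable_one.indicator₀
      (nullMeasurableSet_level hu C R t)) (Eventually.of_forall fun x => ?_)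
    rw [Real.norm_of_nonneg (he0 x)]
    exact (heU x).trans (le_abs_self _)
  -- Chebyshev: on the set where `e = 1` the modulus exceeds `t`.
  have hesq : √(∫ x, e x ^ 2 ∂L.vol C) ≤ y / t := by
    refine Real.sqrt_le_iff.2 ⟨by positivity, ?_⟩
    rw [div_pow, hy, excess_sq, ← integral_div]
    refine integral_mono heL.integrable_sq (hU.integrable_sq.div_const _) fun x => ?_
    simp only
    rw [← div_pow]
    refine pow_le_pow_left₀ (he0 x) ((heU x).trans_eq ?_) 2
    ring
  set g : (Σ _ : K, ℝ × ℝ) → ℝ := fun x => (1 + 2 * D) * L.upper u R t x + (2 * (D' * t') + 1) *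
    (χ (L.height x.1 x.2) * κ ‖u x.1 x.2‖ * (‖p x.1 x.2‖ + ‖q x.1 x.2‖)) with hg
  have hg0 : ∀ x, 0 ≤ g x := fun x => by
    have := upper_nonneg (L := L) (u := u) (R := R) (t := t) x
    have := hχ.nonneg (L.height x.1 x.2)
    have := hκ.nonneg ‖u x.1 x.2‖
    positivity
  have hpq := memLp_step_mul hu ((hp.memLp_vol C).norm.add (hq.memLp_vol C).norm) hχ hκ
  have hgL : MemLp g 2 (L.vol C) := (hU.const_mul _).add (hpq.const_mul _)
  -- The majorant lives on the set above the thresholds, so inserting the indicator `e` costs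
  -- nothing and prepares Cauchy–Schwarz.
  have hge : ∀ x, g x = g x * e x := by
    intro x
    rcases hec x with ⟨h1, -, -⟩ | ⟨h1, h2, h3⟩
    · rw [h1, mul_one]
    · simp only [hg]
      rw [h1, h2, h3]
      simp
  have hgsq : ∫ x, g x ^ 2 ∂L.vol C ≤ 2 * (1 + 2 * D) ^ 2 * y ^ 2 +
      8 * (2 * (D' * t') + 1) ^ 2 * (V * y + 4 * D ^ 2 * y ^ 2) := by
    have i4 : Integrable (fun x : Σ _ : K, ℝ × ℝ => (χ (L.height x.1 x.2) * κ ‖u x.1 x.2‖) ^ 2 *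
        (‖p x.1 x.2‖ ^ 2 + ‖q x.1 x.2‖ ^ 2)) (L.vol C) := by
      refine ((memLp_step_mul hu (hp.memLp_vol C).norm hχ hκ).integrable_sq.add
        (memLp_step_mul hu (hq.memLp_vol C).norm hχ hκ).integrable_sq).congr
        (Eventually.of_forall fun x => ?_)
      simp only [Pi.add_apply]
      ring
    have h1 : ∫ x, g x ^ 2 ∂L.vol C ≤ ∫ x, (2 * (1 + 2 * D) ^ 2 * L.upper u R t x ^ 2 +
        4 * (2 * (D' * t') + 1) ^ 2 * ((χ (L.height x.1 x.2) * κ ‖u x.1 x.2‖) ^ 2 *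
        (‖p x.1 x.2‖ ^ 2 + ‖q x.1 x.2‖ ^ 2))) ∂L.vol C := by
      refine integral_mono hgL.integrable_sq ((hU.integrable_sq.const_mul _).add
        (i4.const_mul _)) fun x => ?_
      simp only [hg]
      generalize χ (L.height x.1 x.2) * κ ‖u x.1 x.2‖ = c
      generalize ‖p x.1 x.2‖ = P
      generalize ‖q x.1 x.2‖ = Q
      generalize 2 * (D' * t') + 1 = B
      generalize 1 + 2 * D = A
      have h2 : (A * L.upper u R t x + B * (c * (P + Q))) ^ 2 ≤
          2 * (A * L.upper u R t x) ^ 2 + 2 * (B * (c * (P + Q))) ^ 2 := by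
        nlinarith [sq_nonneg (A * L.upper u R t x - B * (c * (P + Q)))]
      have h3 : (B * (c * (P + Q))) ^ 2 ≤ 2 * (B ^ 2 * (c ^ 2 * (P ^ 2 + Q ^ 2))) := by
        nlinarith [sq_nonneg (B * c * (P - Q))]
      nlinarith
    rw [integral_add (hU.integrable_sq.const_mul _) (i4.const_mul _), integral_const_mul,
      integral_const_mul, ← excess_sq] at h1
    have := mul_le_mul_of_nonneg_left hE (show 0 ≤ 4 * (2 * (D' * t') + 1) ^ 2 by positivity)
    linarith
  have hgi : Integrable g (L.vol C) := (hgL.integrable_mul heL).congr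
    (Eventually.of_forall fun x => (hge x).symm)
  have hgint : ∫ x, g x ∂L.vol C ≤ √(∫ x, g x ^ 2 ∂L.vol C) * (y / t) := by
    calc ∫ x, g x ∂L.vol C = ∫ x, g x * e x ∂L.vol C := integral_congr_ae
          (Eventually.of_forall hge)
      _ ≤ √(∫ x, g x ^ 2 ∂L.vol C) * √(∫ x, e x ^ 2 ∂L.vol C) :=
          integral_mul_le_sqrt_mul_sqrt hgL heL hg0 he0
      _ ≤ _ := mul_le_mul_of_nonneg_left hesq (Real.sqrt_nonneg _)
  have hgint0 : 0 ≤ ∫ x, g x ∂L.vol C := integral_nonneg hg0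
  have hsob := hS _ (isCutoff_mul_sq_mul hχ hκ ht)
  have hden : ∫⁻ x, L.radialDensity (fun z : ℝ × ℝ => χ z.1 * (κ z.2 ^ 2 * z.2)) u p q x.1 x.2
      ∂L.vol C ≤ ENNReal.ofReal (∫ x, g x ∂L.vol C) := by
    rw [ofReal_integral_eq_lintegral_ofReal hgi (Eventually.of_forall hg0)]
    exact lintegral_mono fun x => radialDensity_le hχ hκ ht' x
  have hup : ENNReal.ofReal (L.excess C u R' t' ^ 2) ≤
      ENNReal.ofReal (M.toReal * (∫ x, g x ∂L.vol C) ^ 2) := by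
    rw [excess_sq, ofReal_integral_eq_lintegral_ofReal (memLp_upper hu C R' t').integrable_sq
      (Eventually.of_forall fun _ => sq_nonneg _), ENNReal.ofReal_mul ENNReal.toReal_nonneg,
      ENNReal.ofReal_toReal hM, ENNReal.ofReal_pow hgint0]
    refine (lintegral_mono fun x => ?_).trans (hsob.trans ?_)
    · rw [enorm_sq_eq_ofReal]
      exact ENNReal.ofReal_le_ofReal (upper_sq_le hχ hκ x)
    · gcongr
  have hup' := (ENNReal.ofReal_le_ofReal_iff (by positivity)).1 hup
  refine hup'.trans ?_
  rw [mul_assoc]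
  refine mul_le_mul_of_nonneg_left ?_ ENNReal.toReal_nonneg
  calc (∫ x, g x ∂L.vol C) ^ 2 ≤ (√(∫ x, g x ^ 2 ∂L.vol C) * (y / t)) ^ 2 :=
        pow_le_pow_left₀ hgint0 hgint 2
    _ = (y / t) ^ 2 * ∫ x, g x ^ 2 ∂L.vol C := by
        rw [mul_pow, Real.sq_sqrt (integral_nonneg fun _ => sq_nonneg _), mul_comm]
    _ ≤ _ := mul_le_mul_of_nonneg_left hgsq (by positivity)

end OpenBook

/-! ### Pointwise bounds by iterated truncation -/

namespace OpenBook

variable {J K : Type*} {L : OpenBook J K} {C : Set K} {u p q w : K → ℝ × ℝ → ℂ} {R R' t t' : ℝ}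

theorem upper_of_mem {x : Σ _ : K, ℝ × ℝ} (h1 : R < L.height x.1 x.2) (h2 : t < ‖u x.1 x.2‖) :
    L.upper u R t x = ‖u x.1 x.2‖ :=
  indicator_of_mem (s := {x : Σ _ : K, ℝ × ℝ | R < L.height x.1 x.2 ∧ t < ‖u x.1 x.2‖}) ⟨h1, h2⟩ _

theorem upper_anti (hR : R ≤ R') (ht : t ≤ t') (x : Σ _ : K, ℝ × ℝ) :
    L.upper u R' t' x ≤ L.upper u R t x := by
  refine indicator_le_indicator_of_subset (fun x hx => ?_) (fun _ => norm_nonneg _) x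
  exact ⟨hR.trans_lt hx.1, ht.trans_lt hx.2⟩

theorem excess_anti [Countable K] (hu : L.MemL2 u) (hR : R ≤ R') (ht : t ≤ t') :
    L.excess C u R' t' ≤ L.excess C u R t :=
  Real.sqrt_le_sqrt (integral_mono (memLp_upper hu C R' t').integrable_sq
    (memLp_upper hu C R t).integrable_sq fun x =>
      pow_le_pow_left₀ (upper_nonneg x) (upper_anti hR ht x) 2)

theorem ae_le_of_excess_eq_zero [Countable K] (hu : L.MemL2 u) (ht : 0 ≤ t)
    (h : L.excess C u R t = 0) :
    ∀ᵐ x ∂L.vol C, R < L.height x.1 x.2 → ‖u x.1 x.2‖ ≤ t := by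
  have h1 : ∫ x, L.upper u R t x ^ 2 ∂L.vol C = 0 := by rw [← excess_sq, h, zero_pow two_ne_zero]
  rw [integral_eq_zero_iff_of_nonneg (fun _ => sq_nonneg _)
    (memLp_upper hu C R t).integrable_sq] at h1
  filter_upwards [h1] with x hx hR
  by_contra hlt
  rw [not_le] at hlt
  simp only [Pi.zero_apply, ne_eq, OfNat.ofNat_ne_zero, not_false_eq_true, pow_eq_zero_iff,
    upper_of_mem hR hlt] at hx
  linarith

/-- Dominated convergence with majorant `|u|²`. It covers both a level and a height that tend to
infinity. -/
theorem tendsto_excess [Countable K] (hu : L.MemL2 u) {ι : Type*} {l : Filter ι}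
    [l.IsCountablyGenerated] {R t : ι → ℝ}
    (h : ∀ x : Σ _ : K, ℝ × ℝ, ∀ᶠ i in l, L.height x.1 x.2 ≤ R i ∨ ‖u x.1 x.2‖ ≤ t i) :
    Tendsto (fun i => L.excess C u (R i) (t i)) l (𝓝 0) := by
  have h1 : Tendsto (fun i => ∫ x, L.upper u (R i) (t i) x ^ 2 ∂L.vol C) l
      (𝓝 (∫ _, (0 : ℝ) ∂L.vol C)) := by
    refine tendsto_integral_filter_of_dominated_convergence (fun x => ‖u x.1 x.2‖ ^ 2)
      (Eventually.of_forall fun i => (memLp_upper hu C _ _).integrable_sq.1)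
      (Eventually.of_forall fun i => Eventually.of_forall fun x => ?_)
      (hu.memLp_vol C).norm.integrable_sq (Eventually.of_forall fun x => ?_)
    · rw [Real.norm_of_nonneg (sq_nonneg _)]
      exact pow_le_pow_left₀ (upper_nonneg x) (upper_le x) 2
    · refine tendsto_const_nhds.congr' ?_
      filter_upwards [h x] with i hi
      have : L.upper u (R i) (t i) x = 0 := by
        refine indicator_of_notMem ?_ _
        rw [mem_ofPred_eq, not_and_or, not_lt, not_lt]
        exact hi
      rw [this, zero_pow two_ne_zero]
  simpa [excess] using h1.sqrt

/-- The cubic power beats the factor `16 ^ n`: inductively `y n ≤ y 0 / 16 ^ n`, and the constant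
`256 = 16 ^ 2` is the square of the ratio gained in each step. -/
theorem tendsto_zero_of_sq_le {y : ℕ → ℝ} (hy : ∀ n, 0 ≤ y n) {a : ℝ} (ha : 0 ≤ a)
    (h : ∀ n, y n ≤ 1 → y (n + 1) ^ 2 ≤ a * 16 ^ n * y n ^ 3) (h1 : y 0 ≤ 1)
    (h2 : 256 * (a * y 0) ≤ 1) : Tendsto y atTop (𝓝 0) := by
  have hle : ∀ n, y n ≤ y 0 * (1 / 16) ^ n := by
    intro n
    induction n with
    | zero => simp
    | succ n ih =>
      have hb : (0 : ℝ) ≤ (1 / 16) ^ n := by positivity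
      have hb1 : ((1 : ℝ) / 16) ^ n ≤ 1 := pow_le_one₀ (by norm_num) (by norm_num)
      have hy1 : y n ≤ 1 := ih.trans (mul_le_one₀ h1 hb hb1)
      refine abs_le_of_sq_le_sq' ?_ (mul_nonneg (hy 0) (by positivity)) |>.2
      have h16 : (16 : ℝ) ^ n * (1 / 16) ^ n = 1 := by rw [← mul_pow]; norm_num
      calc y (n + 1) ^ 2 ≤ a * 16 ^ n * y n ^ 3 := h n hy1
        _ ≤ a * 16 ^ n * (y 0 * (1 / 16) ^ n) ^ 3 := by
            have := pow_le_pow_left₀ (hy n) ih 3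
            gcongr
        _ = (a * y 0) * (16 ^ n * (1 / 16) ^ n) * (y 0 * (1 / 16) ^ n) ^ 2 := by ring
        _ = (a * y 0) * (y 0 * (1 / 16) ^ n) ^ 2 := by rw [h16, mul_one]
        _ ≤ 1 / 256 * (y 0 * (1 / 16) ^ n) ^ 2 := by
            gcongr
            linarith
        _ = (y 0 * (1 / 16) ^ (n + 1)) ^ 2 := by ring
  refine squeeze_zero hy hle ?_
  simpa using (tendsto_pow_atTop_nhds_zero_of_lt_one (r := (1 : ℝ) / 16) (by norm_num)
    (by norm_num)).const_mul (y 0)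

/-- Here `Q = 2 ^ n` measures the growth of the slopes of the two steps. They enter with total power
four, which produces the factor `16 ^ n` of the iteration. -/
theorem iteration_const_le {D V y Q d d' : ℝ} (hD : 0 ≤ D) (hV : 0 ≤ V) (hy : 0 ≤ y) (hy1 : y ≤ 1)
    (hQ : 1 ≤ Q) (hd : 0 ≤ d) (hdQ : d ≤ 2 * D * Q) (hd' : 0 ≤ d') (hdQ' : d' ≤ 4 * D * Q) :
    2 * (1 + 2 * d) ^ 2 * y ^ 2 + 8 * (2 * d' + 1) ^ 2 * (V * y + 4 * d ^ 2 * y ^ 2) ≤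
      (2 * (1 + 4 * D) ^ 2 + 8 * (8 * D + 1) ^ 2 * (V + 16 * D ^ 2)) * Q ^ 4 * y := by
  have h1 : (1 + 2 * d) ^ 2 ≤ ((1 + 4 * D) * Q) ^ 2 := by
    refine pow_le_pow_left₀ (by positivity) ?_ 2
    nlinarith
  have h2 : (2 * d' + 1) ^ 2 ≤ ((8 * D + 1) * Q) ^ 2 := by
    refine pow_le_pow_left₀ (by positivity) ?_ 2
    nlinarith
  have hQ2 : 1 ≤ Q ^ 2 := one_le_pow₀ hQ
  have hyy : y ^ 2 ≤ y := by nlinarith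
  have h3 : V * y + 4 * d ^ 2 * y ^ 2 ≤ (V + 16 * D ^ 2) * Q ^ 2 * y := by
    have h4 : d ^ 2 ≤ (2 * D * Q) ^ 2 := pow_le_pow_left₀ hd hdQ 2
    have h5 : d ^ 2 * y ^ 2 ≤ (2 * D * Q) ^ 2 * y := mul_le_mul h4 hyy (by positivity) (by positivity)
    have h6 : V * y ≤ V * y * Q ^ 2 := le_mul_of_one_le_right (by positivity) hQ2
    nlinarith
  have h4 : (1 + 2 * d) ^ 2 * y ^ 2 ≤ (1 + 4 * D) ^ 2 * Q ^ 4 * y := by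
    calc (1 + 2 * d) ^ 2 * y ^ 2 ≤ ((1 + 4 * D) * Q) ^ 2 * y :=
          mul_le_mul h1 hyy (by positivity) (by positivity)
      _ = (1 + 4 * D) ^ 2 * Q ^ 2 * y * 1 := by ring
      _ ≤ (1 + 4 * D) ^ 2 * Q ^ 2 * y * Q ^ 2 := by gcongr
      _ = _ := by ring
  have h5 : (2 * d' + 1) ^ 2 * (V * y + 4 * d ^ 2 * y ^ 2) ≤
      ((8 * D + 1) * Q) ^ 2 * ((V + 16 * D ^ 2) * Q ^ 2 * y) :=
    mul_le_mul h2 h3 (by positivity) (by positivity)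
  calc _ = 2 * ((1 + 2 * d) ^ 2 * y ^ 2) +
        8 * ((2 * d' + 1) ^ 2 * (V * y + 4 * d ^ 2 * y ^ 2)) := by ring
    _ ≤ 2 * ((1 + 4 * D) ^ 2 * Q ^ 4 * y) +
        8 * (((8 * D + 1) * Q) ^ 2 * ((V + 16 * D ^ 2) * Q ^ 2 * y)) := by gcongr
    _ = _ := by ring

/-- If a solution has small `L²`-norm where it is above `t / 2`, then it is below `t`. -/
theorem IsSolution.exists_forall_ae_le [Countable K] {ω ϖ : ℝ} (h : L.IsSolution ω ϖ u p q w)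
    {M : ℝ≥0∞} (hM : M ≠ ∞) (hS : L.SobolevOn C u p q M)
    (hC : ∀ j, L.len j = ∞ → ∀ k s k' s', L.Incident k s j → L.Incident k' s' j → k ∈ C → k' ∈ C) :
    ∃ A : ℝ, 0 ≤ A ∧ ∀ R t, 0 < t → (C = univ ∨ 0 ≤ R) → L.excess C u R (t / 2) ≤ 1 →
      A * L.excess C u R (t / 2) ≤ t ^ 2 →
      ∀ᵐ x ∂L.vol C, R + 1 < L.height x.1 x.2 → ‖u x.1 x.2‖ ≤ t := by
  obtain ⟨D, hD, hstep⟩ := exists_isStep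
  have hu := h.isH1D.1.1
  set V := √(∫ x, ‖w x.1 x.2‖ ^ 2 ∂L.vol C) with hV
  have hV0 : 0 ≤ V := Real.sqrt_nonneg _
  set B := 2 * (1 + 4 * D) ^ 2 + 8 * (8 * D + 1) ^ 2 * (V + 16 * D ^ 2) with hB
  have hB0 : 0 ≤ B := by positivity
  have hM0 : 0 ≤ M.toReal := ENNReal.toReal_nonneg
  -- The factor is `256 * 4`: the smallness constant of the iteration times the `4` from replacing
  -- each level by its lower bound `t / 2`.
  refine ⟨1024 * (M.toReal * B), by positivity, fun R t ht hR h1 h2 => ?_⟩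
  -- Heights increase from `R` to `R + 1` and levels from `t / 2` to `t`; the gaps halve in each
  -- step, so the slopes double.
  set ρ : ℕ → ℝ := fun n => R + 1 - (1 / 2) ^ n with hρ
  set τ : ℕ → ℝ := fun n => t * (1 - (1 / 2) ^ (n + 1)) with hτ
  have hpow : ∀ n : ℕ, (0 : ℝ) < (1 / 2) ^ n ∧ ((1 : ℝ) / 2) ^ n ≤ 1 := fun n =>
    ⟨by positivity, pow_le_one₀ (by norm_num) (by norm_num)⟩
  have hτ1 : ∀ n, τ n ≤ t := fun n => mul_le_of_le_one_right ht.le (by linarith [(hpow (n + 1)).1])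
  have hτ2 : ∀ n, t / 2 ≤ τ n := fun n => by
    simp only [hτ, pow_succ]
    nlinarith [(hpow n).2]
  have hρ0 : ρ 0 = R := by simp [hρ]
  have hτ0 : τ 0 = t / 2 := by simp only [hτ]; norm_num; ring
  set y : ℕ → ℝ := fun n => L.excess C u (ρ n) (τ n) with hy
  have hy0 : y 0 = L.excess C u R (t / 2) := by simp only [hy, hρ0, hτ0]
  have hlim : Tendsto y atTop (𝓝 0) := by
    refine tendsto_zero_of_sq_le (fun n => excess_nonneg) (a := M.toReal * (4 / t ^ 2) * B)
      (by positivity) (fun n hn => ?_) (hy0 ▸ h1) ?_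
    · have hρn : ρ (n + 1) - ρ n = (1 / 2) ^ (n + 1) := by simp only [hρ, pow_succ]; ring
      have hτn : τ (n + 1) - τ n = t * (1 / 2) ^ (n + 2) := by simp only [hτ, pow_succ]; ring
      have h2n : (2 : ℝ) ^ n * (1 / 2) ^ n = 1 := by rw [← mul_pow]; norm_num
      obtain ⟨χ, hχ⟩ := hstep (ρ n) (ρ (n + 1))
        (by rw [← sub_pos, hρn]; exact (hpow _).1)
      obtain ⟨κ, hκ⟩ := hstep (τ n) (τ (n + 1))
        (by rw [← sub_pos, hτn]; exact mul_pos ht (hpow _).1)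
      rw [hρn] at hχ
      rw [hτn] at hκ
      have hτn0 : 0 < τ n := lt_of_lt_of_le (by linarith) (hτ2 n)
      have hτn1 : 0 ≤ τ (n + 1) := le_trans (by linarith) (hτ2 (n + 1))
      have hcomp : L.Compatible C fun z : ℝ × ℝ => χ z.1 ^ 2 * κ z.2 ^ 2 := by
        refine ⟨hC, hR.imp_right fun hR s => ?_⟩
        -- Unless all pages are used, the cut-off has to vanish at height zero; this is why `R` is
        -- nonnegative then.
        have : χ 0 = 0 := hχ.zero 0 (by simp only [hρ]; linarith [(hpow n).2])
        simp [this]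
      have hmain := h.excess_sq_le hM hS hχ hκ hτn0 hτn1 hcomp
      have e1 : D / (1 / 2) ^ (n + 1) = 2 * D * 2 ^ n := by
        rw [div_eq_iff (by positivity), pow_succ]
        linear_combination (-D) * h2n
      have e2 : D / (t * (1 / 2) ^ (n + 2)) * τ (n + 1) ≤ 4 * D * 2 ^ n := by
        calc _ ≤ D / (t * (1 / 2) ^ (n + 2)) * t :=
              mul_le_mul_of_nonneg_left (hτ1 _) (by positivity)
          _ = 4 * D * 2 ^ n := by
              rw [div_mul_eq_mul_div, div_eq_iff (by positivity), pow_add]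
              linear_combination (-D * t) * h2n
      have hyn : 0 ≤ y n := excess_nonneg
      have hc := iteration_const_le hD.le hV0 hyn hn (one_le_pow₀ (n := n) one_le_two)
        (d := D / (1 / 2) ^ (n + 1)) (by positivity) e1.le
        (d' := D / (t * (1 / 2) ^ (n + 2)) * τ (n + 1)) (by positivity) e2
      rw [← hB] at hc
      have h16 : ((2 : ℝ) ^ n) ^ 4 = 16 ^ n := by rw [← pow_mul, mul_comm, pow_mul]; norm_num
      rw [h16] at hc
      have hdiv : (y n / τ n) ^ 2 ≤ 4 / t ^ 2 * y n ^ 2 := by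
        have h3 : y n / τ n ≤ y n / (t / 2) := div_le_div_of_nonneg_left hyn (by positivity) (hτ2 n)
        exact (pow_le_pow_left₀ (by positivity) h3 2).trans_eq (by ring)
      calc y (n + 1) ^ 2 ≤ _ := hmain
        _ ≤ M.toReal * (4 / t ^ 2 * y n ^ 2) * (B * 16 ^ n * y n) :=
            mul_le_mul (mul_le_mul_of_nonneg_left hdiv hM0) hc (by positivity) (by positivity)
        _ = _ := by ring
    · rw [hy0]
      have : 256 * (M.toReal * (4 / t ^ 2) * B * L.excess C u R (t / 2)) =
          1024 * (M.toReal * B) * L.excess C u R (t / 2) / t ^ 2 := by ring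
      rw [this]
      exact (div_le_one (by positivity)).2 h2
  refine ae_le_of_excess_eq_zero hu ht.le (le_antisymm ?_ excess_nonneg)
  refine ge_of_tendsto' hlim fun n => excess_anti hu ?_ (hτ1 n)
  simp only [hρ]
  linarith [(hpow n).1]

end OpenBook

/-! ### Boundedness of solutions and uniform decay along a component -/

namespace OpenBook

variable {J K : Type*} {L : OpenBook J K} {C : Set K} {u p q w : K → ℝ × ℝ → ℂ} {ω ϖ : ℝ}

theorem exists_ofReal_le_lenA (h : 0 < L.minLength) :
    ∃ d : ℝ, 0 < d ∧ d ≤ 1 ∧ ∀ k o, ENNReal.ofReal d ≤ L.lenA o k := by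
  have h0 : 0 < ⨅ j, L.len j := by
    refine pos_iff_ne_zero.2 fun h0 => ?_
    rw [minLength, h0] at h
    simp at h
  obtain ⟨d, hd, hd1, hle⟩ := exists_ofReal_le h0
  refine ⟨d, hd, hd1, fun k o => (hle.trans (iInf_le _ (L.binding k (lowSide o)))).trans_eq ?_⟩
  rw [L.len_binding _ _ (L.present_lowSide o k), length_lowSide]

/-- Solutions are bounded if the lengths of the bindings are bounded below. -/
theorem IsSolution.exists_bound [Countable K] (h : L.IsSolution ω ϖ u p q w)
    (hL : 0 < L.minLength) (k : K) :
    ∃ B : ℝ, ∀ᵐ z ∂volume.restrict (L.page k), ‖u k z‖ ≤ B := by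
  obtain ⟨d, hd, hd1, hle⟩ := exists_ofReal_le_lenA hL
  obtain ⟨A, hA, hmain⟩ := h.exists_forall_ae_le (C := univ) (ENNReal.mul_ne_top (by norm_num)
    (ENNReal.pow_ne_top ENNReal.ofReal_ne_top)) (sobolevOn_of_length h.isH1D.1 hd hd1
      fun k _ o => hle k o) (fun _ _ _ _ _ _ _ _ _ => mem_univ _)
  -- With `R = -2` the condition `R + 1 < height` holds everywhere, since heights are nonnegative;
  -- only the level is sent to infinity.
  have hlim : Tendsto (fun t : ℝ => L.excess univ u (-2) (t / 2)) atTop (𝓝 0) :=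
    tendsto_excess h.isH1D.1.1 fun x => by
      filter_upwards [eventually_ge_atTop (2 * ‖u x.1 x.2‖)] with t ht
      right
      linarith
  have hlim' : Tendsto (fun t : ℝ => A * L.excess univ u (-2) (t / 2)) atTop (𝓝 0) := by
    simpa using hlim.const_mul A
  obtain ⟨t, ht1, h1, h2⟩ := ((eventually_ge_atTop 1).and ((hlim.eventually_le_const
    zero_lt_one).and (hlim'.eventually_le_const zero_lt_one))).exists
  have h3 := ae_vol.1 (hmain (-2) t (by linarith) (Or.inl rfl) h1 (h2.trans (one_le_pow₀ ht1))) k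
    (mem_univ k)
  refine ⟨t, ?_⟩
  filter_upwards [h3, ae_restrict_mem (L.measurableSet_page k)] with z hz hzp
  exact hz (by linarith [L.height_nonneg hzp])

/-- Solutions tend to zero at infinity on every component of infinite pages. -/
theorem IsSolution.exists_radius [Countable K] (h : L.IsSolution ω ϖ u p q w) {k₀ : K} {o₀ : Bool}
    (h₀ : L.lenA o₀ k₀ = ∞) {m : ℝ} (hm : 0 < m) :
    ∃ R : ℝ, 0 ≤ R ∧
      ∀ᵐ x ∂L.vol (L.component k₀), R < L.height x.1 x.2 → ‖u x.1 x.2‖ ≤ m := by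
  obtain ⟨M, hM, hS⟩ := sobolevOn_component h.isH1D h₀
  obtain ⟨A, hA, hmain⟩ := h.exists_forall_ae_le hM hS mem_component_of_incident
  have hlim : Tendsto (fun R : ℝ => L.excess (L.component k₀) u R (m / 2)) atTop (𝓝 0) :=
    tendsto_excess h.isH1D.1.1 fun x => by
      filter_upwards [eventually_ge_atTop (L.height x.1 x.2)] with R hR
      exact Or.inl hR
  have hlim' : Tendsto (fun R : ℝ => A * L.excess (L.component k₀) u R (m / 2)) atTop (𝓝 0) := by
    simpa using hlim.const_mul A
  -- Here the level is fixed and the height is sent to infinity, so `m` may be as small as desired.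
  obtain ⟨R, hR, h1, h2⟩ := ((eventually_ge_atTop 0).and ((hlim.eventually_le_const
    zero_lt_one).and (hlim'.eventually_le_const (show 0 < m ^ 2 by positivity)))).exists
  exact ⟨R + 1, by linarith, hmain R m hm (Or.inr hR) h1 h2⟩

end OpenBook

/-! ### Integrals of derivatives along infinite directions -/

/-- An integrable function with integrable derivative tends to zero at infinity, so the integral of
the derivative is `-V 0`. -/
theorem integral_Ioi_nonpos_of_primitive {V W : ℝ → ℝ} (hV : ∀ y, 0 ≤ V y)
    (hVi : IntegrableOn V (Ioi 0)) (hWi : IntegrableOn W (Ioi 0))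
    (h : ∀ y, 0 ≤ y → V y = V 0 + ∫ s in (0)..y, W s) : ∫ s in Ioi 0, W s ≤ 0 := by
  have h1 : Tendsto V atTop (𝓝 (V 0 + ∫ s in Ioi 0, W s)) := by
    refine ((intervalIntegral_tendsto_integral_Ioi 0 hWi tendsto_id).const_add (V 0)).congr' ?_
    filter_upwards [eventually_ge_atTop 0] with y hy
    exact (h y hy).symm
  have h2 : V 0 + ∫ s in Ioi 0, W s = 0 := by
    refine IntegrableAtFilter.eq_zero_of_tendsto (μ := volume) ⟨Ioi 0, Ioi_mem_atTop 0, hVi⟩ ?_ h1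
    intro s hs
    obtain ⟨a, ha⟩ := mem_atTop_sets.1 hs
    refine top_le_iff.1 ?_
    rw [← Real.volume_Ici (a := a)]
    exact measure_mono ha
  linarith [hV 0]

theorem ray_top : ray ∞ = Ioi 0 := by
  ext t
  simp [ray]

theorem IsVertPrimitive.integral_nonpos {V W : ℝ × ℝ → ℝ} (h : IsVertPrimitive V W)
    (hV : ∀ z, 0 ≤ V z) {a : ℝ≥0∞} (hVi : IntegrableOn V (openRect a ∞))
    (hWi : IntegrableOn W (openRect a ∞)) : ∫ z in openRect a ∞, W z ≤ 0 := by
  rw [IntegrableOn, restrict_openRect] at hVi hWi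
  rw [restrict_openRect, integral_prod _ hWi]
  refine integral_nonpos_of_ae ?_
  filter_upwards [hVi.prod_right_ae, hWi.prod_right_ae] with t h1 h2
  rw [ray_top] at h1 h2 ⊢
  refine integral_Ioi_nonpos_of_primitive (V := fun s => V (t, s)) (fun y => hV _) h1 h2
    fun y _ => ?_
  rw [← h.sub_eq]
  ring

namespace OpenBook

variable {J K : Type*} {L : OpenBook J K} {C : Set K} {u p q w : K → ℝ × ℝ → ℂ} {H : ℝ × ℝ → ℝ}

theorem integral_turn (o : Bool) (k : K) (f : ℝ × ℝ → ℝ) :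
    ∫ z in openRect (L.lenA o k) (L.lenB o k), f (turn o z) = ∫ z in L.page k, f z :=
  (L.measurePreserving_turn o k).integral_comp (measurableEmbedding_turn o) f

theorem integrable_turn {o : Bool} {k : K} {f : ℝ × ℝ → ℝ} (h : IntegrableOn f (L.page k)) :
    IntegrableOn (fun z => f (turn o z)) (openRect (L.lenA o k) (L.lenB o k)) :=
  ((L.measurePreserving_turn o k).integrable_comp_emb (measurableEmbedding_turn o)).2 h

theorem integral_radialDeriv_page_nonpos (hu : L.IsH1 u p q) (hH : IsCutoff H)
    (hH0 : ∀ r s, 0 ≤ s → 0 ≤ H (r, s)) (o : Bool) {k : K} (hk : L.lenB o k = ∞)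
    (h1 : IntegrableOn (L.radial H u k) (L.page k))
    (h2 : IntegrableOn (L.radialDeriv H (cond o L.wt₁ L.wt₂) u (cond o p q) k) (L.page k)) :
    ∫ z in L.page k, L.radialDeriv H (cond o L.wt₁ L.wt₂) u (cond o p q) k z ≤ 0 := by
  obtain ⟨U, g, hU, hUu, hg⟩ := hu.exists_isVertPrimitive o k
  have hV := L.isVertPrimitive_turned hH hU o k
  have e1 : (fun z => L.radial H u k (turn o z)) =ᵐ[volume.restrict
      (openRect (L.lenA o k) (L.lenB o k))] L.turned H o k U := by
    filter_upwards [hUu] with z hz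
    exact (turned_eq H hz).symm
  have e2 : (fun z => L.radialDeriv H (cond o L.wt₁ L.wt₂) u (cond o p q) k (turn o z))
      =ᵐ[volume.restrict (openRect (L.lenA o k) (L.lenB o k))] L.turnedDeriv H o k U g := by
    filter_upwards [hUu, hg] with z hz hz'
    cases o <;> rw [turnedDeriv, ← height_turn, hz, hz'] <;> rfl
  rw [← L.integral_turn o k, integral_congr_ae e2, hk]
  have i1 := (integrable_turn (o := o) h1).congr_fun_ae e1
  have i2 := (integrable_turn (o := o) h2).congr_fun_ae e2
  rw [hk] at i1 i2
  exact hV.integral_nonpos (fun z => hH0 _ _ (norm_nonneg _)) i1 i2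

theorem integrableOn_page {f : (Σ _ : K, ℝ × ℝ) → ℝ} (h : Integrable f (L.vol C)) {k : K}
    (hk : k ∈ C) : IntegrableOn (fun z => f ⟨k, z⟩) (L.page k) := by
  have h1 := h.mono_measure (Measure.le_sum (fun k : C => (volume.restrict (L.page k)).map
    fun z => (⟨k.1, z⟩ : Σ _ : K, ℝ × ℝ)) ⟨k, hk⟩)
  exact ((measurableEmbedding_sigmaMk k).integrable_map_iff).1 h1

/-- The weight selects the pages that are infinite in the chosen direction. On each of them only the
boundary term at the binding survives, with a minus sign. -/
theorem integral_radialDeriv_nonpos (hu : L.IsH1 u p q) (hH : IsCutoff H)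
    (hH0 : ∀ r s, 0 ≤ s → 0 ≤ H (r, s)) (o : Bool)
    (h1 : Integrable (fun x : Σ _ : K, ℝ × ℝ => L.radial H u x.1 x.2) (L.vol C))
    (h2 : Integrable (fun x : Σ _ : K, ℝ × ℝ => L.wtB o x.1 *
      L.radialDeriv H (cond o L.wt₁ L.wt₂) u (cond o p q) x.1 x.2) (L.vol C)) :
    ∫ x, L.wtB o x.1 * L.radialDeriv H (cond o L.wt₁ L.wt₂) u (cond o p q) x.1 x.2 ∂L.vol C ≤ 0 := by
  rw [integral_vol h2]
  refine tsum_nonpos fun k => ?_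
  by_cases hk : L.lenB o k = ∞
  · have hw : L.wtB o k = 1 := by
      rw [← lenA_not] at hk
      have := L.wtA_of_top hk
      cases o <;> exact this
    have h3 := integrableOn_page h2 k.2
    simp only [hw, one_mul] at h3 ⊢
    exact integral_radialDeriv_page_nonpos hu hH hH0 o hk (integrableOn_page h1 k.2) h3
  · simp [L.wtB_of_ne_top hk]

theorem aestronglyMeasurable_radialDeriv [Countable K] (hu : L.MemL2 u) (hp : L.MemL2 p)
    (hH : IsCutoff H) (wt : K → ℝ) :
    AEStronglyMeasurable (fun x : Σ _ : K, ℝ × ℝ => L.radialDeriv H wt u p x.1 x.2) (L.vol C) := by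
  refine aestronglyMeasurable_vol fun k _ => ?_
  have h1 := (L.continuous_height k).aestronglyMeasurable (μ := volume.restrict (L.page k))
  have := (isBoundedBilinearMap_apply (𝕜 := ℝ) (E := ℝ × ℂ) (F := ℝ)).continuous
    |>.comp_aestronglyMeasurable
      (((hH.contDiff_norm.continuous_fderiv one_ne_zero).comp_aestronglyMeasurable
        (h1.prodMk (hu.1 k))).prodMk
        ((aestronglyMeasurable_const (b := wt k)).prodMk (hp.1 k)))
  refine this.congr (Eventually.of_forall fun z => ?_)
  exact hH.fderiv_norm _ _ _ _

end OpenBook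

/-! ### Comparison with an exponential barrier -/

/-- The primitive of a step. -/
noncomputable def stepPrim (κ : ℝ → ℝ) (x : ℝ) : ℝ := ∫ s in (0)..x, κ s

namespace IsStep

variable {κ : ℝ → ℝ} {D : ℝ}

theorem hasDerivAt_stepPrim (h : IsStep κ 0 1 D) (x : ℝ) : HasDerivAt (stepPrim κ) (κ x) x :=
  intervalIntegral.integral_hasDerivAt_right (h.contDiff.continuous.intervalIntegrable _ _)
    (h.contDiff.continuous.stronglyMeasurableAtFilter _ _) h.contDiff.continuous.continuousAt

theorem contDiff_stepPrim (h : IsStep κ 0 1 D) : ContDiff ℝ 1 (stepPrim κ) := by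
  rw [contDiff_one_iff_deriv]
  refine ⟨fun x => (h.hasDerivAt_stepPrim x).differentiableAt, ?_⟩
  rw [show deriv (stepPrim κ) = κ from funext fun x => (h.hasDerivAt_stepPrim x).deriv]
  exact h.contDiff.continuous

theorem stepPrim_of_nonpos (h : IsStep κ 0 1 D) {x : ℝ} (hx : x ≤ 0) : stepPrim κ x = 0 := by
  rw [stepPrim, intervalIntegral.integral_symm, intervalIntegral.integral_of_le hx,
    setIntegral_congr_fun measurableSet_Ioc fun s hs => h.zero s hs.2]
  simp

theorem stepPrim_nonneg (h : IsStep κ 0 1 D) (x : ℝ) : 0 ≤ stepPrim κ x := by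
  rcases le_total x 0 with hx | hx
  · exact (h.stepPrim_of_nonpos hx).ge
  · exact intervalIntegral.integral_nonneg hx fun s _ => h.nonneg s

theorem stepPrim_le (h : IsStep κ 0 1 D) {x : ℝ} (hx : 0 ≤ x) : stepPrim κ x ≤ x * κ x := by
  calc stepPrim κ x ≤ ∫ _ in (0)..x, κ x :=
        intervalIntegral.integral_mono_on hx (h.contDiff.continuous.intervalIntegrable _ _)
          intervalIntegrable_const fun s hs => h.mono hs.2
    _ = x * κ x := by simp

end IsStep

/-- The cut-off to the set where the second variable is above the barrier `ψ`. -/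
noncomputable def aboveCutoff (χ κ ψ : ℝ → ℝ) (z : ℝ × ℝ) : ℝ := χ z.1 * κ (z.2 - ψ z.1)

/-- A potential whose gradient compensates the mixed terms of the energy of `aboveCutoff`. -/
noncomputable def abovePotential (χ κ ψ : ℝ → ℝ) (z : ℝ × ℝ) : ℝ :=
  χ z.1 * (ψ z.1 * (z.2 * κ (z.2 - ψ z.1) + stepPrim κ (z.2 - ψ z.1)))

section

variable {χ κ ψ : ℝ → ℝ} {R R' D b : ℝ}

theorem contDiff_aboveCutoff (hχ : IsStep χ R R' D) (hκ : IsStep κ 0 1 D) (hψ : ContDiff ℝ 1 ψ) :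
    ContDiff ℝ 1 (aboveCutoff χ κ ψ) :=
  (hχ.contDiff.comp contDiff_fst).mul
    (hκ.contDiff.comp (contDiff_snd.sub (hψ.comp contDiff_fst)))

theorem contDiff_abovePotential (hχ : IsStep χ R R' D) (hκ : IsStep κ 0 1 D)
    (hψ : ContDiff ℝ 1 ψ) : ContDiff ℝ 1 (abovePotential χ κ ψ) := by
  have hN : ContDiff ℝ 1 fun z : ℝ × ℝ => z.2 - ψ z.1 := contDiff_snd.sub (hψ.comp contDiff_fst)
  exact (hχ.contDiff.comp contDiff_fst).mul ((hψ.comp contDiff_fst).mul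
    ((contDiff_snd.mul (hκ.contDiff.comp hN)).add (hκ.contDiff_stepPrim.comp hN)))

theorem derivFst_aboveCutoff (hχ : IsStep χ R R' D) (hκ : IsStep κ 0 1 D) (hψ : ContDiff ℝ 1 ψ)
    (hb : ∀ r, HasDerivAt ψ (-b * ψ r) r) (r s : ℝ) : derivFst (aboveCutoff χ κ ψ) r s =
      deriv χ r * κ (s - ψ r) + χ r * (deriv κ (s - ψ r) * (b * ψ r)) := by
  refine derivFst_eq (contDiff_aboveCutoff hχ hκ hψ) ?_
  have h1 := (hκ.hasDerivAt (s - ψ r)).comp r ((hb r).const_sub s)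
  refine ((hχ.hasDerivAt r).mul h1).congr_deriv ?_
  simp

theorem derivSnd_aboveCutoff (hχ : IsStep χ R R' D) (hκ : IsStep κ 0 1 D) (hψ : ContDiff ℝ 1 ψ)
    (r s : ℝ) : derivSnd (aboveCutoff χ κ ψ) r s = χ r * deriv κ (s - ψ r) := by
  refine derivSnd_eq (contDiff_aboveCutoff hχ hκ hψ) ?_
  have h1 := (hκ.hasDerivAt (s - ψ r)).comp s ((hasDerivAt_id s).sub_const (ψ r))
  refine (h1.const_mul (χ r)).congr_deriv ?_
  simp

theorem derivFst_abovePotential (hχ : IsStep χ R R' D) (hκ : IsStep κ 0 1 D)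
    (hψ : ContDiff ℝ 1 ψ) (hb : ∀ r, HasDerivAt ψ (-b * ψ r) r) (r s : ℝ) :
    derivFst (abovePotential χ κ ψ) r s =
      deriv χ r * (ψ r * (s * κ (s - ψ r) + stepPrim κ (s - ψ r))) +
      χ r * (-b * ψ r * (s * κ (s - ψ r) + stepPrim κ (s - ψ r)) +
        ψ r * ((s * deriv κ (s - ψ r) + κ (s - ψ r)) * (b * ψ r))) := by
  refine derivFst_eq (contDiff_abovePotential hχ hκ hψ) ?_
  have h0 := (hb r).const_sub s
  have h1 := (hκ.hasDerivAt (s - ψ r)).comp r h0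
  have h2 := (hκ.hasDerivAt_stepPrim (s - ψ r)).comp r h0
  refine ((hχ.hasDerivAt r).mul ((hb r).mul ((h1.const_mul s).add h2))).congr_deriv ?_
  simp only [Function.comp, Pi.add_apply, Pi.mul_apply]
  ring

theorem derivSnd_abovePotential (hχ : IsStep χ R R' D) (hκ : IsStep κ 0 1 D)
    (hψ : ContDiff ℝ 1 ψ) (r s : ℝ) : derivSnd (abovePotential χ κ ψ) r s =
      χ r * (ψ r * (2 * κ (s - ψ r) + s * deriv κ (s - ψ r))) := by
  refine derivSnd_eq (contDiff_abovePotential hχ hκ hψ) ?_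
  have h0 := (hasDerivAt_id s).sub_const (ψ r)
  have h1 := (hκ.hasDerivAt (s - ψ r)).comp s h0
  have h2 := (hκ.hasDerivAt_stepPrim (s - ψ r)).comp s h0
  refine (((((hasDerivAt_id s).mul h1).add h2).const_mul (ψ r)).const_mul (χ r)).congr_deriv ?_
  simp only [Function.comp, id]
  ring

theorem isCutoff_abovePotential (hχ : IsStep χ R R' D) (hκ : IsStep κ 0 1 D)
    (hψ : ContDiff ℝ 1 ψ) (hψ0 : ∀ r, 0 < ψ r) : IsCutoff (abovePotential χ κ ψ) :=
  ⟨contDiff_abovePotential hχ hκ hψ, ψ, hψ.continuous, hψ0, fun r s hs => by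
    simp [abovePotential, hκ.zero (s - ψ r) (by linarith),
      hκ.stepPrim_of_nonpos (x := s - ψ r) (by linarith)]⟩

theorem abovePotential_nonneg (hχ : IsStep χ R R' D) (hκ : IsStep κ 0 1 D) (hψ0 : ∀ r, 0 < ψ r)
    (r s : ℝ) (hs : 0 ≤ s) : 0 ≤ abovePotential χ κ ψ (r, s) :=
  mul_nonneg (hχ.nonneg _) (mul_nonneg (hψ0 _).le (add_nonneg (mul_nonneg hs (hκ.nonneg _))
    (hκ.stepPrim_nonneg _)))

theorem bounded_aboveCutoff (hχ : IsStep χ R R' D) (hκ : IsStep κ 0 1 D) (hψ : ContDiff ℝ 1 ψ)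
    (hb : ∀ r, HasDerivAt ψ (-b * ψ r) r) (hψ0 : ∀ r, 0 < ψ r) (hb0 : 0 ≤ b) {A : ℝ}
    (hA : ∀ r, 0 ≤ r → ψ r ≤ A) :
    IsCutoff.Bounded (aboveCutoff χ κ ψ) (1 + D + D * (b * A) + D * (1 + A)) := by
  have hD := hχ.const_nonneg
  have hA0 : 0 ≤ A := (hψ0 0).le.trans (hA 0 le_rfl)
  refine ⟨⟨contDiff_aboveCutoff hχ hκ hψ, ψ, hψ.continuous, hψ0, fun r s hs => ?_⟩,
    fun r s _ _ => ?_, fun r s hr _ => ?_, fun r s hr hs => ?_⟩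
  · simp [aboveCutoff, hκ.zero (s - ψ r) (by linarith)]
  · rw [aboveCutoff, abs_of_nonneg (mul_nonneg (hχ.nonneg _) (hκ.nonneg _))]
    have h1 : χ r * κ (s - ψ r) ≤ 1 := mul_le_one₀ (hχ.le_one _) (hκ.nonneg _) (hκ.le_one _)
    have h2 : 0 ≤ D + D * (b * A) + D * (1 + A) := by positivity
    simp only
    linarith
  · rw [derivFst_aboveCutoff hχ hκ hψ hb]
    have hd := hχ.deriv_nonneg r
    have hk := hκ.nonneg (s - ψ r)
    have hc := hχ.nonneg r
    have hk' := hκ.deriv_nonneg (s - ψ r)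
    have hp := (hψ0 r).le
    rw [abs_of_nonneg (by positivity)]
    have h1 : deriv χ r * κ (s - ψ r) ≤ D * 1 :=
      mul_le_mul (hχ.deriv_le r) (hκ.le_one _) hk hD
    have h2 : χ r * (deriv κ (s - ψ r) * (b * ψ r)) ≤ 1 * (D * (b * A)) := by
      have := hA r hr
      have := hχ.le_one r
      have := hκ.deriv_le (s - ψ r)
      gcongr
    have h3 : 0 ≤ D * (1 + A) := by positivity
    linarith
  · rw [derivSnd_aboveCutoff hχ hκ hψ]
    have hc := hχ.nonneg r
    have hk' := hκ.deriv_nonneg (s - ψ r)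
    rw [abs_of_nonneg (by positivity)]
    have h0 : 0 ≤ 1 + D + D * (b * A) := by positivity
    have h1 : deriv κ (s - ψ r) * s ≤ D * (1 + A) := by
      by_cases h : 1 ≤ s - ψ r
      · rw [hκ.deriv_of_ge h, zero_mul]
        positivity
      · have := hA r hr
        have h2 : s ≤ 1 + A := by linarith
        have := hκ.deriv_le (s - ψ r)
        gcongr
    have h2 : χ r * deriv κ (s - ψ r) * s ≤ 1 * (deriv κ (s - ψ r) * s) := by
      rw [mul_assoc]
      exact mul_le_mul_of_nonneg_right (hχ.le_one r) (by positivity)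
    linarith

/-- The functions `aboveCutoff` and `abovePotential` vanish, with their gradients, below the
barrier. -/
theorem above_eq_zero (hχ : IsStep χ R R' D) (hκ : IsStep κ 0 1 D) (hψ : ContDiff ℝ 1 ψ)
    (hb : ∀ r, HasDerivAt ψ (-b * ψ r) r) {r s : ℝ} (h : r ≤ R ∨ s ≤ ψ r) :
    aboveCutoff χ κ ψ (r, s) = 0 ∧ derivFst (aboveCutoff χ κ ψ) r s = 0 ∧
      derivSnd (aboveCutoff χ κ ψ) r s = 0 ∧ abovePotential χ κ ψ (r, s) = 0 ∧
      derivFst (abovePotential χ κ ψ) r s = 0 ∧ derivSnd (abovePotential χ κ ψ) r s = 0 := by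
  rw [derivFst_aboveCutoff hχ hκ hψ hb, derivSnd_aboveCutoff hχ hκ hψ,
    derivFst_abovePotential hχ hκ hψ hb, derivSnd_abovePotential hχ hκ hψ]
  rcases h with h | h
  · simp [aboveCutoff, abovePotential, hχ.zero r h, hχ.deriv_of_le h]
  · simp [aboveCutoff, abovePotential, hκ.zero (s - ψ r) (by linarith),
      hκ.deriv_of_le (r := s - ψ r) (by linarith),
      hκ.stepPrim_of_nonpos (x := s - ψ r) (by linarith)]

/-- Since the primitive of `κ` is at most `(s - ψ) κ`, the claim reduces to `ψ (2 s - ψ) ≤ s²`, the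
nonnegativity of `(s - ψ)²`. -/
theorem abovePotential_le (hχ : IsStep χ R R' D) (hκ : IsStep κ 0 1 D) (hψ0 : ∀ r, 0 < ψ r)
    (r s : ℝ) : abovePotential χ κ ψ (r, s) ≤ aboveCutoff χ κ ψ (r, s) * s ^ 2 := by
  simp only [abovePotential, aboveCutoff]
  rw [mul_assoc]
  refine mul_le_mul_of_nonneg_left ?_ (hχ.nonneg r)
  rcases le_total s (ψ r) with h | h
  · simp [hκ.zero (s - ψ r) (by linarith), hκ.stepPrim_of_nonpos (x := s - ψ r) (by linarith)]
  · have h1 := hκ.stepPrim_le (x := s - ψ r) (by linarith)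
    have h2 := hκ.nonneg (s - ψ r)
    have h3 := mul_le_mul_of_nonneg_left h1 (hψ0 r).le
    nlinarith [mul_nonneg h2 (sq_nonneg (s - ψ r))]

end

/-- The expression dominates a sum of nonnegative terms. In terms of `f = |u|` with gradient `(x,
y)` and of `∇ψ = -b ψ e`, the main one is `(κ + f κ') |∇(f - ψ)|²`. The other terms are `κ (|∇u|² -
|∇f|²)` and a multiple of `2 - |e|²`, which is where the factor `2 b²` originates. -/
theorem comparison_inequality {k k' f b ψ P Q x y e₁ e₂ Z : ℝ} (hk : 0 ≤ k) (hk' : 0 ≤ k')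
    (hf : 0 ≤ f) (hψ : 0 ≤ ψ) (hx : x ^ 2 ≤ P ^ 2) (hy : y ^ 2 ≤ Q ^ 2) (h₁ : e₁ ^ 2 ≤ 1)
    (h₂ : e₂ ^ 2 ≤ 1) (hZ : 0 ≤ Z) :
    0 ≤ k * (P ^ 2 + Q ^ 2) + k' * f * (x ^ 2 + y ^ 2) + k' * (b * ψ) * (f * (e₁ * x + e₂ * y)) +
      b * (e₁ * ((-b * ψ * Z + ψ * ((f * k' + k) * (b * ψ))) * e₁ + ψ * (2 * k + f * k') * x) +
        e₂ * ((-b * ψ * Z + ψ * ((f * k' + k) * (b * ψ))) * e₂ + ψ * (2 * k + f * k') * y)) +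
      2 * b ^ 2 * (ψ * Z) := by
  have a1 : 0 ≤ k * (P ^ 2 - x ^ 2) := mul_nonneg hk (by linarith)
  have a2 : 0 ≤ k * (Q ^ 2 - y ^ 2) := mul_nonneg hk (by linarith)
  have a3 : 0 ≤ (k + k' * f) * ((x + b * ψ * e₁) ^ 2 + (y + b * ψ * e₂) ^ 2) := by positivity
  have a4 : 0 ≤ (b ^ 2 * (ψ * Z)) * ((1 - e₁ ^ 2) + (1 - e₂ ^ 2)) :=
    mul_nonneg (by positivity) (by linarith)
  linarith

theorem integral_add_mul_add_mul {α : Type*} [MeasurableSpace α] {μ : Measure α}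
    {f g₁ g₂ h : α → ℝ} (hf : Integrable f μ) (h₁ : Integrable g₁ μ) (h₂ : Integrable g₂ μ)
    (hh : Integrable h μ) (b c : ℝ) :
    ∫ x, (f x + b * (g₁ x + g₂ x) + c * h x) ∂μ =
      ∫ x, f x ∂μ + b * (∫ x, g₁ x ∂μ + ∫ x, g₂ x ∂μ) + c * ∫ x, h x ∂μ := by
  have i₁ : Integrable (fun x => b * (g₁ x + g₂ x)) μ := (h₁.add h₂).const_mul b
  have i₂ : Integrable (fun x => f x + b * (g₁ x + g₂ x)) μ := hf.add i₁
  rw [integral_add i₂ (hh.const_mul c), integral_add hf i₁, integral_const_mul, integral_const_mul,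
    integral_add h₁ h₂]

namespace OpenBook

variable {J K : Type*} {L : OpenBook J K} {C : Set K} {u p q w : K → ℝ × ℝ → ℂ}
  {χ κ ψ : ℝ → ℝ} {R D b m : ℝ}

theorem sq_inner_div_norm_le (ξ η : ℂ) : (inner ℝ ξ η / ‖ξ‖) ^ 2 ≤ ‖η‖ ^ 2 := by
  rw [sq_le_sq, abs_norm, abs_div, abs_norm]
  refine div_le_of_le_mul₀ (norm_nonneg _) (norm_nonneg _) ?_
  rw [mul_comm]
  exact abs_real_inner_le_norm _ _

theorem energyDensity_aboveCutoff_nonneg (hχ : IsStep χ R (R + 1) D) (hκ : IsStep κ 0 1 D)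
    (hψ : ContDiff ℝ 1 ψ) (hb : ∀ r, HasDerivAt ψ (-b * ψ r) r) (hψ0 : ∀ r, 0 < ψ r)
    {x : Σ _ : K, ℝ × ℝ} (h : (L.height x.1 x.2 ≤ R ∨ ‖u x.1 x.2‖ ≤ ψ (L.height x.1 x.2)) ∨
      (R + 1 < L.height x.1 x.2 ∧ ψ (L.height x.1 x.2) < ‖u x.1 x.2‖)) :
    0 ≤ L.energyDensity (aboveCutoff χ κ ψ) u p q x +
      b * (L.wt₁ x.1 * L.radialDeriv (abovePotential χ κ ψ) L.wt₁ u p x.1 x.2 +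
        L.wt₂ x.1 * L.radialDeriv (abovePotential χ κ ψ) L.wt₂ u q x.1 x.2) +
      2 * b ^ 2 * L.radial (abovePotential χ κ ψ) u x.1 x.2 := by
  rw [energyDensity, radialDeriv, radialDeriv, radial]
  rcases h with h | ⟨h1, h2⟩
  · obtain ⟨e1, e2, e3, e4, e5, e6⟩ := above_eq_zero hχ hκ hψ hb h
    rw [e1, e2, e3, e4, e5, e6]
    simp
  · have hf : 0 < ‖u x.1 x.2‖ := (hψ0 _).trans h2
    have hw₁ : L.wt₁ x.1 ^ 2 ≤ 1 := pow_le_one₀ (L.wt₁_nonneg _) (L.wt₁_le_one _)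
    have hw₂ : L.wt₂ x.1 ^ 2 ≤ 1 := pow_le_one₀ (L.wt₂_nonneg _) (L.wt₂_le_one _)
    have hp := sq_inner_div_norm_le (u x.1 x.2) (p x.1 x.2)
    have hq := sq_inner_div_norm_le (u x.1 x.2) (q x.1 x.2)
    rw [derivFst_aboveCutoff hχ hκ hψ hb, derivSnd_aboveCutoff hχ hκ hψ,
      derivFst_abovePotential hχ hκ hψ hb, derivSnd_abovePotential hχ hκ hψ,
      aboveCutoff, abovePotential]
    simp only
    rw [hχ.one _ h1.le, hχ.deriv_of_ge h1.le]
    generalize L.height x.1 x.2 = r at *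
    have hk := hκ.nonneg (‖u x.1 x.2‖ - ψ r)
    have hk' := hκ.deriv_nonneg (‖u x.1 x.2‖ - ψ r)
    have hZ : 0 ≤ ‖u x.1 x.2‖ * κ (‖u x.1 x.2‖ - ψ r) + stepPrim κ (‖u x.1 x.2‖ - ψ r) :=
      add_nonneg (mul_nonneg hf.le hk) (hκ.stepPrim_nonneg _)
    have key := comparison_inequality (b := b) hk hk' hf.le (hψ0 r).le hp hq hw₁ hw₂ hZ
    have e1 : inner ℝ (u x.1 x.2) (p x.1 x.2) =
        ‖u x.1 x.2‖ * (inner ℝ (u x.1 x.2) (p x.1 x.2) / ‖u x.1 x.2‖) := by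
      field_simp
    have e2 : inner ℝ (u x.1 x.2) (q x.1 x.2) =
        ‖u x.1 x.2‖ * (inner ℝ (u x.1 x.2) (q x.1 x.2) / ‖u x.1 x.2‖) := by
      field_simp
    generalize inner ℝ (u x.1 x.2) (p x.1 x.2) / ‖u x.1 x.2‖ = i at *
    generalize inner ℝ (u x.1 x.2) (q x.1 x.2) / ‖u x.1 x.2‖ = j at *
    rw [e1, e2]
    refine key.trans_eq ?_
    field_simp
    ring

/-- This supplies an integrable majorant for the derivative of the potential. The bound `m` on `|u|`
controls `|u| κ'`, and `ψ < |u|` turns the remaining factors into products of `L²` functions. -/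
theorem norm_radialDeriv_abovePotential_le (hχ : IsStep χ R (R + 1) D) (hκ : IsStep κ 0 1 D)
    (hψ : ContDiff ℝ 1 ψ) (hb : ∀ r, HasDerivAt ψ (-b * ψ r) r) (hψ0 : ∀ r, 0 < ψ r) (hb0 : 0 ≤ b)
    (hm : 0 ≤ m) {wt : K → ℝ} (hwt : ∀ k, 0 ≤ wt k) (hwt' : ∀ k, wt k ≤ 1) {x : Σ _ : K, ℝ × ℝ}
    (h : (L.height x.1 x.2 ≤ R ∨ ‖u x.1 x.2‖ ≤ ψ (L.height x.1 x.2)) ∨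
      (R + 1 < L.height x.1 x.2 ∧ ψ (L.height x.1 x.2) < ‖u x.1 x.2‖ ∧ ‖u x.1 x.2‖ ≤ m)) :
    ‖wt x.1 * L.radialDeriv (abovePotential χ κ ψ) wt u p x.1 x.2‖ ≤
      b * (m * D + 2) * (‖u x.1 x.2‖ * ‖u x.1 x.2‖) + (m * D + 2) * (‖u x.1 x.2‖ * ‖p x.1 x.2‖) := by
  have hD := hχ.const_nonneg
  have hpot := abovePotential_le hχ hκ hψ0 (L.height x.1 x.2) ‖u x.1 x.2‖
  have hi : |inner ℝ (u x.1 x.2) (p x.1 x.2) / ‖u x.1 x.2‖| ≤ ‖p x.1 x.2‖ := by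
    have := sq_inner_div_norm_le (u x.1 x.2) (p x.1 x.2)
    rwa [sq_le_sq, abs_norm] at this
  rw [radialDeriv, norm_mul, Real.norm_of_nonneg (hwt _), Real.norm_eq_abs]
  rcases h with h | ⟨h1, h2, h3⟩
  · obtain ⟨-, -, -, -, e5, e6⟩ := above_eq_zero hχ hκ hψ hb h
    rw [e5, e6]
    simp only [zero_mul, add_zero, abs_zero, mul_zero]
    positivity
  · refine (mul_le_of_le_one_left (abs_nonneg _) (hwt' _)).trans ?_
    rw [aboveCutoff, abovePotential] at hpot
    rw [derivFst_abovePotential hχ hκ hψ hb, derivSnd_abovePotential hχ hκ hψ]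
    simp only at hpot
    rw [hχ.one _ h1.le] at hpot ⊢
    rw [hχ.deriv_of_ge h1.le]
    have hψr := (hψ0 (L.height x.1 x.2)).le
    have hf0 : 0 ≤ ‖u x.1 x.2‖ := norm_nonneg _
    have hw := hwt x.1
    have hw' := hwt' x.1
    generalize L.height x.1 x.2 = r at *
    generalize ‖u x.1 x.2‖ = f at *
    generalize inner ℝ (u x.1 x.2) (p x.1 x.2) / f = i at *
    have hk := hκ.nonneg (f - ψ r)
    have hk1 := hκ.le_one (f - ψ r)
    have hk' := hκ.deriv_nonneg (f - ψ r)
    have hkD := hκ.deriv_le (f - ψ r)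
    have hZ : 0 ≤ f * κ (f - ψ r) + stepPrim κ (f - ψ r) :=
      add_nonneg (mul_nonneg hf0 hk) (hκ.stepPrim_nonneg _)
    generalize f * κ (f - ψ r) + stepPrim κ (f - ψ r) = Z at *
    generalize κ (f - ψ r) = k at *
    generalize deriv κ (f - ψ r) = k' at *
    generalize ψ r = y at *
    have hZf : y * Z ≤ f * f := by
      have : k * f ^ 2 ≤ 1 * f ^ 2 := mul_le_mul_of_nonneg_right hk1 (by positivity)
      linarith
    have hfk : f * k' ≤ m * D := mul_le_mul h3 hkD hk' hm
    have hmD : 0 ≤ m * D := mul_nonneg hm hD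
    have a1 : |-b * y * Z + y * ((f * k' + k) * (b * y))| ≤ b * (m * D + 2) * (f * f) := by
      have b1 : y * ((f * k' + k) * (b * y)) ≤ b * (m * D + 1) * (f * f) := by
        calc y * ((f * k' + k) * (b * y)) ≤ f * ((m * D + 1) * (b * f)) := by gcongr
          _ = _ := by ring
      have b2 : 0 ≤ y * ((f * k' + k) * (b * y)) := by positivity
      have b3 : b * (y * Z) ≤ b * (f * f) := mul_le_mul_of_nonneg_left hZf hb0
      have b4 : 0 ≤ b * (y * Z) := by positivity
      have b5 : 0 ≤ b * (m * D + 1) * (f * f) := by positivity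
      rw [abs_le]
      constructor <;> linarith
    have a2 : |y * (2 * k + f * k') * i| ≤ (m * D + 2) * (f * ‖p x.1 x.2‖) := by
      rw [abs_mul, abs_of_nonneg (by positivity)]
      calc y * (2 * k + f * k') * |i| ≤ f * (2 * 1 + m * D) * ‖p x.1 x.2‖ := by gcongr
        _ = _ := by ring
    have a3 : |(-b * y * Z + y * ((f * k' + k) * (b * y))) * wt x.1| ≤
        b * (m * D + 2) * (f * f) := by
      rw [abs_mul, abs_of_nonneg hw]
      exact (mul_le_of_le_one_right (abs_nonneg _) hw').trans a1
    simp only [zero_mul, zero_add, one_mul]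
    exact (abs_add_le _ _).trans (add_le_add a3 a2)

theorem integrable_norm_mul_norm [Countable K] (hu : L.MemL2 u) (hp : L.MemL2 p) :
    Integrable (fun x : Σ _ : K, ℝ × ℝ => ‖u x.1 x.2‖ * ‖p x.1 x.2‖) (L.vol C) :=
  (hu.memLp_vol C).norm.integrable_mul (hp.memLp_vol C).norm

/-- A solution which is small at large height decays exponentially in the height. -/
theorem IsSolution.ae_le_exp [Countable K] {ω ϖ : ℝ} (h : L.IsSolution ω ϖ u p q w) (hω : 0 < ω)
    (hϖ : 1 < ϖ)
    (hC : ∀ j, L.len j = ∞ → ∀ k s k' s', L.Incident k s j → L.Incident k' s' j → k ∈ C → k' ∈ C)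
    (hR0 : 0 ≤ R) (hm : 0 < m) (hmω : m ^ (ϖ - 1) ≤ ω / 4)
    (hR : ∀ᵐ x ∂L.vol C, R < L.height x.1 x.2 → ‖u x.1 x.2‖ ≤ m) :
    ∀ᵐ x ∂L.vol C, R + 1 < L.height x.1 x.2 →
      ‖u x.1 x.2‖ ≤ m * Real.exp (-(√ω / 2) * (L.height x.1 x.2 - (R + 1))) := by
  obtain ⟨D, hD, hstep⟩ := exists_isStep
  obtain ⟨χ, hχ⟩ := hstep R (R + 1) (by linarith)
  obtain ⟨κ, hκ⟩ := hstep 0 1 zero_lt_one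
  rw [add_sub_cancel_left, div_one] at hχ
  rw [sub_zero, div_one] at hκ
  -- With this rate `ω = 4 b²`, and `m ^ (ϖ - 1) ≤ ω / 4` means that the nonlinear coefficient is at
  -- most `b²`.
  set b := √ω / 2 with hbdef
  have hb0 : 0 < b := by positivity
  have hb2 : ω = 4 * b ^ 2 := by
    rw [hbdef, div_pow, Real.sq_sqrt hω.le]
    ring
  set ψ : ℝ → ℝ := fun r => m * Real.exp (-b * (r - (R + 1))) with hψdef
  have hψ0 : ∀ r, 0 < ψ r := fun r => by positivity
  have hψ : ContDiff ℝ 1 ψ := by fun_prop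
  have hψ' : ∀ r, HasDerivAt ψ (-b * ψ r) r := fun r => by
    refine ((((hasDerivAt_id r).sub_const (R + 1)).const_mul (-b)).exp.const_mul m).congr_deriv ?_
    simp only [hψdef, id]
    ring
  have hψA : ∀ r, 0 ≤ r → ψ r ≤ ψ 0 := fun r hr => by
    simp only [hψdef]
    gcongr m * Real.exp ?_
    nlinarith
  have hψm : ∀ r, r ≤ R + 1 → m ≤ ψ r := fun r hr => by
    refine le_mul_of_one_le_right hm.le (Real.one_le_exp ?_)
    nlinarith
  -- The barrier is at least `m` up to height `R + 1`, so `|u|` can exceed it only where `χ = 1`.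
  -- Derivatives of `χ` therefore never contribute.
  have hcase : ∀ᵐ x ∂L.vol C,
      (L.height x.1 x.2 ≤ R ∨ ‖u x.1 x.2‖ ≤ ψ (L.height x.1 x.2)) ∨
      (R + 1 < L.height x.1 x.2 ∧ ψ (L.height x.1 x.2) < ‖u x.1 x.2‖ ∧ ‖u x.1 x.2‖ ≤ m) := by
    filter_upwards [hR] with x hx
    by_cases h1 : L.height x.1 x.2 ≤ R
    · exact Or.inl (Or.inl h1)
    by_cases h2 : ‖u x.1 x.2‖ ≤ ψ (L.height x.1 x.2)
    · exact Or.inl (Or.inr h2)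
    · refine Or.inr ⟨?_, not_le.1 h2, hx (not_le.1 h1)⟩
      by_contra h3
      exact h2 ((hx (not_le.1 h1)).trans (hψm _ (not_lt.1 h3)))
  obtain ⟨hu, hp, hq, -, -⟩ := h.isH1D.1
  have hcut := isCutoff_abovePotential hχ hκ hψ hψ0
  have hpot0 := abovePotential_nonneg (ψ := ψ) hχ hκ hψ0
  have hGb := bounded_aboveCutoff hχ hκ hψ hψ' hψ0 hb0.le hψA
  obtain ⟨i1, i2, he⟩ := h.integral_energyDensity hGb (C := C)
    ⟨hC, Or.inr fun s => by simp [aboveCutoff, hχ.zero 0 hR0]⟩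
  set G : (Σ _ : K, ℝ × ℝ) → ℝ := fun x => aboveCutoff χ κ ψ (L.height x.1 x.2, ‖u x.1 x.2‖) with hG
  have hG0 : ∀ x, 0 ≤ G x := fun x => mul_nonneg (hχ.nonneg _) (hκ.nonneg _)
  have hG1 : ∀ x, G x ≤ 1 := fun x => mul_le_one₀ (hχ.le_one _) (hκ.nonneg _) (hκ.le_one _)
  have hmeas : AEStronglyMeasurable (fun x : Σ _ : K, ℝ × ℝ => (L.height x.1 x.2, ‖u x.1 x.2‖))
      (L.vol C) := measurable_height.stronglyMeasurable.aestronglyMeasurable.prodMk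
        (hu.memLp_vol C).1.norm
  have hu2 := (hu.memLp_vol C).norm.integrable_sq
  have i3 : Integrable (fun x => G x * ‖u x.1 x.2‖ ^ 2) (L.vol C) := by
    refine hu2.mono' ((hGb.isCutoff.contDiff.continuous.comp_aestronglyMeasurable hmeas).mul hu2.1)
      (Eventually.of_forall fun x => ?_)
    rw [Real.norm_of_nonneg (mul_nonneg (hG0 x) (sq_nonneg _))]
    exact mul_le_of_le_one_left (sq_nonneg _) (hG1 x)
  have i4 : Integrable (fun x : Σ _ : K, ℝ × ℝ => L.radial (abovePotential χ κ ψ) u x.1 x.2)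
      (L.vol C) := by
    refine i3.mono' (hcut.contDiff.continuous.comp_aestronglyMeasurable hmeas)
      (Eventually.of_forall fun x => ?_)
    rw [radial, Real.norm_of_nonneg (hpot0 _ _ (norm_nonneg _))]
    exact abovePotential_le hχ hκ hψ0 _ _
  have hwm : ∀ wt : K → ℝ, AEStronglyMeasurable (fun x : Σ _ : K, ℝ × ℝ => wt x.1) (L.vol C) :=
    fun wt => aestronglyMeasurable_vol fun k _ => aestronglyMeasurable_const (b := wt k)
  have i5 : Integrable (fun x : Σ _ : K, ℝ × ℝ => L.wt₁ x.1 *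
      L.radialDeriv (abovePotential χ κ ψ) L.wt₁ u p x.1 x.2) (L.vol C) := by
    refine Integrable.mono' (((integrable_norm_mul_norm hu hu).const_mul (b * (m * D + 2))).add
      ((integrable_norm_mul_norm hu hp).const_mul (m * D + 2)))
      ((hwm _).mul (aestronglyMeasurable_radialDeriv hu hp hcut _)) ?_
    filter_upwards [hcase] with x hx
    exact norm_radialDeriv_abovePotential_le hχ hκ hψ hψ' hψ0 hb0.le hm.le L.wt₁_nonneg
      L.wt₁_le_one hx
  have i6 : Integrable (fun x : Σ _ : K, ℝ × ℝ => L.wt₂ x.1 *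
      L.radialDeriv (abovePotential χ κ ψ) L.wt₂ u q x.1 x.2) (L.vol C) := by
    refine Integrable.mono' (((integrable_norm_mul_norm hu hu).const_mul (b * (m * D + 2))).add
      ((integrable_norm_mul_norm hu hq).const_mul (m * D + 2)))
      ((hwm _).mul (aestronglyMeasurable_radialDeriv hu hq hcut _)) ?_
    filter_upwards [hcase] with x hx
    exact norm_radialDeriv_abovePotential_le hχ hκ hψ hψ' hψ0 hb0.le hm.le L.wt₂_nonneg
      L.wt₂_le_one hx
  -- The orientations `true` and `false` stand for the first and the second direction.
  have n5 := integral_radialDeriv_nonpos h.isH1D.1 hcut hpot0 true i4 i5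
  have n6 := integral_radialDeriv_nonpos h.isH1D.1 hcut hpot0 false i4 i6
  have h1 : 0 ≤ ∫ x, (L.energyDensity (aboveCutoff χ κ ψ) u p q x +
      b * (L.wt₁ x.1 * L.radialDeriv (abovePotential χ κ ψ) L.wt₁ u p x.1 x.2 +
        L.wt₂ x.1 * L.radialDeriv (abovePotential χ κ ψ) L.wt₂ u q x.1 x.2) +
      2 * b ^ 2 * L.radial (abovePotential χ κ ψ) u x.1 x.2) ∂L.vol C := by
    refine integral_nonneg_of_ae ?_
    filter_upwards [hcase] with x hx
    exact energyDensity_aboveCutoff_nonneg hχ hκ hψ hψ' hψ0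
      (hx.imp_right fun hx => ⟨hx.1, hx.2.1⟩)
  rw [integral_add_mul_add_mul i1 i5 i6 i4, he] at h1
  have h2 : ∫ x, L.radial (abovePotential χ κ ψ) u x.1 x.2 ∂L.vol C ≤
      ∫ x, G x * ‖u x.1 x.2‖ ^ 2 ∂L.vol C :=
    integral_mono i4 i3 fun x => abovePotential_le hχ hκ hψ0 _ _
  have h3 : ∫ x, G x * ((‖u x.1 x.2‖ ^ (ϖ - 1) - ω) * ‖u x.1 x.2‖ ^ 2) ∂L.vol C ≤
      ∫ x, -(3 * b ^ 2) * (G x * ‖u x.1 x.2‖ ^ 2) ∂L.vol C := by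
    refine integral_mono_ae i2 (i3.const_mul _) ?_
    filter_upwards [hcase] with x hx
    rcases hx with hx | ⟨-, -, hx⟩
    · have : G x = 0 := (above_eq_zero hχ hκ hψ hψ' hx).1
      simp [this]
    · have h4 : ‖u x.1 x.2‖ ^ (ϖ - 1) ≤ b ^ 2 := by
        refine (Real.rpow_le_rpow (norm_nonneg _) hx (by linarith)).trans (hmω.trans ?_)
        linarith
      have h5 := mul_le_mul_of_nonneg_right h4 (mul_nonneg (hG0 x) (sq_nonneg ‖u x.1 x.2‖))
      rw [hb2]
      linarith
  rw [integral_const_mul] at h3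
  -- If `X` denotes this integral, the energy is at most `-3 b² X`, the potential at most `X` and
  -- its derivatives have nonpositive integrals. Hence `0 ≤ -3 b² X + 2 b² X = -b² X`.
  have h4 : ∫ x, G x * ‖u x.1 x.2‖ ^ 2 ∂L.vol C ≤ 0 := by
    have h5 := mul_le_mul_of_nonneg_left h2 (show 0 ≤ 2 * b ^ 2 by positivity)
    have h6 := mul_le_mul_of_nonneg_left (add_nonpos n5 n6) hb0.le
    simp only [cond_true, cond_false, wtB] at h6
    have h7 : 0 ≤ -(b ^ 2) * ∫ x, G x * ‖u x.1 x.2‖ ^ 2 ∂L.vol C := by linarith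
    by_contra h8
    have := mul_pos (show 0 < b ^ 2 by positivity) (not_le.1 h8)
    linarith
  have h5 : ∫ x, G x * ‖u x.1 x.2‖ ^ 2 ∂L.vol C = 0 :=
    le_antisymm h4 (integral_nonneg fun x => mul_nonneg (hG0 x) (sq_nonneg _))
  rw [integral_eq_zero_iff_of_nonneg (fun x => mul_nonneg (hG0 x) (sq_nonneg _)) i3] at h5
  filter_upwards [h5, hcase] with x hx hx' hxR
  rcases hx' with (hx' | hx') | ⟨hx1, hx2, -⟩
  · linarith
  · exact hx'
  -- Above the barrier both the cut-off and `|u|` are positive, so their product cannot vanish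
  -- there.
  · exfalso
    have h6 : 0 < G x := mul_pos (by rw [hχ.one _ hx1.le]; exact one_pos)
      (hκ.pos _ (by simpa using hx2))
    have h7 : 0 < ‖u x.1 x.2‖ := (hψ0 _).trans hx2
    have : G x * ‖u x.1 x.2‖ ^ 2 = 0 := hx
    have : 0 < G x * ‖u x.1 x.2‖ ^ 2 := by positivity
    linarith

end OpenBook

/-! ### Boundedness of `H²` functions -/

theorem IsVertPrimitive.enorm_sq_le {U g : ℝ × ℝ → ℂ} (h : IsVertPrimitive U g) (x : ℝ)
    {b : ℝ≥0∞} {d : ℝ} (hd : 0 < d) (hdb : ENNReal.ofReal d ≤ b) {y : ℝ} (hy : y ∈ closedRay b) :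
    ‖U (x, y)‖ₑ ^ 2 ≤
      ∫⁻ s in ray b, ((ENNReal.ofReal d⁻¹ + 1) * ‖U (x, s)‖ₑ ^ 2 + ‖g (x, s)‖ₑ ^ 2) := by
  have hF : ContDiff ℝ 1 fun z : ℝ × ℂ => ‖z.2‖ ^ 2 := contDiff_snd.norm_sq ℝ
  have hder : ∀ (r e : ℝ) (ξ η : ℂ),
      fderiv ℝ (fun z : ℝ × ℂ => ‖z.2‖ ^ 2) (r, ξ) (e, η) = 2 * inner ℝ ξ η := by
    intro r e ξ η
    have := (hasFDerivAt_snd (𝕜 := ℝ) (E := ℝ) (F := ℂ) (p := (r, ξ))).norm_sq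
    rw [this.fderiv]
    simp
    ring
  -- The bound along a line is applied to `|U|²`, whose derivative `2 ⟨U, g⟩` is split into squares.
  have h1 := (h.comp hF 0 0).enorm_le_lintegral x hd hdb hy
  simp only [hder] at h1
  rw [enorm_pow, enorm_norm] at h1
  refine h1.trans (lintegral_mono fun s => ?_)
  have h2 : ‖2 * inner ℝ (U (x, s)) (g (x, s))‖ₑ ≤ ‖U (x, s)‖ₑ ^ 2 + ‖g (x, s)‖ₑ ^ 2 := by
    rw [OpenBook.enorm_sq_eq_ofReal, OpenBook.enorm_sq_eq_ofReal,
      ← ENNReal.ofReal_add (by positivity) (by positivity), ← ofReal_norm]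
    refine ENNReal.ofReal_le_ofReal ?_
    rw [norm_mul, Real.norm_eq_abs, abs_two]
    have := norm_inner_le_norm (𝕜 := ℝ) (U (x, s)) (g (x, s))
    nlinarith [sq_nonneg (‖U (x, s)‖ - ‖g (x, s)‖)]
  simp only
  rw [enorm_pow, enorm_norm, add_mul, one_mul, add_assoc]
  exact add_le_add_right h2 _

namespace OpenBook

variable {J K : Type*} {L : OpenBook J K} {u p q w : K → ℝ × ℝ → ℂ}

/-- On almost every line through a page, an `H¹` function is bounded in terms of its norm on the
line. -/
theorem IsH1.exists_sq_bound (hu : L.IsH1 u p q) (o : Bool) (k : K) :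
    ∃ α : ℝ → ℝ≥0∞, Measurable α ∧
      (∀ᵐ z ∂volume.restrict (L.page k), ‖u k z‖ₑ ^ 2 ≤ α (turn o z).1) ∧
      ∫⁻ t in ray (L.lenA o k), α t < ∞ ∧
      ∃ c : ℝ≥0∞, c ≠ ∞ ∧ ∀ᵐ t ∂volume.restrict (ray (L.lenA o k)),
        α t = ∫⁻ s in ray (L.lenB o k),
          (c * ‖u k (turn o (t, s))‖ₑ ^ 2 + ‖(cond o p q) k (turn o (t, s))‖ₑ ^ 2) := by
  obtain ⟨U, g, hU, hUu, hg⟩ := hu.exists_isVertPrimitive o k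
  obtain ⟨d, hd, -, hdb⟩ := exists_ofReal_le (L.lenB_pos o k)
  set c : ℝ≥0∞ := ENNReal.ofReal d⁻¹ + 1 with hc
  have hcT : c ≠ ∞ := ENNReal.add_ne_top.2 ⟨ENNReal.ofReal_ne_top, ENNReal.one_ne_top⟩
  have hm : Measurable fun z => c * ‖U z‖ₑ ^ 2 + ‖g z‖ₑ ^ 2 :=
    ((hU.measU.enorm.pow_const 2).const_mul _).add (hU.measg.enorm.pow_const 2)
  refine ⟨fun t => ∫⁻ s in ray (L.lenB o k), (c * ‖U (t, s)‖ₑ ^ 2 + ‖g (t, s)‖ₑ ^ 2),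
    hm.lintegral_prod_right', ?_, ?_, c, hcT, ?_⟩
  · rw [L.ae_turn o k]
    filter_upwards [hUu, ae_restrict_mem (measurableSet_openRect _ _)] with z h1 h2
    rw [turn_turn, ← h1]
    exact hU.enorm_sq_le z.1 hd hdb ⟨h2.2.2.1.le, h2.2.2.2.le⟩
  · have e1 : ∫⁻ t in ray (L.lenA o k), ∫⁻ s in ray (L.lenB o k),
        (c * ‖U (t, s)‖ₑ ^ 2 + ‖g (t, s)‖ₑ ^ 2) =
        ∫⁻ z in openRect (L.lenA o k) (L.lenB o k), (c * ‖U z‖ₑ ^ 2 + ‖g z‖ₑ ^ 2) := by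
      rw [restrict_openRect, lintegral_prod _ hm.aemeasurable]
    have e2 : ∫⁻ z in openRect (L.lenA o k) (L.lenB o k), (c * ‖U z‖ₑ ^ 2 + ‖g z‖ₑ ^ 2) =
        ∫⁻ z in L.page k, (c * ‖u k z‖ₑ ^ 2 + ‖(cond o p q) k z‖ₑ ^ 2) := by
      rw [← L.lintegral_turn o k]
      refine lintegral_congr_ae ?_
      filter_upwards [hUu, hg] with z h1 h2
      rw [h1, h2]
    have hpq : MemLp ((cond o p q) k) 2 (volume.restrict (L.page k)) := by
      cases o
      · exact hu.2.2.1.memLp k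
      · exact hu.2.1.memLp k
    have h1 := memLp_two_iff_lintegral.1 (hu.1.memLp k)
    have h2 := memLp_two_iff_lintegral.1 hpq
    rw [e1, e2, lintegral_add_left' ((h1.1.enorm.pow_const 2).const_mul c),
      lintegral_const_mul' _ _ hcT]
    exact ENNReal.add_lt_top.2 ⟨ENNReal.mul_lt_top hcT.lt_top h1.2, h2.2⟩
  · rw [restrict_openRect] at hUu hg
    filter_upwards [Measure.ae_ae_of_ae_prod hUu, Measure.ae_ae_of_ae_prod hg] with t h1 h2
    refine lintegral_congr_ae ?_
    filter_upwards [h1, h2] with s h3 h4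
    rw [h3, h4]

/-- `H²` functions are bounded on every page. -/
theorem MemH2.exists_bound (hu : L.MemH2 u) (k : K) :
    ∃ B : ℝ, ∀ᵐ z ∂volume.restrict (L.page k), ‖u k z‖ ≤ B := by
  obtain ⟨p, q, hu, -, q₁, q₂, hq⟩ := hu
  obtain ⟨α, -, hα, -, c, hc, hαc⟩ := hu.exists_sq_bound false k
  obtain ⟨β, hβm, hβ, hβi, -⟩ := hu.exists_sq_bound true k
  obtain ⟨γ, -, hγ, hγi, -⟩ := hq.exists_sq_bound true k
  -- On a vertical line `|u|²` is bounded by the integral of `c |u|² + |q|²`. Both squares are in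
  -- turn bounded by integrable functions of the second coordinate alone, because `u` and `q` are in
  -- `H¹`; so the bound is uniform in the line.
  set E := ∫⁻ s in ray (L.lenB false k), (c * β s + γ s) with hE
  have hET : E < ∞ := by
    rw [hE, lintegral_add_left (hβm.const_mul c), lintegral_const_mul _ hβm]
    exact ENNReal.add_lt_top.2 ⟨ENNReal.mul_lt_top hc.lt_top hβi, hγi⟩
  have hαE : ∀ᵐ t ∂volume.restrict (ray (L.lenA false k)), α t ≤ E := by
    rw [L.ae_turn false k, restrict_openRect] at hβ hγ
    filter_upwards [hαc, Measure.ae_ae_of_ae_prod hβ, Measure.ae_ae_of_ae_prod hγ] with t h1 h2 h3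
    rw [h1]
    refine lintegral_mono_ae ?_
    filter_upwards [h2, h3] with s h4 h5
    exact add_le_add (mul_le_mul_right h4 c) h5
  have hαE' : ∀ᵐ z ∂volume.restrict (L.page k), α (turn false z).1 ≤ E := by
    rw [L.ae_turn false k, restrict_openRect]
    exact Measure.quasiMeasurePreserving_fst.ae hαE
  refine ⟨√E.toReal, ?_⟩
  filter_upwards [hα, hαE'] with z h1 h2
  refine Real.le_sqrt_of_sq_le ?_
  rw [← ENNReal.ofReal_le_iff_le_toReal hET.ne, ← enorm_sq_eq_ofReal]
  exact h1.trans h2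

/-! ### Exponential decay -/

theorem _root_.closedRay_subset_closure_ray {a : ℝ≥0∞} (ha : 0 < a) :
    closedRay a ⊆ closure (ray a) := by
  intro t ht
  by_cases h : a = ∞
  · rw [h, ray_top, closure_Ioi]
    exact ht.1
  · have h0 := ENNReal.toReal_pos ha.ne' h
    have hray : ray a = Ioo 0 a.toReal := by
      ext t
      exact and_congr_right fun ht => by rw [ENNReal.ofReal_lt_iff_lt_toReal ht.le h]
    rw [hray, closure_Ioo h0.ne]
    exact ⟨ht.1, (ENNReal.ofReal_le_iff_le_toReal h).1 ht.2⟩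

variable (L) in
theorem closedPage_subset_closure_page (k : K) : L.closedPage k ⊆ closure (L.page k) := by
  intro z hz
  rw [page, openRect_eq, closure_prod_eq]
  exact ⟨closedRay_subset_closure_ray (L.len₁_pos k) ⟨hz.1, hz.2.1⟩,
    closedRay_subset_closure_ray (L.len₂_pos k) ⟨hz.2.2.1, hz.2.2.2⟩⟩

variable (L) in
theorem isOpen_page (k : K) : IsOpen (L.page k) := by
  rw [page, openRect_eq]
  exact (isOpen_ray _).prod (isOpen_ray _)

/-- An almost everywhere bound by a continuous function holds at all points of continuity. -/
theorem boundedOnPage_of_ae {k : K} {f : ℝ × ℝ → ℂ} {b : ℝ × ℝ → ℝ} (hb : Continuous b)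
    (h : ∀ᵐ z ∂volume.restrict (L.page k), ‖f z‖ ≤ b z) : L.BoundedOnPage k f b := by
  refine ⟨h, fun g hg z hz hc => ?_⟩
  set S : Set (ℝ × ℝ) := L.page k ∩ {z | ‖g z‖ ≤ b z} with hS
  have hz' : z ∈ closure S := by
    rw [mem_closure_iff]
    intro O hO hzO
    obtain ⟨y, hy⟩ := mem_closure_iff.1 (L.closedPage_subset_closure_page k hz) O hO hzO
    by_contra hne
    rw [not_nonempty_iff_eq_empty] at hne
    have h1 : ∀ᵐ z ∂volume.restrict (L.page k), ‖g z‖ ≤ b z := by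
      filter_upwards [h, hg] with z h2 h3
      rwa [h3]
    rw [ae_restrict_iff' (L.measurableSet_page k)] at h1
    -- The page meets every neighbourhood of `z` in a nonempty open set, which has positive measure;
    -- hence the bound holds at points of the page arbitrarily close to `z`.
    have h2 : volume (O ∩ L.page k) = 0 := by
      refine measure_mono_null (fun x hx => ?_) h1
      simp only [mem_compl_iff, mem_ofPred_eq]
      intro h3
      have : x ∈ O ∩ S := ⟨hx.1, hx.2, h3 hx.2⟩
      rw [hne] at this
      exact this
    exact ((hO.inter (L.isOpen_page k)).measure_pos volume ⟨y, hy⟩).ne' h2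
  have := mem_closure_iff_nhdsWithin_neBot.1 hz'
  refine le_of_tendsto_of_tendsto ((hc.mono inter_subset_left).norm)
    (hb.continuousWithinAt (s := S)) ?_
  filter_upwards [self_mem_nhdsWithin] with x hx
  exact hx.2

theorem IsSolution.boundedOnPage [Countable K] {ω ϖ : ℝ} (h : L.IsSolution ω ϖ u p q w)
    (hω : 0 < ω) (hϖ : 1 < ϖ) {k : K} (hB : ∃ B : ℝ, ∀ᵐ z ∂volume.restrict (L.page k), ‖u k z‖ ≤ B)
    {o : Bool} (ho : L.lenA o k = ∞) : ∃ M : ℝ, 0 < M ∧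
      L.BoundedOnPage k (u k) fun z => M * Real.exp (-(√ω / 2) * |(turn o z).1|) := by
  obtain ⟨B, hB⟩ := hB
  -- This is the largest level at which the nonlinear coefficient is at most `ω / 4`.
  set m := (ω / 4) ^ (ϖ - 1)⁻¹ with hmdef
  have hm : 0 < m := by positivity
  have hmω : m ^ (ϖ - 1) ≤ ω / 4 := by
    rw [hmdef, Real.rpow_inv_rpow (by positivity) (by linarith)]
  obtain ⟨R, hR0, hR⟩ := h.exists_radius ho hm
  have hdecay := ae_vol.1 (h.ae_le_exp hω hϖ mem_component_of_incident hR0 hm hmω hR) k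
    Relation.ReflTransGen.refl
  set b := √ω / 2 with hb
  have hb0 : 0 ≤ b := by positivity
  -- The exponential factor makes the claimed bound at least `|B| + m` wherever the height is at
  -- most `R + 1`, where only boundedness is known.
  refine ⟨(|B| + m) * Real.exp (b * (R + 1)), by positivity, boundedOnPage_of_ae ?_ ?_⟩
  · have : Continuous fun z => (turn o z).1 := by
      cases o
      · exact continuous_fst
      · exact continuous_snd
    fun_prop
  · have hdecay' := (L.ae_turn o k).1 hdecay
    have hB' := (L.ae_turn o k).1 hB
    rw [L.ae_turn o k]
    filter_upwards [hdecay', hB', ae_restrict_mem (measurableSet_openRect _ _)] with z h1 h2 h3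
    have hz1 : 0 < z.1 := h3.1
    have hz2 : 0 < z.2 := h3.2.2.1
    have hwB : 0 ≤ L.wtB o k := by
      cases o
      · exact L.wt₂_nonneg k
      · exact L.wt₁_nonneg k
    -- The height dominates each infinite coordinate, so decay in the height gives decay in the
    -- coordinate.
    have hle : z.1 ≤ L.height k (turn o z) := by
      rw [height_turn, L.wtA_of_top ho, one_mul]
      linarith [mul_nonneg hwB hz2.le]
    rw [turn_turn, abs_of_pos hz1, mul_assoc, ← Real.exp_add]
    by_cases h4 : R + 1 < L.height k (turn o z)
    · refine (h1 h4).trans ?_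
      have h5 : -b * (L.height k (turn o z) - (R + 1)) ≤ b * (R + 1) + -b * z.1 := by nlinarith
      gcongr
      linarith [abs_nonneg B]
    · have h5 : 1 ≤ Real.exp (b * (R + 1) + -b * z.1) := Real.one_le_exp (by nlinarith)
      calc ‖u k (turn o z)‖ ≤ |B| + m := by linarith [le_abs_self B]
        _ ≤ _ := le_mul_of_one_le_right (by positivity) h5

end OpenBook

theorem mainTheorem3 {J K : Type*} [Countable J] [Countable K] (L : OpenBook J K)
    (ω p : ℝ) (hω : 0 < ω) (hp : 1 < p) (u : K → ℝ × ℝ → ℂ) (hu : L.SolvesNLS ω p u)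
    (hreg : 0 < L.minLength ∨ L.MemH2 u) (k : K) :
    (L.len₁ k = ⊤ → ∃ M : ℝ, 0 < M ∧
      L.BoundedOnPage k (u k) fun z => M * Real.exp (-(Real.sqrt ω / 2) * |z.1|)) ∧
    (L.len₂ k = ⊤ → ∃ M : ℝ, 0 < M ∧
      L.BoundedOnPage k (u k) fun z => M * Real.exp (-(Real.sqrt ω / 2) * |z.2|)) := by
  obtain ⟨p', q', w, h⟩ := hu.exists_isSolution
  -- The alternative in the hypothesis serves only to bound `u` on this one page.
  have hB : ∃ B : ℝ, ∀ᵐ z ∂volume.restrict (L.page k), ‖u k z‖ ≤ B :=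
    hreg.elim (fun hL => h.exists_bound hL k) fun hH => hH.exists_bound k
  exact ⟨fun h₁ => h.boundedOnPage hω hp hB (o := false) h₁,
    fun h₂ => h.boundedOnPage hω hp hB (o := true) h₂⟩
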